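/- Let $n\in\{1,2,\dots,\infty\}$ and let $\mathcal{TO}_n$ be the universal unital $C^*$-algebra generated by $n$ isometries $v_1,v_2,\dots$ with mutually orthogonal ranges (so $\mathcal{TO}_\infty=\mathcal O_\infty$). For a word $\mu=(i_1,\dots,i_k)$ put $v_\mu=v_{i_1}\cdots v_{i_k}$ and $|\mu|=k$; $\mathcal W_k$ denotes the set of words of length $k$. Let $F$ be the Hilbert space with orthonormal basis $\{e_\mu\}$ indexed by all words (full Fock space over an $n$-dimensional Hilbert space). Define isometries on $F$ by $l(v_i)e_\mu=e_{i\mu}$ and $r(v_i)e_\mu=e_{\mu i}$, and let $l:\mathcal{TO}_n\to B(F)$ be the resulting (Fock) representation. Put $$\beta(A)=\sum_{i} r(v_i)A\,r(v_i)^*,\qquad \delta=\mathrm{id}-\beta,\qquad E_k=\beta^k(I)-\beta^{k+1}(I),\qquad P_k=I-\beta^{k+1}(I),$$ $\mathfrak B_k=\{T\in B(F):T=P_kTP_k\}$, $\mathfrak B=\bigcup_k\mathfrak B_k$, and $\lambda(B)=\sum_{i\ge0}\beta^i(B)$ for $B\in\mathfrak B$; then $\delta(\lambda(B))=B$. Let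 $\mathcal K$ be the ideal of compact operators on $F$ in the unital $C^*$-algebra $\overline{\lambda(\mathfrak B)}$, which also contains $l(\mathcal{TO}_n)$. A linear functional $\omega$ on $\mathfrak B$ is positive if $\omega(B^*B)\ge0$ for all $B\in\mathfrak B$, decreasing if $\omega\circ\delta$ is positive on $\mathfrak B$, and locally normal if its restriction to each $\mathfrak B_k$ is normal. If $\omega$ is a decreasing locally normal positive linear functional, then so is $\omega\circ\beta$, and $\omega\circ\delta$ extends uniquely from $\lambda(\mathfrak B)$ to a positive linear functional $\Delta\omega$ on $\overline{\lambda(\mathfrak B)}$. Moreover there are unique trace-class operators $T_k\in\mathfrak B_k$ with $\omega(B)=\mathrm{tr}(T_kB)$ for $B\in\mathfrak B_k$; the density matrix of $\omega$ is $\Omega=(\Omega_{ij})_{i,j\ge0}$ with $\Omega_{ij}=E_iT_kE_j$ for any $k\ge i,j$. For a trace-class operator $T$ let $\mathrm{slice}(T)=\sum_i r(v_i)^*T\,r(v_i)$, and let $\mathrm{slice}(\Omega)=(\mathrm{slice}(\Omega_{i+1,j+1}))_{i,j}$. Let $\rho$ be a positive linear functional on $\mathcal{TO}_n$, with GNS representation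 $\pi$. It is called essential if $\sum_i\pi(v_iv_i^*)=I$ strongly, and singular if $\sum_{\mu\in\mathcal W_k}\pi(v_\mu v_\mu^*)\to0$ strongly as $k\to\infty$. A positive linear functional on $\overline{\lambda(\mathfrak B)}$ is called $\mathcal K$-singular if it vanishes on $\mathcal K$, and $\mathcal K$-essential if the restriction of its GNS representation to $\mathcal K$ is nondegenerate. **Proposition.** There is a unique decreasing locally normal positive linear functional $\omega$ on $\mathfrak B$ such that $\rho=\Delta\omega\circ l$. Let $\Omega$ be its density matrix, and let $\beta^*\rho=\Delta(\omega\circ\beta)\circ l$. The following are equivalent: (1a) $\rho$ is essential; (1b) $\omega(E_k)$ is constant in $k$; (1c) $\omega(\delta(B))=0$ for every $B\in\mathfrak B$; (1d) $\Delta\omega$ is $\mathcal K$-singular; (1e) $\mathrm{slice}(\Omega)=\Omega$; (1f) $\rho=\beta^*\rho$. The following are also equivalent: (2a) $\rho$ is singular; (2b) $\lim_{k\to\infty}\omega(E_k)=0$; (2c) $\rho$ is normal in the Fock representation, i.e. $\rho=\varphi\circ l$ for some normal linear functional $\varphi$ on $B(F)$; (2d) $\Delta\omega$ is $\mathcal K$-essential.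 -/

import Mathlib

open scoped ComplexOrder InnerProductSpace ENNReal
open Filter Topology

namespace ToeplitzCuntz

noncomputable section

/-- A family of isometries `w i` with mutually orthogonal ranges in a (nonzero) unital
C⋆-algebra `B`. -/
structure IsometryFamily (ι : Type) : Type 1 where
  B : Type
  [cstar : CStarAlgebra B]
  [nontriv : Nontrivial B]
  w : ι → B
  isom : ∀ i, star (w i) * w i = 1
  orth : ∀ i j, i ≠ j → star (w i) * w j = 0

attribute [instance] IsometryFamily.cstar IsometryFamily.nontriv

variable {ι : Type}

lemma IsometryFamily.norm_le_one (R : IsometryFamily ι) (i : ι) : ‖R.w i‖ ≤ 1 := by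
  have h := CStarRing.norm_star_mul_self (x := R.w i)
  rw [R.isom i, CStarRing.norm_one] at h
  nlinarith [norm_nonneg (R.w i)]

/-- The C⋆-algebra of bounded families `(b_R)`, indexed by all families of isometries. -/
abbrev Ambient (ι : Type) : Type 1 := lp (fun R : IsometryFamily ι => R.B) ∞

instance instCStarAlgebraAmbient : CStarAlgebra (Ambient ι) where

/-- The direct sum of the `i`-th isometries of all families of isometries. -/
def ambientGen (i : ι) : Ambient ι :=
  ⟨fun R => R.w i, memℓp_infty ⟨1, by rintro _ ⟨R, rfl⟩; exact R.norm_le_one i⟩⟩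

/-- Evaluation of a bounded family at one index. -/
def ambientEval (R : IsometryFamily ι) : Ambient ι →⋆ₐ[ℂ] R.B where
  toFun x := x R
  map_one' := rfl
  map_mul' _ _ := rfl
  map_zero' := rfl
  map_add' _ _ := rfl
  commutes' _ := rfl
  map_star' _ := rfl

lemma continuous_ambientEval (R : IsometryFamily ι) : Continuous (ambientEval R) :=
  (lp.evalCLM ℂ (fun R : IsometryFamily ι => R.B) ∞ R).continuous

/-- The unital C⋆-subalgebra generated by a subset of a C⋆-algebra. -/
def generated {A : Type*} [CStarAlgebra A] (S : Set A) : StarSubalgebra ℂ A :=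
  (StarAlgebra.adjoin ℂ S).topologicalClosure

lemma isClosed_generated {A : Type*} [CStarAlgebra A] (S : Set A) :
    IsClosed (generated S : Set A) := StarSubalgebra.isClosed_topologicalClosure _

lemma subset_generated {A : Type*} [CStarAlgebra A] (S : Set A) : S ⊆ generated S :=
  (StarAlgebra.subset_adjoin ℂ S).trans (StarSubalgebra.le_topologicalClosure _)

lemma generated_le {A : Type*} [CStarAlgebra A] {S : Set A} {T : StarSubalgebra ℂ A}
    (hS : S ⊆ T) (hT : IsClosed (T : Set A)) : generated S ≤ T :=
  StarSubalgebra.topologicalClosure_minimal (StarAlgebra.adjoin_le hS) hT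

/-- The unital C⋆-subalgebra generated by a subset of a C⋆-algebra, as a type. -/
def Generated {A : Type*} [CStarAlgebra A] (S : Set A) : Type _ := generated S

instance {A : Type*} [CStarAlgebra A] (S : Set A) : CStarAlgebra (Generated S) :=
  letI : IsClosed (generated S : Set A) := isClosed_generated S
  inferInstanceAs (CStarAlgebra (generated S))

/-- The order in which the positive elements are those of the form `star x * x`. -/
instance {A : Type*} [CStarAlgebra A] (S : Set A) : PartialOrder (Generated S) :=
  CStarAlgebra.spectralOrder _

instance {A : Type*} [CStarAlgebra A] (S : Set A) : StarOrderedRing (Generated S) :=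
  CStarAlgebra.spectralOrderedRing _

/-- The inclusion of a generated C⋆-subalgebra. -/
def Generated.incl {A : Type*} [CStarAlgebra A] {S : Set A} : Generated S →⋆ₐ[ℂ] A :=
  (generated S).subtype

/-- A `*`-homomorphism with values in a generated C⋆-subalgebra. -/
def Generated.codRestrict {A B : Type*} [CStarAlgebra A] [CStarAlgebra B] {S : Set A}
    (f : B →⋆ₐ[ℂ] A) (hf : ∀ x, f x ∈ generated S) : B →⋆ₐ[ℂ] Generated S :=
  f.codRestrict (generated S) hf

open scoped CStarAlgebra in
lemma Generated.hom_ext {A B : Type*} [CStarAlgebra A] [CStarAlgebra B] {S : Set A}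
    {f g : Generated S →⋆ₐ[ℂ] B}
    (h : ∀ x (hx : x ∈ S), f ⟨x, subset_generated S hx⟩ = g ⟨x, subset_generated S hx⟩) :
    f = g := by
  have key : ∀ f g : generated S →⋆ₐ[ℂ] B, Continuous f → Continuous g →
      (∀ x (hx : x ∈ S), f ⟨x, subset_generated S hx⟩ = g ⟨x, subset_generated S hx⟩) →
      f = g := by
    intro f g hf hg h
    refine StarAlgHom.ext_topologicalClosure hf hg ?_
    refine StarAlgHom.ext_adjoin ?_
    rintro ⟨x, _⟩ hx
    exact h x hx
  have h1 : Continuous f := map_continuous f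
  have h2 : Continuous g := map_continuous g
  exact key f g h1 h2 h

/-- The Toeplitz-Cuntz algebra: the universal unital C⋆-algebra generated by isometries `v i`,
`i ∈ ι`, with mutually orthogonal ranges. For `ι` of cardinality `n` this is `TO_n`; for `ι`
countably infinite it is the Cuntz algebra `O_∞`. The universal property is
`TO.existsUnique_hom` below. (The algebra is separable for countable `ι`, so that
families of isometries in C⋆-algebras in `Type` exhaust all families up to isomorphism.) -/
abbrev TO (ι : Type) : Type 1 := Generated (Set.range (ambientGen (ι := ι)))

/-- The distinguished generating isometries of the Toeplitz-Cuntz algebra. -/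
def TO.v (i : ι) : TO ι := ⟨ambientGen i, subset_generated _ ⟨i, rfl⟩⟩

/-- The `*`-homomorphism from the Toeplitz-Cuntz algebra which is determined by a family of
isometries with mutually orthogonal ranges. -/
def TO.lift (R : IsometryFamily ι) : TO ι →⋆ₐ[ℂ] R.B := (ambientEval R).comp Generated.incl

lemma TO.lift_v (R : IsometryFamily ι) (i : ι) : TO.lift R (TO.v i) = R.w i := rfl

lemma TO.ext {x y : TO ι} (h : ∀ R, TO.lift R x = TO.lift R y) : x = y := by
  apply Subtype.ext
  apply lp.ext
  funext R
  exact h R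

lemma TO.star_v_mul_v (i : ι) : star (TO.v i) * TO.v i = 1 :=
  TO.ext fun R => by rw [map_mul, map_star, map_one, TO.lift_v, R.isom]

lemma TO.star_v_mul_v_of_ne {i j : ι} (h : i ≠ j) : star (TO.v i) * TO.v j = 0 :=
  TO.ext fun R => by rw [map_mul, map_star, map_zero, TO.lift_v, TO.lift_v, R.orth i j h]

/-- The universal property of the Toeplitz-Cuntz algebra. -/
theorem TO.existsUnique_hom (R : IsometryFamily ι) :
    ∃! φ : TO ι →⋆ₐ[ℂ] R.B, ∀ i, φ (TO.v i) = R.w i := by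
  refine ⟨TO.lift R, TO.lift_v R, fun φ hφ => Generated.hom_ext ?_⟩
  rintro _ ⟨i, rfl⟩
  exact hφ i

/-- The product `v_μ = v_{i_1} ⋯ v_{i_k}` for a multi-index `μ = (i_1, …, i_k)`. -/
def TO.word (μ : List ι) : TO ι := (μ.map TO.v).prod


/-- Full Fock space over `ℓ²(ι)`, with the words `μ` in the alphabet `ι` as orthonormal basis.
The words of length `k` span the summand `𝓔_k`. -/
abbrev Fock (ι : Type) : Type := lp (fun _ : List ι => ℂ) 2

/-- The algebra of bounded operators on Fock space. -/
abbrev BFock (ι : Type) : Type := Fock ι →L[ℂ] Fock ι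

/-! Shortcuts for instance search. -/

section Shortcuts

instance : NormedAddCommGroup (Fock ι) := inferInstance
instance : AddCommGroup (Fock ι) := inferInstance
instance : AddCommMonoid (Fock ι) := inferInstance
instance : UniformSpace (Fock ι) := inferInstance
instance : TopologicalSpace (Fock ι) := inferInstance
instance : T2Space (Fock ι) := inferInstance
instance : Module ℂ (Fock ι) := inferInstance
instance : Ring (BFock ι) := inferInstance
instance : Semiring (BFock ι) := inferInstance
instance : AddCommGroup (BFock ι) := inferInstance
instance : AddCommMonoid (BFock ι) := inferInstance
instance : Module ℂ (BFock ι) := inferInstance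
instance : Algebra ℂ (BFock ι) := inferInstance

end Shortcuts

/-- The basis vector of Fock space which belongs to a word. -/
def basisVec (μ : List ι) : Fock ι :=
  letI := Classical.decEq (List ι)
  lp.single 2 μ (1 : ℂ)

lemma inner_basisVec_left (μ : List ι) (x : Fock ι) : ⟪basisVec μ, x⟫_ℂ = x μ := by
  classical
  simp [basisVec, lp.inner_single_left]

lemma norm_basisVec (μ : List ι) : ‖basisVec μ‖ = 1 := by
  classical
  simp [basisVec, lp.norm_single]

lemma basisVec_apply_self (μ : List ι) : basisVec μ μ = 1 := by
  classical
  simp [basisVec]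

lemma basisVec_apply_of_ne {μ ν : List ι} (h : μ ≠ ν) : basisVec μ ν = 0 := by
  let _ := Classical.decEq (List ι)
  exact lp.single_apply_ne (E := fun _ : List ι => ℂ) 2 μ (1 : ℂ) h.symm

lemma orthonormal_basisVec : Orthonormal ℂ (basisVec (ι := ι)) :=
  ⟨norm_basisVec, fun μ ν h => by
    exact (inner_basisVec_left μ (basisVec ν)).trans (basisVec_apply_of_ne h.symm)⟩

lemma clm_ext {E : Type*} [NormedAddCommGroup E] [NormedSpace ℂ E] {S T : Fock ι →L[ℂ] E}
    (h : ∀ μ, S (basisVec μ) = T (basisVec μ)) : S = T := by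
  let _ := Classical.decEq (List ι)
  refine lp.ext_continuousLinearMap (by norm_num) fun μ => ?_
  ext
  exact h μ

lemma orthonormal_basisVec_comp {f : List ι → List ι} (hf : Function.Injective f) :
    Orthonormal ℂ (fun μ => basisVec (f μ)) :=
  orthonormal_basisVec.comp f hf

/-- The isometry of Fock space which maps the basis vector of `μ` to that of `f μ`. -/
def wordIso (f : List ι → List ι) (hf : Function.Injective f) : Fock ι →ₗᵢ[ℂ] Fock ι :=
  (orthonormal_basisVec_comp hf).orthogonalFamily.linearIsometry

lemma wordIso_basisVec (f : List ι → List ι) (hf : Function.Injective f) (μ : List ι) :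
    wordIso f hf (basisVec μ) = basisVec (f μ) := by
  let _ := Classical.decEq (List ι)
  have := (orthonormal_basisVec_comp hf).orthogonalFamily.linearIsometry_apply_single
    (i := μ) (1 : ℂ)
  simp only [LinearIsometry.toSpanSingleton_apply, one_smul] at this
  exact this

/-- The isometry `l(v_i)` of Fock space: left multiplication by `v_i`. -/
def leftCreation (i : ι) : BFock ι :=
  (wordIso (fun μ => i :: μ) (List.cons_injective)).toContinuousLinearMap

lemma append_singleton_injective (i : ι) : Function.Injective (fun μ : List ι => μ ++ [i]) :=
  fun _ _ h => List.append_cancel_right h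

/-- Right multiplication by `v_i`, as a linear isometry. -/
def rightIso (i : ι) : Fock ι →ₗᵢ[ℂ] Fock ι :=
  wordIso (fun μ => μ ++ [i]) (append_singleton_injective i)

/-- The isometry `r(v_i)` of Fock space: right multiplication by `v_i`. -/
def rightCreation (i : ι) : BFock ι := (rightIso i).toContinuousLinearMap

lemma leftCreation_basisVec (i : ι) (μ : List ι) :
    leftCreation i (basisVec μ) = basisVec (i :: μ) :=
  wordIso_basisVec (fun μ => i :: μ) List.cons_injective μ

lemma rightCreation_basisVec (i : ι) (μ : List ι) :
    rightCreation i (basisVec μ) = basisVec (μ ++ [i]) :=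
  wordIso_basisVec (fun μ => μ ++ [i]) (append_singleton_injective i) μ

lemma star_apply_coord (T : BFock ι) (x : Fock ι) (μ : List ι) :
    (star T x : Fock ι) μ = ⟪T (basisVec μ), x⟫_ℂ := by
  rw [← inner_basisVec_left, ContinuousLinearMap.star_eq_adjoint,
    ContinuousLinearMap.adjoint_inner_right]

lemma star_leftCreation_mul_self (i : ι) : star (leftCreation i) * leftCreation i = 1 := by
  ext x : 1
  apply ext_inner_left ℂ
  intro y
  simp only [mul_apply_eq_comp, ContinuousLinearMap.star_eq_adjoint,
    ContinuousLinearMap.adjoint_inner_right, one_apply_eq_self]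
  exact (wordIso (fun μ => i :: μ) List.cons_injective).inner_map_map y x

lemma star_rightCreation_mul_self (i : ι) : star (rightCreation i) * rightCreation i = 1 := by
  ext x : 1
  apply ext_inner_left ℂ
  intro y
  simp only [mul_apply_eq_comp, ContinuousLinearMap.star_eq_adjoint,
    ContinuousLinearMap.adjoint_inner_right, one_apply_eq_self]
  exact (rightIso i).inner_map_map y x

lemma star_leftCreation_mul_of_ne {i j : ι} (h : i ≠ j) :
    star (leftCreation i) * leftCreation j = 0 := by
  refine clm_ext fun μ => lp.ext (funext fun ν => ?_)
  rw [mul_apply_eq_comp, star_apply_coord, leftCreation_basisVec,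
    leftCreation_basisVec, inner_basisVec_left, basisVec_apply_of_ne]
  · rfl
  · simp [h.symm]

lemma star_rightCreation_mul_of_ne {i j : ι} (h : i ≠ j) :
    star (rightCreation i) * rightCreation j = 0 := by
  refine clm_ext fun μ => lp.ext (funext fun ν => ?_)
  rw [mul_apply_eq_comp, star_apply_coord, rightCreation_basisVec,
    rightCreation_basisVec, inner_basisVec_left, basisVec_apply_of_ne]
  · rfl
  · simp [h.symm]

instance : Nontrivial (BFock ι) :=
  ⟨⟨0, 1, fun h => by
    have h2 := congrArg (fun T : BFock ι => T (basisVec [])) h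
    have h3 : basisVec ([] : List ι) = 0 := h2.symm
    have h4 := norm_basisVec ([] : List ι)
    rw [h3, norm_zero] at h4
    exact zero_ne_one h4⟩⟩

/-- The left creation operators, as a family of isometries with mutually orthogonal ranges. -/
def fockFamily (ι : Type) : IsometryFamily ι where
  B := BFock ι
  w := leftCreation
  isom := star_leftCreation_mul_self
  orth _ _ := star_leftCreation_mul_of_ne

/-- The Fock representation of the Toeplitz-Cuntz algebra. -/
def fockRep (ι : Type) : TO ι →⋆ₐ[ℂ] BFock ι := TO.lift (fockFamily ι)

lemma fockRep_v (i : ι) : fockRep ι (TO.v i) = leftCreation i := rfl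

/-! ### The endomorphism `β` -/

lemma orthogonalFamily_rightIso :
    OrthogonalFamily ℂ (fun _ : ι => Fock ι) (fun i => rightIso i) := by
  intro i j h x y
  have h1 : ⟪x, (star (rightCreation i) * rightCreation j) y⟫_ℂ = 0 := by
    rw [star_rightCreation_mul_of_ne h]; simp
  rwa [mul_apply_eq_comp, ContinuousLinearMap.star_eq_adjoint,
    ContinuousLinearMap.adjoint_inner_right] at h1

lemma sum_norm_sq_star_rightCreation_le (x : Fock ι) (s : Finset ι) :
    ∑ i ∈ s, ‖star (rightCreation i) x‖ ^ 2 ≤ ‖x‖ ^ 2 := by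
  set S := ∑ i ∈ s, ‖star (rightCreation i) x‖ ^ 2 with hS
  have h0 : 0 ≤ S := Finset.sum_nonneg fun _ _ => sq_nonneg _
  set y := ∑ i ∈ s, rightIso i (star (rightCreation i) x) with hy
  have hn : ‖y‖ ^ 2 = S := orthogonalFamily_rightIso.norm_sum _ s
  have hi : ⟪y, x⟫_ℂ = (S : ℂ) := by
    rw [hy, sum_inner, hS, Complex.ofReal_sum]
    refine Finset.sum_congr rfl fun i _ => ?_
    have : ⟪rightIso i (star (rightCreation i) x), x⟫_ℂ
        = ⟪star (rightCreation i) x, star (rightCreation i) x⟫_ℂ := by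
      rw [ContinuousLinearMap.star_eq_adjoint, ContinuousLinearMap.adjoint_inner_right]; rfl
    rw [this, inner_self_eq_norm_sq_to_K]
    simp
  have hle : S ≤ ‖y‖ * ‖x‖ := by
    have := norm_inner_le_norm (𝕜 := ℂ) y x
    rwa [hi, Complex.norm_real, Real.norm_of_nonneg h0] at this
  nlinarith [norm_nonneg y, norm_nonneg x, sq_nonneg (‖y‖ - ‖x‖)]

lemma sum_norm_sq_mul_star_rightCreation_le (A : BFock ι) (x : Fock ι) (s : Finset ι) :
    ∑ i ∈ s, ‖A (star (rightCreation i) x)‖ ^ 2 ≤ ‖A‖ ^ 2 * ‖x‖ ^ 2 := by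
  calc ∑ i ∈ s, ‖A (star (rightCreation i) x)‖ ^ 2
      ≤ ∑ i ∈ s, ‖A‖ ^ 2 * ‖star (rightCreation i) x‖ ^ 2 := by
        refine Finset.sum_le_sum fun i _ => ?_
        rw [← mul_pow]
        exact pow_le_pow_left₀ (norm_nonneg _) (A.le_opNorm _) 2
    _ ≤ _ := by
        rw [← Finset.mul_sum]
        exact mul_le_mul_of_nonneg_left (sum_norm_sq_star_rightCreation_le x s) (sq_nonneg _)

lemma summable_beta (A : BFock ι) (x : Fock ι) :
    Summable fun i => rightCreation i (A (star (rightCreation i) x)) := by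
  refine (orthogonalFamily_rightIso.summable_iff_norm_sq_summable
    (fun i => A (star (rightCreation i) x))).2 ?_
  exact summable_of_sum_le (fun _ => sq_nonneg _) (sum_norm_sq_mul_star_rightCreation_le A x)

lemma norm_tsum_beta_le (A : BFock ι) (x : Fock ι) :
    ‖∑' i, rightCreation i (A (star (rightCreation i) x))‖ ≤ ‖A‖ * ‖x‖ := by
  refine le_of_tendsto ((summable_beta A x).hasSum.norm) (Eventually.of_forall fun s => ?_)
  have h1 : ‖∑ i ∈ s, rightCreation i (A (star (rightCreation i) x))‖ ^ 2
      = ∑ i ∈ s, ‖A (star (rightCreation i) x)‖ ^ 2 :=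
    orthogonalFamily_rightIso.norm_sum (fun i => A (star (rightCreation i) x)) s
  refine le_of_sq_le_sq ?_ (by positivity)
  rw [h1, mul_pow]
  exact sum_norm_sq_mul_star_rightCreation_le A x s

/-- The bounded operator `β(A) = ∑ i, r(v_i) A r(v_i)*`, the sum being taken in the strong
operator topology. -/
def betaFun (A : BFock ι) : BFock ι :=
  LinearMap.mkContinuous
    { toFun := fun x => ∑' i, rightCreation i (A (star (rightCreation i) x))
      map_add' := fun x y => by
        simp only [map_add]
        exact (summable_beta A x).tsum_add (summable_beta A y)
      map_smul' := fun c x => by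
        simp only [map_smul, RingHom.id_apply]
        exact (summable_beta A x).tsum_const_smul c }
    ‖A‖ (norm_tsum_beta_le A)

lemma hasSum_betaFun (A : BFock ι) (x : Fock ι) :
    HasSum (fun i => rightCreation i (A (star (rightCreation i) x))) (betaFun A x) :=
  (summable_beta A x).hasSum

lemma star_rightCreation_apply_rightCreation (i : ι) (x : Fock ι) :
    star (rightCreation i) (rightCreation i x) = x :=
  congrArg (fun T : BFock ι => T x) (star_rightCreation_mul_self i)

lemma star_rightCreation_apply_of_ne {i j : ι} (h : i ≠ j) (x : Fock ι) :
    star (rightCreation i) (rightCreation j x) = 0 :=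
  congrArg (fun T : BFock ι => T x) (star_rightCreation_mul_of_ne h)

lemma betaFun_rightCreation (A : BFock ι) (i : ι) (x : Fock ι) :
    betaFun A (rightCreation i x) = rightCreation i (A x) := by
  refine (hasSum_betaFun A _).unique ?_
  have := hasSum_single (f := fun j => rightCreation j
    (A (star (rightCreation j) (rightCreation i x)))) i (fun j hj => by
      simp only [star_rightCreation_apply_of_ne hj, map_zero])
  simpa only [star_rightCreation_apply_rightCreation] using this

/-- The normal `*`-endomorphism `β` of the algebra of bounded operators on Fock space,
`β(A) = ∑ i, r(v_i) A r(v_i)*`. -/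
def beta : BFock ι →⋆ₙₐ[ℂ] BFock ι where
  toFun := betaFun
  map_smul' c A := by
    ext x : 1
    refine (hasSum_betaFun (c • A) x).unique ?_
    have := (hasSum_betaFun A x).const_smul c
    simpa only [smul_apply, map_smul, MonoidHom.id_apply] using this
  map_zero' := by
    ext x : 1
    refine (hasSum_betaFun 0 x).unique ?_
    simp only [zero_apply, map_zero]
    exact hasSum_zero
  map_add' A B := by
    ext x : 1
    refine (hasSum_betaFun (A + B) x).unique ?_
    have := (hasSum_betaFun A x).add (hasSum_betaFun B x)
    simpa only [add_apply, map_add] using this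
  map_mul' A B := by
    ext x : 1
    refine (hasSum_betaFun (A * B) x).unique ?_
    have := (hasSum_betaFun B x).mapL (betaFun A)
    simpa only [betaFun_rightCreation, mul_apply_eq_comp] using this
  map_star' A := by
    ext x : 1
    apply ext_inner_left ℂ
    intro y
    rw [ContinuousLinearMap.star_eq_adjoint (betaFun A), ContinuousLinearMap.adjoint_inner_right]
    have h1 := (hasSum_betaFun (star A) x).mapL (innerSL ℂ y)
    have h2 := (hasSum_betaFun A y).mapL (innerSL ℂ x)
    have h3 := (Complex.hasSum_conj'.2 h2)
    simp only [innerSL_apply_apply] at h1 h3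
    rw [inner_conj_symm] at h3
    have e : ∀ i, ⟪y, rightCreation i (star A (star (rightCreation i) x))⟫_ℂ
        = starRingEnd ℂ ⟪x, rightCreation i (A (star (rightCreation i) y))⟫_ℂ := fun i => by
      rw [inner_conj_symm, ContinuousLinearMap.star_eq_adjoint, ContinuousLinearMap.star_eq_adjoint,
        ← ContinuousLinearMap.adjoint_inner_left, ContinuousLinearMap.adjoint_inner_right,
        ContinuousLinearMap.adjoint_inner_right]
    simp only [e] at h1
    exact h1.unique h3

lemma hasSum_beta (A : BFock ι) (x : Fock ι) :
    HasSum (fun i => rightCreation i (A (star (rightCreation i) x))) (beta A x) :=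
  hasSum_betaFun A x

lemma beta_basisVec_nil (A : BFock ι) : beta A (basisVec []) = 0 := by
  refine (hasSum_beta A _).unique ?_
  have : ∀ i : ι, star (rightCreation i) (basisVec []) = 0 := fun i => by
    refine lp.ext (funext fun μ => ?_)
    rw [star_apply_coord, rightCreation_basisVec, inner_basisVec_left, basisVec_apply_of_ne]
    · rfl
    · simp
  simp only [this, map_zero]
  exact hasSum_zero

lemma beta_basisVec_append (A : BFock ι) (μ : List ι) (i : ι) :
    beta A (basisVec (μ ++ [i])) = rightCreation i (A (basisVec μ)) := by
  rw [← rightCreation_basisVec]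
  exact betaFun_rightCreation A i _

lemma beta_iterate_one_basisVec (k : ℕ) (μ : List ι) :
    beta^[k] (1 : BFock ι) (basisVec μ) = if k ≤ μ.length then basisVec μ else 0 := by
  induction k generalizing μ with
  | zero => simp
  | succ k ih =>
    rw [Function.iterate_succ_apply']
    rcases List.eq_nil_or_concat μ with rfl | ⟨ν, i, rfl⟩
    · rw [beta_basisVec_nil]; simp
    · rw [List.concat_eq_append, beta_basisVec_append, ih]
      by_cases h : k ≤ ν.length
      · simp [h, rightCreation_basisVec]
      · simp [h]

lemma beta_iterate_one_mul (j k : ℕ) :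
    beta^[j] (1 : BFock ι) * beta^[k] 1 = beta^[max j k] 1 := by
  refine clm_ext fun μ => ?_
  rw [mul_apply_eq_comp, beta_iterate_one_basisVec, beta_iterate_one_basisVec]
  by_cases h1 : k ≤ μ.length <;> by_cases h2 : j ≤ μ.length <;>
    simp [h1, h2, beta_iterate_one_basisVec]

lemma star_beta_iterate (k : ℕ) (A : BFock ι) : star (beta^[k] A) = beta^[k] (star A) := by
  induction k with
  | zero => rfl
  | succ k ih => rw [Function.iterate_succ_apply', Function.iterate_succ_apply', ← ih, map_star]

/-- `P_k = I - β^{k+1}(I)`, the projection onto the span of the words of length at most `k`. -/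
def P (k : ℕ) : BFock ι := 1 - beta^[k + 1] 1

/-- `E_k = β^k(I) - β^{k+1}(I)`, the projection onto the span of the words of length `k`. -/
def E (k : ℕ) : BFock ι := beta^[k] 1 - beta^[k + 1] 1

lemma star_P (k : ℕ) : star (P k : BFock ι) = P k := by
  rw [P, star_sub, star_beta_iterate, star_one]

lemma P_mul_P (j k : ℕ) : (P j * P k : BFock ι) = P (min j k) := by
  rcases le_total j k with h | h
  · rw [P, P, sub_mul, one_mul, mul_sub, mul_one, beta_iterate_one_mul, min_eq_left h,
      max_eq_right (by omega), P]
    abel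
  · rw [P, P, sub_mul, one_mul, mul_sub, mul_one, beta_iterate_one_mul, min_eq_right h,
      max_eq_left (by omega), P]
    abel

lemma P_mul_E (k : ℕ) : (P k * E k : BFock ι) = E k := by
  rw [P, E, sub_mul, one_mul, mul_sub, beta_iterate_one_mul, beta_iterate_one_mul,
    max_eq_left (by omega), max_self]
  abel

lemma star_E (k : ℕ) : star (E k : BFock ι) = E k := by
  rw [E, star_sub, star_beta_iterate, star_beta_iterate, star_one]

/-- The von Neumann algebra `𝔅_k` of the operators `T` with `T = P_k T P_k`, as a set. -/
def boundedSupportLevel (ι : Type) (k : ℕ) : Set (BFock ι) := {T | T = P k * T * P k}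

lemma mem_level_iff {k : ℕ} {T : BFock ι} :
    T ∈ boundedSupportLevel ι k ↔ P k * T = T ∧ T * P k = T := by
  constructor
  · intro h
    have h' : T = P k * T * P k := h
    constructor
    · rw [h', ← mul_assoc, ← mul_assoc, P_mul_P, min_self]
    · rw [h', mul_assoc, P_mul_P, min_self]
  · rintro ⟨h1, h2⟩
    change T = P k * T * P k
    rw [h1, h2]

lemma level_mono {j k : ℕ} (h : j ≤ k) : boundedSupportLevel ι j ⊆ boundedSupportLevel ι k := by
  intro T hT
  rw [mem_level_iff] at hT ⊢
  constructor
  · rw [← hT.1, ← mul_assoc, P_mul_P, min_eq_right h]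
  · rw [← hT.2, mul_assoc, P_mul_P, min_eq_left h]

/-- The `*`-algebra `𝔅 = ⋃ k, 𝔅_k` of the operators of bounded support. -/
def boundedSupport (ι : Type) : NonUnitalStarSubalgebra ℂ (BFock ι) where
  carrier := ⋃ k, boundedSupportLevel ι k
  zero_mem' := Set.mem_iUnion.2 ⟨0, by simp [boundedSupportLevel]⟩
  add_mem' {S T} hS hT := by
    obtain ⟨j, hj⟩ := Set.mem_iUnion.1 hS
    obtain ⟨k, hk⟩ := Set.mem_iUnion.1 hT
    have h1 := mem_level_iff.1 (level_mono (le_max_left j k) hj)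
    have h2 := mem_level_iff.1 (level_mono (le_max_right j k) hk)
    exact Set.mem_iUnion.2 ⟨max j k, mem_level_iff.2
      ⟨by rw [mul_add, h1.1, h2.1], by rw [add_mul, h1.2, h2.2]⟩⟩
  mul_mem' {S T} hS hT := by
    obtain ⟨j, hj⟩ := Set.mem_iUnion.1 hS
    obtain ⟨k, hk⟩ := Set.mem_iUnion.1 hT
    have h1 := mem_level_iff.1 (level_mono (le_max_left j k) hj)
    have h2 := mem_level_iff.1 (level_mono (le_max_right j k) hk)
    exact Set.mem_iUnion.2 ⟨max j k, mem_level_iff.2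
      ⟨by rw [← mul_assoc, h1.1], by rw [mul_assoc, h2.2]⟩⟩
  smul_mem' c T hT := by
    obtain ⟨k, hk⟩ := Set.mem_iUnion.1 hT
    have h1 := mem_level_iff.1 hk
    exact Set.mem_iUnion.2 ⟨k, mem_level_iff.2
      ⟨by rw [mul_smul_comm, h1.1], by rw [smul_mul_assoc, h1.2]⟩⟩
  star_mem' {T} hT := by
    obtain ⟨k, hk⟩ := Set.mem_iUnion.1 hT
    have h1 := mem_level_iff.1 hk
    refine Set.mem_iUnion.2 ⟨k, mem_level_iff.2 ⟨?_, ?_⟩⟩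
    · conv_rhs => rw [← h1.2]
      rw [star_mul, star_P]
    · conv_rhs => rw [← h1.1]
      rw [star_mul, star_P]

instance : AddCommGroup (boundedSupport ι) := inferInstance
instance : AddCommMonoid (boundedSupport ι) := inferInstance

lemma mem_boundedSupport_iff {T : BFock ι} :
    T ∈ boundedSupport ι ↔ ∃ k, T ∈ boundedSupportLevel ι k := Set.mem_iUnion

lemma beta_mem_level {k : ℕ} {T : BFock ι} (hT : T ∈ boundedSupportLevel ι k) :
    beta T ∈ boundedSupportLevel ι (k + 1) := by
  rw [mem_level_iff] at hT ⊢
  have hP : beta (P k : BFock ι) = beta 1 - beta^[k + 1 + 1] 1 := by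
    rw [P, map_sub, ← Function.iterate_succ_apply' (⇑beta)]
  have h1 : (P (k + 1) : BFock ι) * beta (P k) = beta (P k) := by
    rw [hP, P, sub_mul, one_mul, mul_sub, beta_iterate_one_mul]
    have := beta_iterate_one_mul (ι := ι) (k + 1 + 1) 1
    rw [Function.iterate_one, max_eq_left (by omega)] at this
    rw [this, max_self, sub_self, sub_zero]
  have h2 : beta (P k : BFock ι) * P (k + 1) = beta (P k) := by
    have := congrArg star h1
    rwa [star_mul, star_P, ← map_star, star_P] at this
  constructor
  · rw [← hT.1, map_mul, ← mul_assoc, h1]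
  · rw [← hT.2, map_mul, mul_assoc, h2]

lemma beta_mem_boundedSupport {T : BFock ι} (hT : T ∈ boundedSupport ι) :
    beta T ∈ boundedSupport ι := by
  obtain ⟨k, hk⟩ := mem_boundedSupport_iff.1 hT
  exact mem_boundedSupport_iff.2 ⟨k + 1, beta_mem_level hk⟩

/-- `β` as an endomorphism of `𝔅`. -/
def betaB : boundedSupport ι →ₗ[ℂ] boundedSupport ι where
  toFun B := ⟨beta (B : BFock ι), beta_mem_boundedSupport B.2⟩
  map_add' A B := Subtype.ext (map_add beta (A : BFock ι) (B : BFock ι))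
  map_smul' c B := Subtype.ext (map_smul beta c (B : BFock ι))

/-- `δ = id - β` on `𝔅`. -/
def deltaB : boundedSupport ι →ₗ[ℂ] boundedSupport ι := LinearMap.id - betaB

/-- `δ = id - β` on all bounded operators on Fock space. -/
def delta (A : BFock ι) : BFock ι := A - beta A

/-- `E_k` as an element of `𝔅`. -/
def EB (k : ℕ) : boundedSupport ι :=
  ⟨E k, mem_boundedSupport_iff.2 ⟨k, mem_level_iff.2 ⟨P_mul_E k, by
    have := congrArg star (P_mul_E (ι := ι) k)
    rwa [star_mul, star_E, star_P] at this⟩⟩⟩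

/-! ### The algebra `λ(𝔅)` and its closure -/

/-- `A = λ(B)`, that is, `A` is the strong sum of the series `∑ i, β^i(B)`. -/
def IsLambda (B A : BFock ι) : Prop :=
  ∀ x : Fock ι, Tendsto (fun N => ∑ i ∈ Finset.range N, beta^[i] B x) atTop (𝓝 (A x))

/-- The range `λ(𝔅)`. -/
def lambdaRange (ι : Type) : Set (BFock ι) := {A | ∃ B ∈ boundedSupport ι, IsLambda B A}

lemma norm_beta_iterate_le (k : ℕ) (A : BFock ι) : ‖beta^[k] A‖ ≤ ‖A‖ := by
  induction k with
  | zero => exact le_rfl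
  | succ k ih =>
    rw [Function.iterate_succ_apply']
    exact (LinearMap.mkContinuous_norm_le _ (norm_nonneg _) (norm_tsum_beta_le _)).trans ih

lemma tendsto_zero_of_basisVec {T : ℕ → BFock ι} (hT : ∀ n, ‖T n‖ ≤ 1)
    (h : ∀ μ, ∀ᶠ n in atTop, T n (basisVec μ) = 0) (x : Fock ι) :
    Tendsto (fun n => T n x) atTop (𝓝 0) := by
  let _ := Classical.decEq (List ι)
  have hsum : HasSum (fun μ => x μ • basisVec μ) x := by
    have h0 := lp.hasSum_single (p := 2) (by norm_num) x
    have hs : ∀ μ, lp.single 2 μ (x μ) = x μ • basisVec μ := fun μ => by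
      rw [basisVec, ← lp.single_smul, smul_eq_mul, mul_one]
    simpa only [hs] using h0
  rw [Metric.tendsto_atTop]
  intro ε hε
  obtain ⟨s, hs⟩ := (Metric.tendsto_nhds.1 hsum ε hε).exists
  obtain ⟨N, hN⟩ := eventually_atTop.1 ((eventually_all_finset s).2 fun μ _ => h μ)
  refine ⟨N, fun n hn => ?_⟩
  have hz : T n (∑ μ ∈ s, x μ • basisVec μ) = 0 := by
    rw [map_sum]
    exact Finset.sum_eq_zero fun μ hμ => by rw [map_smul, hN n hn μ hμ, smul_zero]
  have hx : T n x = T n (x - ∑ μ ∈ s, x μ • basisVec μ) := by rw [map_sub, hz, sub_zero]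
  rw [dist_zero_right, hx]
  refine ((T n).le_of_opNorm_le (hT n) _).trans_lt ?_
  rwa [one_mul, ← dist_eq_norm, dist_comm]

lemma tendsto_beta_iterate_one (x : Fock ι) :
    Tendsto (fun N => beta^[N] (1 : BFock ι) x) atTop (𝓝 0) := by
  refine tendsto_zero_of_basisVec (fun n => ?_) (fun μ => ?_) x
  · exact (norm_beta_iterate_le n 1).trans_eq CStarRing.norm_one
  · filter_upwards [eventually_gt_atTop μ.length] with N hN
    rw [beta_iterate_one_basisVec, if_neg (by omega)]

lemma isLambda_delta (A : BFock ι) : IsLambda (delta A) A := by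
  intro x
  have hit : ∀ i, beta^[i] (delta A) x = beta^[i] A x - beta^[i + 1] A x := fun i => by
    rw [delta, iterate_map_sub, Function.iterate_succ_apply]
    rfl
  simp only [hit, Finset.sum_range_sub']
  have h0 : Tendsto (fun N => beta^[N] A x) atTop (𝓝 0) := by
    have hb : ∀ N, ‖beta^[N] A x‖ ≤ ‖A‖ * ‖beta^[N] (1 : BFock ι) x‖ := fun N => by
      have : beta^[N] A = beta^[N] A * beta^[N] 1 := by
        rw [← iterate_map_mul, mul_one]
      conv_lhs => rw [this, mul_apply_eq_comp]
      exact (beta^[N] A).le_of_opNorm_le (norm_beta_iterate_le N A) _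
    refine squeeze_zero_norm hb ?_
    simpa using (tendsto_beta_iterate_one x).norm.const_mul ‖A‖
  simpa using tendsto_const_nhds.sub h0

lemma delta_leftCreation_mem (i : ι) : delta (leftCreation i) ∈ boundedSupport ι := by
  have hd : ∀ μ : List ι, delta (leftCreation i) (basisVec μ)
      = if μ = [] then basisVec [i] else 0 := by
    intro μ
    rw [delta, sub_apply]
    rcases List.eq_nil_or_concat μ with rfl | ⟨ν, j, rfl⟩
    · rw [beta_basisVec_nil, leftCreation_basisVec]; simp
    · rw [List.concat_eq_append, beta_basisVec_append, leftCreation_basisVec,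
        leftCreation_basisVec, rightCreation_basisVec]
      simp
  have hP : ∀ μ : List ι, (P 1 : BFock ι) (basisVec μ)
      = if μ.length ≤ 1 then basisVec μ else 0 := by
    intro μ
    rw [P, sub_apply, one_apply_eq_self, beta_iterate_one_basisVec]
    by_cases h : μ.length ≤ 1
    · rw [if_pos h, if_neg (by omega), sub_zero]
    · rw [if_neg h, if_pos (by omega), sub_self]
  refine mem_boundedSupport_iff.2 ⟨1, mem_level_iff.2 ⟨clm_ext fun μ => ?_, clm_ext fun μ => ?_⟩⟩
  · rw [mul_apply_eq_comp, hd]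
    split_ifs with h
    · rw [hP]; simp
    · simp
  · rw [mul_apply_eq_comp, hP, hd]
    split_ifs with h1 h2 h2
    · rw [hd, if_pos h2]
    · rw [hd, if_neg h2]
    · exact absurd (by simp [h2]) h1
    · simp

lemma leftCreation_mem_lambdaRange (i : ι) : leftCreation i ∈ lambdaRange ι :=
  ⟨_, delta_leftCreation_mem i, isLambda_delta _⟩

/-- The C⋆-algebra generated by `λ(𝔅)`. As `λ(𝔅)` is a unital `*`-algebra, this is the norm
closure of `λ(𝔅)`. -/
abbrev ClosureLambda (ι : Type) : Type := Generated (lambdaRange ι)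

lemma fockRep_mem (x : TO ι) : fockRep ι x ∈ generated (lambdaRange ι) := by
  let ev : Ambient ι →⋆ₐ[ℂ] BFock ι := ambientEval (fockFamily ι)
  have hev : Continuous ev := continuous_ambientEval (fockFamily ι)
  have hle : generated (Set.range (ambientGen (ι := ι)))
      ≤ (generated (lambdaRange ι)).comap ev := by
    refine generated_le ?_ ((isClosed_generated _).preimage hev)
    rintro _ ⟨i, rfl⟩
    exact subset_generated _ (leftCreation_mem_lambdaRange i)
  exact hle x.2

/-- The Fock representation, as a `*`-homomorphism into `closure λ(𝔅)`. -/
def fockRepClosure (ι : Type) : TO ι →⋆ₐ[ℂ] ClosureLambda ι :=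
  Generated.codRestrict (fockRep ι) fockRep_mem

lemma incl_fockRepClosure (x : TO ι) : (fockRepClosure ι x).incl = fockRep ι x := rfl

/-! ### Functionals -/

/-- A normal (`σ`-weakly continuous) functional on the bounded operators on Fock space:
`φ(T) = ∑ n, ⟨T x_n, y_n⟩` with `∑ n, ‖x_n‖ ‖y_n‖ < ∞`. -/
def IsNormal (φ : BFock ι →ₗ[ℂ] ℂ) : Prop :=
  ∃ x y : ℕ → Fock ι, Summable (fun n => ‖x n‖ * ‖y n‖) ∧
    ∀ T : BFock ι, HasSum (fun n => ⟪y n, T (x n)⟫_ℂ) (φ T)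

/-- Positive linear functionals on `𝔅`. -/
def IsPositive (ω : boundedSupport ι →ₗ[ℂ] ℂ) : Prop :=
  ∀ B : boundedSupport ι, 0 ≤ ω (star B * B)

/-- Decreasing linear functionals on `𝔅`: those `ω` for which `ω ∘ δ` is positive on `𝔅`. -/
def IsDecreasing (ω : boundedSupport ι →ₗ[ℂ] ℂ) : Prop := IsPositive (ω ∘ₗ deltaB)

/-- Locally normal linear functionals on `𝔅`: the restriction to each von Neumann algebra `𝔅_k`
is normal. -/
def IsLocallyNormal (ω : boundedSupport ι →ₗ[ℂ] ℂ) : Prop :=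
  ∀ k, ∃ φ : BFock ι →ₗ[ℂ] ℂ, IsNormal φ ∧
    ∀ B : boundedSupport ι, (B : BFock ι) ∈ boundedSupportLevel ι k → ω B = φ B

/-- The cone `𝓦_β` of decreasing locally normal positive linear functionals on `𝔅`. -/
def IsDecreasingLocallyNormal (ω : boundedSupport ι →ₗ[ℂ] ℂ) : Prop :=
  IsPositive ω ∧ IsDecreasing ω ∧ IsLocallyNormal ω

/-- `φ` is a positive linear functional on `closure λ(𝔅)` which extends `ω ∘ δ`. -/
def IsDelta (ω : boundedSupport ι →ₗ[ℂ] ℂ) (φ : ClosureLambda ι →ₚ[ℂ] ℂ) : Prop :=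
  ∀ A : ClosureLambda ι, A.incl ∈ lambdaRange ι →
    ∀ B : boundedSupport ι, (B : BFock ι) = delta A.incl → φ A = ω B

open Classical in
/-- The functional `Δω`: the positive linear functional on `closure λ(𝔅)` which extends `ω ∘ δ`
(and, conventionally, `0` if there is none). -/
def Delta (ω : boundedSupport ι →ₗ[ℂ] ℂ) : ClosureLambda ι →ₚ[ℂ] ℂ :=
  if h : ∃ φ, IsDelta ω φ then h.choose else 0

lemma isDelta_Delta {ω : boundedSupport ι →ₗ[ℂ] ℂ} (h : ∃ φ, IsDelta ω φ) :
    IsDelta ω (Delta ω) := by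
  rw [Delta, dif_pos h]
  exact h.choose_spec

/-! ### Density matrices -/

/-- Trace-class operators: `T = ∑ n, x_n ⊗ y_n^*` with `∑ n, ‖x_n‖ ‖y_n‖ < ∞`. -/
def IsTraceClass (T : BFock ι) : Prop :=
  ∃ x y : ℕ → Fock ι, Summable (fun n => ‖x n‖ * ‖y n‖) ∧
    ∀ z : Fock ι, HasSum (fun n => ⟪y n, z⟫_ℂ • x n) (T z)

/-- The trace of a trace-class operator on Fock space. -/
def trace (T : BFock ι) : ℂ := ∑' μ : List ι, ⟪basisVec μ, T (basisVec μ)⟫_ℂ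

/-- `Ω` is the density matrix of `ω`: `Ω_{ij} = E_i T_k E_j` for `i, j ≤ k`, where `T_k` is the
trace-class operator in `𝔅_k` with `ω(B) = tr(T_k B)` for all `B ∈ 𝔅_k`. Operators from `𝓔_j`
to `𝓔_i` are identified with operators `S` on Fock space such that `S = E_i S E_j`. -/
def IsDensityMatrix (ω : boundedSupport ι →ₗ[ℂ] ℂ) (Ω : ℕ → ℕ → BFock ι) : Prop :=
  ∃ T : ℕ → BFock ι, ∀ k, IsTraceClass (T k) ∧ T k ∈ boundedSupportLevel ι k ∧
    (∀ B : boundedSupport ι, (B : BFock ι) ∈ boundedSupportLevel ι k →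
      ω B = trace (T k * (B : BFock ι))) ∧
    ∀ i ≤ k, ∀ j ≤ k, Ω i j = E i * T k * E j

/-- The slice of a trace-class operator; the series converges in norm. -/
def slice (T : BFock ι) : BFock ι := ∑' i, star (rightCreation i) * T * rightCreation i

/-- The slice of an operator matrix. -/
def sliceMatrix (Ω : ℕ → ℕ → BFock ι) : ℕ → ℕ → BFock ι :=
  fun i j => slice (Ω (i + 1) (j + 1))

/-! ### Essential and singular functionals -/

/-- `ρ` is essential: in the GNS representation `π` of `ρ`, `∑ i, π(v_i v_i^*)` is the identity
(strong operator topology). -/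
def IsEssential (ρ : TO ι →ₚ[ℂ] ℂ) : Prop :=
  ∀ ξ : ρ.GNS, HasSum (fun i => ρ.gnsStarAlgHom (TO.v i * star (TO.v i)) ξ) ξ

/-- `ρ` is singular: in the GNS representation `π` of `ρ`, the (decreasing) projections
`∑_{|μ| = k} π(v_μ v_μ^*)` converge strongly to zero as `k → ∞`. -/
def IsSingular (ρ : TO ι →ₚ[ℂ] ℂ) : Prop :=
  ∀ ξ : ρ.GNS, ∃ q : ℕ → ρ.GNS,
    (∀ k, HasSum (fun μ : {μ : List ι // μ.length = k} =>
      ρ.gnsStarAlgHom (TO.word μ.1 * star (TO.word μ.1)) ξ) (q k)) ∧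
    Tendsto q atTop (𝓝 0)

/-- `ρ` is normal in the Fock representation. -/
def IsFockNormal (ρ : TO ι →ₚ[ℂ] ℂ) : Prop :=
  ∃ φ : BFock ι →ₗ[ℂ] ℂ, IsNormal φ ∧ ∀ x, ρ x = φ (fockRep ι x)

/-- A positive functional on `closure λ(𝔅)` is `𝓚`-singular if it vanishes on the ideal `𝓚` of
compact operators. -/
def IsKSingular (φ : ClosureLambda ι →ₚ[ℂ] ℂ) : Prop :=
  ∀ A : ClosureLambda ι, IsCompactOperator A.incl → φ A = 0

/-- A positive functional on `closure λ(𝔅)` is `𝓚`-essential if the restriction of its GNS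
representation to the ideal `𝓚` of compact operators is nondegenerate. -/
def IsKEssential (φ : ClosureLambda ι →ₚ[ℂ] ℂ) : Prop :=
  Dense (Submodule.span ℂ {η : φ.GNS | ∃ A : ClosureLambda ι, IsCompactOperator A.incl ∧
    ∃ ξ, η = φ.gnsStarAlgHom A ξ} : Set φ.GNS)

end

end ToeplitzCuntz

open ToeplitzCuntz

namespace ToeplitzCuntz

noncomputable section

variable {ι : Type}

/-! ### Operators on Fock space -/

/-! Everything is read off from matrix entries. The operator l(v_μ v_ν^*) maps e_{ντ} to e_{μτ} and
commutes with appending a letter, except where τ starts from the empty word; hence δ turns it into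
the matrix unit e_{μν} (`delta_leftWord`). As the v_μ v_ν^* span a dense subspace of the
Toeplitz-Cuntz algebra, ρ = Δω ∘ l means exactly ρ(v_μ v_ν^*) = ω(e_{μν}) for all μ, ν
(`eq_Delta_iff`). A locally normal ω is determined by its values on matrix units
(`IsApproximable.ext`), which gives uniqueness.

For existence, ρ(v_μ v_ν^*) is the Gram matrix of the vectors π(v_μ)^* ξ. Their squared norms sum to
at most ρ(1) over the words of one length, so on words of length at most k the matrix defines a
normal functional (`exists_normal_gram`), and these functionals glue. Passing to ω ∘ β inserts ∑ v_i
v_i^* between v_μ and v_ν^*, so ω decreases because this sum is at most 1.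

The functional Δω is a limit of averages. With A_m = P_m A P_m one has A_{m+1} = δ(A) + β(A_m) for
large m, so ω(δ(A_m)) differs from ω(δ(A)) by a telescoping term. The averages are positive on
positive A and tend to ω(δ(A)) (`tendsto_averaged`); an ultrafilter limit extends them to all of
B(F).

The essential conditions all say that ω(β(e_{μν})) = ω(e_{μν}). The singular conditions rest on Δω(1
- P_k) = ω(E_{k+1}) (`Delta_one_sub_PB`): if this tends to zero, finite-rank operators act
nondegenerately in the GNS space of Δω; conversely nondegeneracy makes P_k tend strongly to 1, and
word projections of length k+1 lie below 1 - P_k. For Fock normality, ω ∘ δ is always given on 𝔅 by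
a normal functional φ, and φ(A - β^N(A)) = ω(e_{μν}) - ω(β^N(e_{μν})) for A = l(v_μ v_ν^*); the
error vanishes when ω(E_N) → 0 (`isFockNormal_of_tendsto`). -/

lemma beta_iterate_one_eq (k : ℕ) : beta^[k + 1] (1 : BFock ι) = 1 - P k := by
  rw [P, sub_sub_cancel]

lemma beta_one : beta (1 : BFock ι) = 1 - P 0 := beta_iterate_one_eq 0

lemma beta_P (k : ℕ) : beta (P k : BFock ι) = P (k + 1) - P 0 := by
  rw [P, map_sub, ← Function.iterate_succ_apply' (⇑beta), beta_one, beta_iterate_one_eq]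
  abel

lemma P_basisVec (k : ℕ) (μ : List ι) :
    (P k : BFock ι) (basisVec μ) = if μ.length ≤ k then basisVec μ else 0 := by
  rw [P, sub_apply, one_apply_eq_self, beta_iterate_one_basisVec]
  by_cases h : μ.length ≤ k
  · rw [if_pos h, if_neg (by omega), sub_zero]
  · rw [if_neg h, if_pos (by omega), sub_self]

lemma E_basisVec (k : ℕ) (μ : List ι) :
    (E k : BFock ι) (basisVec μ) = if μ.length = k then basisVec μ else 0 := by
  rw [E, sub_apply, beta_iterate_one_basisVec, beta_iterate_one_basisVec]
  rcases lt_trichotomy μ.length k with h | h | h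
  · rw [if_neg (by omega), if_neg (by omega), if_neg (by omega), sub_zero]
  · rw [if_pos (by omega), if_neg (by omega), if_pos h, sub_zero]
  · rw [if_pos (by omega), if_pos (by omega), if_neg (by omega), sub_self]

lemma beta_E (k : ℕ) : beta (E k : BFock ι) = E (k + 1) := by
  simp only [E, map_sub, ← Function.iterate_succ_apply' (⇑beta)]

lemma P_succ (k : ℕ) : (P (k + 1) : BFock ι) = P k + E (k + 1) := by
  rw [P, P, E]; abel

lemma P_zero : (P 0 : BFock ι) = E 0 := rfl

lemma norm_P_le (k : ℕ) : ‖(P k : BFock ι)‖ ≤ 1 :=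
  IsStarProjection.norm_le _ ⟨by rw [IsIdempotentElem, P_mul_P, min_self], star_P k⟩

lemma tendsto_P (x : Fock ι) : Tendsto (fun k => P k x) atTop (𝓝 x) := by
  have h : Tendsto (fun k => x - beta^[k + 1] (1 : BFock ι) x) atTop (𝓝 (x - 0)) :=
    tendsto_const_nhds.sub ((tendsto_beta_iterate_one x).comp (tendsto_add_atTop_nat 1))
  rwa [sub_zero] at h

lemma P_mul_beta_one_comm (k : ℕ) : (P (k + 1) : BFock ι) * beta 1 = beta (P k) := by
  rw [beta_one, mul_sub, mul_one, P_mul_P, min_eq_right (by omega), beta_P]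

lemma beta_one_mul_P (k : ℕ) : beta (1 : BFock ι) * P (k + 1) = beta (P k) := by
  rw [beta_one, sub_mul, one_mul, P_mul_P, min_eq_left (by omega), beta_P]

/-- Since β(A) = β(1)β(A), the cutoff passes through β and drops by one. -/
lemma P_mul_beta (k : ℕ) (A : BFock ι) : P (k + 1) * beta A = beta (P k * A) := by
  rw [map_mul, ← P_mul_beta_one_comm, mul_assoc, ← map_mul, one_mul]

lemma beta_mul_P (k : ℕ) (A : BFock ι) : beta A * P (k + 1) = beta (A * P k) := by
  rw [map_mul, ← beta_one_mul_P, ← mul_assoc, ← map_mul, mul_one]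

lemma P_zero_mul_beta (A : BFock ι) : P 0 * beta A = 0 := by
  have h : (P 0 : BFock ι) * beta 1 = 0 := by
    rw [beta_one, mul_sub, mul_one, P_mul_P, min_self, sub_self]
  rw [← one_mul A, map_mul, ← mul_assoc, h, zero_mul]

/-! ### Compressions and the `*`-algebra λ(𝔅) -/

/-- The compression of an operator to the words of length at most `m`. -/
def compress (m : ℕ) (A : BFock ι) : BFock ι := P m * A * P m

lemma compress_mem_level (m : ℕ) (A : BFock ι) : compress m A ∈ boundedSupportLevel ι m :=
  mem_level_iff.2 ⟨by rw [compress, ← mul_assoc, ← mul_assoc, P_mul_P, min_self],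
    by rw [compress, mul_assoc, P_mul_P, min_self]⟩

lemma compress_mem (m : ℕ) (A : BFock ι) : compress m A ∈ boundedSupport ι :=
  mem_boundedSupport_iff.2 ⟨m, compress_mem_level m A⟩

lemma compress_of_mem {m : ℕ} {A : BFock ι} (h : A ∈ boundedSupportLevel ι m) :
    compress m A = A := Eq.symm h

/-- Split A = δ(A) + β(A): the corner of level m+1 already contains δ(A), and β carries the corner
of level m to the next one. This recursion is what makes the averages defining Δω telescope. -/
lemma compress_succ {k m : ℕ} {A : BFock ι} (hA : delta A ∈ boundedSupportLevel ι k)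
    (hm : k ≤ m + 1) : compress (m + 1) A = delta A + beta (compress m A) := by
  have h : A = delta A + beta A := by rw [delta, sub_add_cancel]
  conv_lhs => rw [compress, h, mul_add, add_mul, P_mul_beta, beta_mul_P]
  rw [← compress, ← compress, compress_of_mem (level_mono hm hA)]

/-- A band condition: no entry of A leads from a word longer than j + k to a word of length at most
j. Induction on j through A = δ(A) + β(A), starting from the fact that β(A) has no vacuum component.
-/
lemma P_mul_eq_of_delta_mem {k : ℕ} {A : BFock ι} (hA : delta A ∈ boundedSupportLevel ι k)
    (j : ℕ) : P j * A = P j * A * P (j + k) := by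
  have h : A = delta A + beta A := by rw [delta, sub_add_cancel]
  induction j with
  | zero =>
    have h0 : P 0 * A = P 0 * delta A := by
      conv_lhs => rw [h, mul_add, P_zero_mul_beta, add_zero]
    rw [h0, mul_assoc, zero_add, (mem_level_iff.1 hA).2]
  | succ j ih =>
    have h1 : P (j + 1) * A = P (j + 1) * delta A + beta (P j * A) := by
      conv_lhs => rw [h, mul_add, P_mul_beta]
    rw [h1, add_mul, mul_assoc,
      (mem_level_iff.1 (level_mono (by omega : k ≤ j + 1 + k) hA)).2,
      show j + 1 + k = j + k + 1 by omega, beta_mul_P, ← ih]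

lemma mul_mem_boundedSupport {C A : BFock ι} (hC : C ∈ boundedSupport ι)
    (hA : delta A ∈ boundedSupport ι) : C * A ∈ boundedSupport ι := by
  obtain ⟨j, hj⟩ := mem_boundedSupport_iff.1 hC
  obtain ⟨k, hk⟩ := mem_boundedSupport_iff.1 hA
  have h : C * A = C * A * P (j + k) := by
    rw [← (mem_level_iff.1 hj).2, mul_assoc C, P_mul_eq_of_delta_mem hk j]
    simp only [mul_assoc, P_mul_P, min_self]
  refine mem_boundedSupport_iff.2 ⟨j + k, mem_level_iff.2 ⟨?_, h.symm⟩⟩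
  rw [← mul_assoc, (mem_level_iff.1 (level_mono (by omega : j ≤ j + k) hj)).1]

lemma delta_star (A : BFock ι) : delta (star A) = star (delta A) := by
  rw [delta, delta, star_sub, map_star]

lemma delta_mul (A B : BFock ι) : delta (A * B) = delta A * B + (A - delta A) * delta B := by
  simp only [delta, map_mul]
  noncomm_ring

lemma delta_add (A B : BFock ι) : delta (A + B) = delta A + delta B := by
  simp only [delta, map_add]; abel

lemma delta_smul (c : ℂ) (A : BFock ι) : delta (c • A) = c • delta A := by
  simp only [delta, map_smul, smul_sub]

lemma delta_one : delta (1 : BFock ι) = E 0 := rfl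

lemma E_mem (k : ℕ) : (E k : BFock ι) ∈ boundedSupport ι := (EB k).2

lemma P_mem_level (k : ℕ) : (P k : BFock ι) ∈ boundedSupportLevel ι k :=
  mem_level_iff.2 ⟨by rw [P_mul_P, min_self], by rw [P_mul_P, min_self]⟩

/-- The unital `*`-algebra `λ(𝔅)`, as the set of all `A` with `δ(A) ∈ 𝔅`. -/
def lambdaAlg (ι : Type) : StarSubalgebra ℂ (BFock ι) where
  carrier := {A | delta A ∈ boundedSupport ι}
  mul_mem' {A B} hA hB := by
    have hA' : delta A ∈ boundedSupport ι := hA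
    have hB' : delta B ∈ boundedSupport ι := hB
    change delta (A * B) ∈ boundedSupport ι
    -- Only products with 𝔅 on the left are available, so the other side is obtained by taking
    -- adjoints.
    have h3 : A * delta B ∈ boundedSupport ι := by
      have h4 : star (delta B) * star A ∈ boundedSupport ι :=
        mul_mem_boundedSupport (star_mem hB') (by rw [delta_star]; exact star_mem hA')
      have := star_mem h4
      rwa [star_mul, star_star, star_star] at this
    rw [delta_mul, sub_mul]
    exact add_mem (mul_mem_boundedSupport hA' hB') (sub_mem h3 (mul_mem hA' hB'))
  add_mem' {A B} hA hB := by
    change delta (A + B) ∈ boundedSupport ι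
    rw [delta_add]; exact add_mem hA hB
  algebraMap_mem' c := by
    change delta _ ∈ boundedSupport ι
    rw [Algebra.algebraMap_eq_smul_one, delta_smul, delta_one]
    exact SMulMemClass.smul_mem c (E_mem 0)
  star_mem' {A} hA := by
    change delta (star A) ∈ boundedSupport ι
    rw [delta_star]; exact star_mem hA

/-- Applying β termwise to a strongly convergent series needs a justification. On a word ending in
j, β amounts to r(v_j) after deleting that letter, so continuity of r(v_j) suffices; the vacuum is
killed by β. -/
lemma IsLambda.delta_eq {A B : BFock ι} (h : IsLambda B A) : delta A = B := by
  refine clm_ext fun μ => ?_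
  have h1 : Tendsto (fun N => ∑ i ∈ Finset.range N, beta^[i + 1] B (basisVec μ)) atTop
      (𝓝 (beta A (basisVec μ))) := by
    rcases List.eq_nil_or_concat μ with rfl | ⟨ν, j, rfl⟩
    · simp only [Function.iterate_succ_apply', beta_basisVec_nil, Finset.sum_const_zero]
      exact tendsto_const_nhds
    · rw [List.concat_eq_append, beta_basisVec_append]
      simp only [Function.iterate_succ_apply', beta_basisVec_append, ← map_sum]
      exact ((rightCreation j).continuous.tendsto _).comp (h _)
  have h2 := (h (basisVec μ)).comp (tendsto_add_atTop_nat 1)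
  simp only [Function.comp_def, Finset.sum_range_succ', Function.iterate_zero, id_eq] at h2
  have h3 := tendsto_nhds_unique h2 (h1.add_const _)
  rw [delta, sub_apply, h3, add_sub_cancel_left]

lemma mem_lambdaRange_iff {A : BFock ι} : A ∈ lambdaRange ι ↔ delta A ∈ boundedSupport ι :=
  ⟨fun ⟨_, hB, h⟩ => h.delta_eq ▸ hB, fun h => ⟨_, h, isLambda_delta A⟩⟩

lemma mem_lambdaRange_of_mem {B : BFock ι} (hB : B ∈ boundedSupport ι) : B ∈ lambdaRange ι :=
  mem_lambdaRange_iff.2 (sub_mem hB (beta_mem_boundedSupport hB))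

lemma adjoin_lambdaRange_le : StarAlgebra.adjoin ℂ (lambdaRange ι) ≤ lambdaAlg ι :=
  StarAlgebra.adjoin_le fun _ h => mem_lambdaRange_iff.1 h

/-- In a generated C⋆-algebra the generated `*`-algebra is dense. -/
lemma Generated.dense_adjoin {A : Type*} [CStarAlgebra A] (S : Set A) :
    Dense {x : Generated S | x.incl ∈ StarAlgebra.adjoin ℂ S} := by
  intro x
  rw [Metric.mem_closure_iff]
  intro ε hε
  obtain ⟨y, hy, hd⟩ := Metric.mem_closure_iff.1 (show x.incl ∈ closure _ from x.2) ε hε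
  exact ⟨⟨y, StarSubalgebra.le_topologicalClosure _ hy⟩, hy, hd⟩

lemma Generated.incl_injective {A : Type*} [CStarAlgebra A] {S : Set A} :
    Function.Injective (Generated.incl : Generated S →⋆ₐ[ℂ] A) := Subtype.val_injective

lemma dense_lambdaRange : Dense {x : ClosureLambda ι | x.incl ∈ lambdaRange ι} :=
  (Generated.dense_adjoin (lambdaRange ι)).mono fun _ hx =>
    mem_lambdaRange_iff.2 (adjoin_lambdaRange_le hx)

/-- An element of `λ(𝔅)`, as an element of the closure. -/
def ofLambda (A : BFock ι) (hA : A ∈ lambdaRange ι) : ClosureLambda ι :=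
  ⟨A, subset_generated _ hA⟩

/-! ### Matrix units -/

/-- The matrix unit which maps the basis vector of `ν` to that of `μ`. -/
def matUnit (μ ν : List ι) : BFock ι := InnerProductSpace.rankOne ℂ (basisVec μ) (basisVec ν)

lemma matUnit_apply (μ ν : List ι) (x : Fock ι) : matUnit μ ν x = x ν • basisVec μ := by
  rw [matUnit, InnerProductSpace.rankOne_apply, inner_basisVec_left]

lemma star_matUnit (μ ν : List ι) : star (matUnit μ ν) = matUnit ν μ := by
  rw [matUnit, ContinuousLinearMap.star_eq_adjoint, InnerProductSpace.adjoint_rankOne, matUnit]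

lemma basisVec_apply [DecidableEq (List ι)] (μ ν : List ι) :
    basisVec μ ν = if μ = ν then 1 else 0 := by
  split_ifs with h
  · rw [h, basisVec_apply_self]
  · exact basisVec_apply_of_ne h

lemma matUnit_mul_matUnit_self (μ ν κ : List ι) :
    matUnit μ ν * matUnit ν κ = matUnit μ κ := by
  ext x : 1
  rw [mul_apply_eq_comp, matUnit_apply, matUnit_apply, matUnit_apply, lp.coeFn_smul,
    Pi.smul_apply, basisVec_apply_self, smul_eq_mul, mul_one]

lemma matUnit_mul_matUnit_of_ne {ν κ : List ι} (h : ν ≠ κ) (μ τ : List ι) :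
    matUnit μ ν * matUnit κ τ = 0 := by
  ext x : 1
  rw [mul_apply_eq_comp, matUnit_apply, matUnit_apply, lp.coeFn_smul,
    Pi.smul_apply, basisVec_apply_of_ne h.symm, smul_zero, zero_smul, zero_apply]

lemma matUnit_mem_level {k : ℕ} {μ ν : List ι} (hμ : μ.length ≤ k) (hν : ν.length ≤ k) :
    matUnit μ ν ∈ boundedSupportLevel ι k := by
  have h : ∀ {μ ν : List ι}, μ.length ≤ k → P k * matUnit μ ν = matUnit μ ν := by
    intro μ ν hμ
    ext x : 1
    rw [mul_apply_eq_comp, matUnit_apply, map_smul, P_basisVec, if_pos hμ]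
  refine mem_level_iff.2 ⟨h hμ, ?_⟩
  have := congrArg star (h (μ := ν) (ν := μ) hν)
  rwa [star_mul, star_P, star_matUnit] at this

/-- The matrix units as elements of `𝔅`. -/
def matUnitB (μ ν : List ι) : boundedSupport ι :=
  ⟨matUnit μ ν, mem_boundedSupport_iff.2 ⟨max μ.length ν.length,
    matUnit_mem_level (le_max_left _ _) (le_max_right _ _)⟩⟩

/-- Conjugation by a right creation operator. -/
lemma rightCreation_mul_matUnit_mul (i : ι) (μ ν : List ι) :
    rightCreation i * matUnit μ ν * star (rightCreation i) = matUnit (μ ++ [i]) (ν ++ [i]) := by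
  ext x : 1
  rw [mul_apply_eq_comp, mul_apply_eq_comp, matUnit_apply, matUnit_apply, map_smul,
    rightCreation_basisVec, star_apply_coord, rightCreation_basisVec, inner_basisVec_left]

/-- Left multiplication by a word. -/
def leftWord (μ : List ι) : BFock ι := fockRep ι (TO.word μ)

lemma leftWord_basisVec (μ ν : List ι) : leftWord μ (basisVec ν) = basisVec (μ ++ ν) := by
  induction μ with
  | nil => simp [leftWord, TO.word]
  | cons i μ ih =>
    have : leftWord (i :: μ) = leftCreation i * leftWord μ := by
      simp only [leftWord, TO.word, List.map_cons, List.prod_cons, map_mul, fockRep_v]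
    rw [this, mul_apply_eq_comp, ih, leftCreation_basisVec, List.cons_append]

lemma star_leftWord_basisVec_append (μ ν : List ι) :
    star (leftWord μ) (basisVec (μ ++ ν)) = basisVec ν := by
  classical
  refine lp.ext (funext fun κ => ?_)
  rw [star_apply_coord, leftWord_basisVec, inner_basisVec_left, basisVec_apply, basisVec_apply]
  simp

lemma star_leftWord_basisVec_of_not_prefix {μ ν : List ι} (h : ¬ μ <+: ν) :
    star (leftWord μ) (basisVec ν) = 0 := by
  classical
  refine lp.ext (funext fun κ => ?_)
  rw [star_apply_coord, leftWord_basisVec, inner_basisVec_left, basisVec_apply,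
    if_neg (by rintro rfl; exact h (List.prefix_append μ κ))]
  rfl

/-- Deleting the last letter, applying the operator and restoring the letter gives the same result
as applying it directly, unless ν is the whole word: then the shortened word no longer has the
prefix ν and only the first term of δ survives. -/
lemma delta_leftWord (μ ν : List ι) : delta (leftWord μ * star (leftWord ν)) = matUnit μ ν := by
  refine clm_ext fun κ => ?_
  rw [delta, sub_apply, matUnit_apply]
  rcases List.eq_nil_or_concat κ with rfl | ⟨κ, j, rfl⟩
  · rw [beta_basisVec_nil, sub_zero, mul_apply_eq_comp]
    by_cases hν : ν = []
    · subst hν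
      have := star_leftWord_basisVec_append ([] : List ι) []
      rw [List.append_nil] at this
      rw [this, leftWord_basisVec, basisVec_apply_self, one_smul, List.append_nil]
    · rw [star_leftWord_basisVec_of_not_prefix (by simpa using hν), map_zero,
        basisVec_apply_of_ne (Ne.symm hν), zero_smul]
  · rw [List.concat_eq_append, beta_basisVec_append, mul_apply_eq_comp, mul_apply_eq_comp]
    by_cases h1 : ν <+: κ
    · obtain ⟨τ, rfl⟩ := h1
      rw [List.append_assoc, star_leftWord_basisVec_append, star_leftWord_basisVec_append,
        leftWord_basisVec, leftWord_basisVec, rightCreation_basisVec, List.append_assoc, sub_self,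
        basisVec_apply_of_ne (by simp), zero_smul]
    · rw [star_leftWord_basisVec_of_not_prefix h1, map_zero, map_zero, sub_zero]
      by_cases h2 : ν = κ ++ [j]
      · have := star_leftWord_basisVec_append ν []
        rw [List.append_nil] at this
        rw [← h2, this, leftWord_basisVec, basisVec_apply_self, one_smul, List.append_nil]
      · rw [star_leftWord_basisVec_of_not_prefix, map_zero, basisVec_apply_of_ne (Ne.symm h2),
          zero_smul]
        rw [List.prefix_concat_iff]
        exact not_or.2 ⟨h2, h1⟩

/-! ### Finite word projections -/

/-- The projection onto the span of finitely many words. -/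
def wordProj (s : Finset (List ι)) : BFock ι := ∑ μ ∈ s, matUnit μ μ

lemma isStarProjection_wordProj (s : Finset (List ι)) : IsStarProjection (wordProj s) := by
  classical
  constructor
  · rw [IsIdempotentElem, wordProj, Finset.sum_mul]
    refine Finset.sum_congr rfl fun μ hμ => ?_
    rw [Finset.mul_sum, Finset.sum_eq_single_of_mem μ hμ, matUnit_mul_matUnit_self]
    exact fun ν _ h => matUnit_mul_matUnit_of_ne h.symm _ _
  · rw [isSelfAdjoint_iff, wordProj, star_sum]
    exact Finset.sum_congr rfl fun μ _ => star_matUnit μ μ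

lemma norm_wordProj_le (s : Finset (List ι)) : ‖wordProj s‖ ≤ 1 :=
  (isStarProjection_wordProj s).norm_le

lemma tendsto_wordProj (x : Fock ι) : Tendsto (fun s => wordProj s x) atTop (𝓝 x) := by
  let _ := Classical.decEq (List ι)
  have h0 := lp.hasSum_single (p := 2) (by norm_num) x
  have hs : ∀ μ, lp.single 2 μ (x μ) = matUnit μ μ x := fun μ => by
    rw [matUnit_apply, basisVec, ← lp.single_smul, smul_eq_mul, mul_one]
  simp only [hs] at h0
  simpa only [HasSum, SummationFilter.unconditional_filter, wordProj, sum_apply] using h0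

lemma mul_matUnit (A : BFock ι) (μ ν : List ι) :
    A * matUnit μ ν = InnerProductSpace.rankOne ℂ (A (basisVec μ)) (basisVec ν) := by
  ext x : 1
  rw [mul_apply_eq_comp, matUnit_apply, map_smul, InnerProductSpace.rankOne_apply,
    inner_basisVec_left]

lemma matUnit_mul_mul_matUnit (A : BFock ι) (μ ν : List ι) :
    matUnit μ μ * A * matUnit ν ν = A (basisVec ν) μ • matUnit μ ν := by
  ext x : 1
  simp only [mul_apply_eq_comp, matUnit_apply, map_smul, smul_apply, smul_smul, mul_comm]

lemma _root_.HasSum.of_eq {α β : Type*} [AddCommMonoid α] [TopologicalSpace α] {f g : β → α} {a : α}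
    (h : HasSum f a) (e : ∀ b, g b = f b) : HasSum g a :=
  funext e ▸ h

/-! ### Normal functionals -/

lemma norm_inner_apply_le (T : BFock ι) (x y : Fock ι) :
    ‖⟪y, T x⟫_ℂ‖ ≤ ‖T‖ * (‖x‖ * ‖y‖) := by
  refine (norm_inner_le_norm y (T x)).trans ?_
  nlinarith [mul_le_mul_of_nonneg_left (T.le_opNorm x) (norm_nonneg y)]

lemma summable_inner_apply {κ : Type*} {x y : κ → Fock ι}
    (h : Summable fun n => ‖x n‖ * ‖y n‖) (T : BFock ι) :
    Summable fun n => ⟪y n, T (x n)⟫_ℂ :=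
  (h.mul_left ‖T‖).of_norm_bounded fun n => norm_inner_apply_le T (x n) (y n)

/-- The functional `T ↦ ∑ n, ⟨T x_n, y_n⟩`. -/
def seriesFunctional {κ : Type*} (x y : κ → Fock ι) (h : Summable fun n => ‖x n‖ * ‖y n‖) :
    BFock ι →ₗ[ℂ] ℂ where
  toFun T := ∑' n, ⟪y n, T (x n)⟫_ℂ
  map_add' S T := by
    simp only [add_apply, inner_add_right]
    exact (summable_inner_apply h S).tsum_add (summable_inner_apply h T)
  map_smul' c T := by
    simp only [smul_apply, inner_smul_right, RingHom.id_apply, smul_eq_mul]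
    exact tsum_mul_left

lemma hasSum_seriesFunctional {κ : Type*} {x y : κ → Fock ι}
    (h : Summable fun n => ‖x n‖ * ‖y n‖) (T : BFock ι) :
    HasSum (fun n => ⟪y n, T (x n)⟫_ℂ) (seriesFunctional x y h T) :=
  (summable_inner_apply h T).hasSum

/-- A summable family has countable support, so it can be transported to a sequence and padded with
zero vectors. This allows double series and Hilbert bases of arbitrary cardinality as index sets. -/
lemma IsNormal.of_hasSum {κ : Type*} {φ : BFock ι →ₗ[ℂ] ℂ} {x y : κ → Fock ι}
    (h : Summable fun n => ‖x n‖ * ‖y n‖)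
    (hφ : ∀ T : BFock ι, HasSum (fun n => ⟪y n, T (x n)⟫_ℂ) (φ T)) : IsNormal φ := by
  set S := Function.support fun n => ‖x n‖ * ‖y n‖ with hS
  have : Countable S := h.countable_support
  obtain ⟨e, he⟩ := exists_injective_nat S
  have hx0 : ∀ m ∉ Set.range e, Function.extend e (fun n : S => x n) 0 m = 0 := fun m hm =>
    Function.extend_apply' _ _ _ hm
  refine ⟨Function.extend e (fun n : S => x n) 0, Function.extend e (fun n : S => y n) 0, ?_,
    fun T => ?_⟩
  · refine (he.summable_iff fun m hm => by rw [hx0 m hm, norm_zero, zero_mul]).1 ?_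
    simp only [Function.comp_def, he.extend_apply]
    exact h.subtype S
  · refine (he.hasSum_iff fun m hm => by rw [hx0 m hm, map_zero, inner_zero_right]).1 ?_
    simp only [Function.comp_def, he.extend_apply]
    refine (hasSum_subtype_iff_of_support_subset (f := fun n => ⟪y n, T (x n)⟫_ℂ) ?_).2 (hφ T)
    intro n hn hz
    have h1 := norm_inner_apply_le T (x n) (y n)
    have hz' : ‖x n‖ * ‖y n‖ = 0 := hz
    rw [hz', mul_zero] at h1
    exact hn (norm_le_zero_iff.1 h1)

/-- Normal functionals are continuous on bounded sets for the weak operator topology. -/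
lemma IsNormal.tendsto {α : Type*} {l : Filter α} {φ : BFock ι →ₗ[ℂ] ℂ} (hφ : IsNormal φ)
    {T : α → BFock ι} {T' : BFock ι} {C : ℝ} (hC : ∀ a, ‖T a‖ ≤ C)
    (h : ∀ x y, Tendsto (fun a => ⟪y, T a x⟫_ℂ) l (𝓝 ⟪y, T' x⟫_ℂ)) :
    Tendsto (fun a => φ (T a)) l (𝓝 (φ T')) := by
  obtain ⟨x, y, hs, hφ⟩ := hφ
  simp only [← (hφ _).tsum_eq]
  refine tendsto_tsum_of_dominated_convergence (hs.mul_left C) (fun n => h _ _)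
    (Eventually.of_forall fun a n => (norm_inner_apply_le _ _ _).trans ?_)
  exact mul_le_mul_of_nonneg_right (hC a) (by positivity)

lemma IsNormal.continuous {φ : BFock ι →ₗ[ℂ] ℂ} (hφ : IsNormal φ) : Continuous φ := by
  obtain ⟨x, y, hs, hφ⟩ := hφ
  refine (φ.mkContinuousOfExistsBound ⟨∑' n, ‖x n‖ * ‖y n‖, fun T => ?_⟩).continuous
  rw [mul_comm, ← (hφ T).tsum_eq]
  exact tsum_of_norm_bounded (hs.hasSum.mul_left ‖T‖) fun n => norm_inner_apply_le T (x n) (y n)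

lemma tendsto_inner_of_tendsto {α : Type*} {l : Filter α} {T : α → BFock ι} {T' : BFock ι}
    (h : ∀ x, Tendsto (fun a => T a x) l (𝓝 (T' x))) (x y : Fock ι) :
    Tendsto (fun a => ⟪y, T a x⟫_ℂ) l (𝓝 ⟪y, T' x⟫_ℂ) :=
  tendsto_const_nhds.inner (h x)

lemma summable_prod_of_sum_le {α κ : Type*} {f : α × κ → ℝ} {g : α → ℝ} (h0 : ∀ p, 0 ≤ f p)
    (hg : Summable g) (h : ∀ n (s : Finset κ), ∑ i ∈ s, f (n, i) ≤ g n) : Summable f := by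
  refine (summable_prod_of_nonneg h0).2 ⟨fun n => ?_, ?_⟩
  · exact summable_of_sum_le (fun i => h0 _) (h n)
  · exact hg.of_nonneg_of_le (fun n => tsum_nonneg fun i => h0 _)
      fun n => Real.tsum_le_of_sum_le (fun i => h0 _) (h n)

lemma sum_norm_star_rightCreation_mul_le (x y : Fock ι) (s : Finset ι) :
    ∑ i ∈ s, ‖star (rightCreation i) x‖ * ‖star (rightCreation i) y‖ ≤ ‖x‖ * ‖y‖ := by
  refine le_of_sq_le_sq ((Finset.sum_mul_sq_le_sq_mul_sq s _ _).trans ?_) (by positivity)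
  rw [mul_pow]
  exact mul_le_mul (sum_norm_sq_star_rightCreation_le x s) (sum_norm_sq_star_rightCreation_le y s)
    (Finset.sum_nonneg fun _ _ => sq_nonneg _) (sq_nonneg _)

lemma summable_norm_star_rightCreation {x y : ℕ → Fock ι}
    (h : Summable fun n => ‖x n‖ * ‖y n‖) :
    Summable fun p : ℕ × ι =>
      ‖star (rightCreation p.2) (x p.1)‖ * ‖star (rightCreation p.2) (y p.1)‖ :=
  summable_prod_of_sum_le (fun _ => by positivity) h
    fun n s => sum_norm_star_rightCreation_mul_le (x n) (y n) s

/-- The linear map underlying `β`. -/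
def betaL : BFock ι →ₗ[ℂ] BFock ι where
  toFun := beta
  map_add' := map_add beta
  map_smul' := map_smul beta

lemma inner_rightCreation_conj (i : ι) (A : BFock ι) (x y : Fock ι) :
    ⟪y, rightCreation i (A (star (rightCreation i) x))⟫_ℂ
      = ⟪star (rightCreation i) y, A (star (rightCreation i) x)⟫_ℂ := by
  rw [ContinuousLinearMap.star_eq_adjoint, ContinuousLinearMap.adjoint_inner_left]

lemma IsNormal.hasSum_beta_prod {φ : BFock ι →ₗ[ℂ] ℂ} {x y : ℕ → Fock ι}
    (hs : Summable (fun n => ‖x n‖ * ‖y n‖))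
    (hφ : ∀ T : BFock ι, HasSum (fun n => ⟪y n, T (x n)⟫_ℂ) (φ T)) (A : BFock ι) :
    HasSum (fun p : ℕ × ι =>
      ⟪star (rightCreation p.2) (y p.1), A (star (rightCreation p.2) (x p.1))⟫_ℂ)
      (φ (beta A)) := by
  have h1 := (summable_inner_apply (summable_norm_star_rightCreation hs) A).hasSum
  have h2 : ∀ n, HasSum (fun i =>
      ⟪star (rightCreation i) (y n), A (star (rightCreation i) (x n))⟫_ℂ)
      ⟪y n, beta A (x n)⟫_ℂ := fun n => by
    have := (hasSum_beta A (x n)).mapL (innerSL ℂ (y n))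
    simpa only [innerSL_apply_apply, inner_rightCreation_conj] using this
  rwa [← (h1.prod_fiberwise h2).unique (hφ (beta A))]

/-- The representing vectors r(v_i)^* x_n and r(v_i)^* y_n stay summable by Cauchy-Schwarz over i.
-/
lemma IsNormal.comp_beta {φ : BFock ι →ₗ[ℂ] ℂ} (hφ : IsNormal φ) : IsNormal (φ ∘ₗ betaL) := by
  obtain ⟨x, y, hs, hφ⟩ := hφ
  exact IsNormal.of_hasSum (summable_norm_star_rightCreation hs) (IsNormal.hasSum_beta_prod hs hφ)

/-- The absolutely convergent double series over n and i, summed with i outermost. -/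
lemma IsNormal.hasSum_beta {φ : BFock ι →ₗ[ℂ] ℂ} (hφ : IsNormal φ) (A : BFock ι) :
    HasSum (fun i => φ (rightCreation i * A * star (rightCreation i))) (φ (beta A)) := by
  obtain ⟨x, y, hs, hφ⟩ := hφ
  have h := (Equiv.prodComm ι ℕ).hasSum_iff.2 (IsNormal.hasSum_beta_prod hs hφ A)
  refine h.prod_fiberwise fun i => ?_
  refine (hφ (rightCreation i * A * star (rightCreation i))).of_eq fun n => ?_
  exact (inner_rightCreation_conj i A (x n) (y n)).symm

/-! ### Trace-class operators -/

lemma IsTraceClass.mul_mul {T : BFock ι} (h : IsTraceClass T) (C D : BFock ι) :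
    IsTraceClass (C * T * D) := by
  obtain ⟨x, y, hs, hT⟩ := h
  refine ⟨fun n => C (x n), fun n => star D (y n), ?_, fun z => ?_⟩
  · refine (hs.mul_left (‖C‖ * ‖star D‖)).of_nonneg_of_le (fun n => by positivity) fun n => ?_
    calc ‖C (x n)‖ * ‖star D (y n)‖ ≤ (‖C‖ * ‖x n‖) * (‖star D‖ * ‖y n‖) :=
          mul_le_mul (C.le_opNorm _) ((star D).le_opNorm _) (norm_nonneg _) (by positivity)
      _ = _ := by ring
  · refine ((hT (D z)).mapL C).of_eq fun n => ?_
    rw [map_smul, ContinuousLinearMap.star_eq_adjoint, ContinuousLinearMap.adjoint_inner_left]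

lemma IsNormal.tendsto_mul_wordProj {φ : BFock ι →ₗ[ℂ] ℂ} (hφ : IsNormal φ) (B : BFock ι) :
    Tendsto (fun s => φ (B * wordProj s)) atTop (𝓝 (φ B)) := by
  refine hφ.tendsto (C := ‖B‖) (fun s => ?_) (tendsto_inner_of_tendsto fun x => ?_)
  · calc ‖B * wordProj s‖ ≤ ‖B‖ * ‖wordProj s‖ := norm_mul_le _ _
      _ ≤ ‖B‖ := mul_le_of_le_one_right (norm_nonneg _) (norm_wordProj_le s)
  · exact (B.continuous.tendsto _).comp (tendsto_wordProj x)

lemma IsNormal.hasSum_mul_matUnit {φ : BFock ι →ₗ[ℂ] ℂ} (hφ : IsNormal φ) (B : BFock ι) :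
    HasSum (fun μ => φ (B * matUnit μ μ)) (φ B) := by
  have := hφ.tendsto_mul_wordProj B
  simp only [wordProj, Finset.mul_sum, map_sum] at this
  exact this

/-- Take T = ∑ x_n ⊗ y_n^*, convergent in norm. The diagonal entry of TB at μ is φ(B e_{μμ}), and
normality sums these to φ(B). -/
lemma IsNormal.exists_traceClass {φ : BFock ι →ₗ[ℂ] ℂ} (hφ : IsNormal φ) :
    ∃ T, IsTraceClass T ∧ ∀ B, trace (T * B) = φ B := by
  obtain ⟨x, y, hs, h⟩ := id hφ
  have hsum : Summable fun n => (InnerProductSpace.rankOne ℂ (x n) (y n) : BFock ι) :=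
    Summable.of_norm (by simpa only [InnerProductSpace.norm_rankOne] using hs)
  have hT : ∀ z, HasSum (fun n => ⟪y n, z⟫_ℂ • x n)
      ((∑' n, (InnerProductSpace.rankOne ℂ (x n) (y n) : BFock ι)) z) := fun z => by
    have := hsum.hasSum.mapL (ContinuousLinearMap.apply ℂ (Fock ι) z)
    simpa only [ContinuousLinearMap.apply_apply, InnerProductSpace.rankOne_apply] using this
  refine ⟨_, ⟨x, y, hs, hT⟩, fun B => ?_⟩
  refine (HasSum.tsum_eq ?_ : trace _ = _)
  refine (hφ.hasSum_mul_matUnit B).of_eq fun μ => ?_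
  have h1 := (hT (B (basisVec μ))).mapL (innerSL ℂ (basisVec μ))
  simp only [innerSL_apply_apply, inner_smul_right] at h1
  refine h1.unique ((h (B * matUnit μ μ)).of_eq fun n => ?_)
  rw [mul_apply_eq_comp, matUnit_apply, map_smul, inner_smul_right, inner_basisVec_left, mul_comm]

lemma trace_mul_matUnit (T : BFock ι) (μ ν : List ι) :
    trace (T * matUnit μ ν) = T (basisVec μ) ν := by
  rw [trace, tsum_eq_single ν]
  · rw [mul_apply_eq_comp, matUnit_apply, basisVec_apply_self, one_smul, inner_basisVec_left]
  · intro κ h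
    rw [mul_apply_eq_comp, matUnit_apply, basisVec_apply_of_ne h, zero_smul, map_zero,
      inner_zero_right]

lemma trace_compress_mul {k : ℕ} (T : BFock ι) {B : BFock ι}
    (hB : B ∈ boundedSupportLevel ι k) : trace (compress k T * B) = trace (T * B) := by
  refine tsum_congr fun μ => ?_
  have hB' := mem_level_iff.1 hB
  rw [compress, mul_assoc, hB'.1, mul_assoc, mul_apply_eq_comp (P k)]
  have h : ∀ z, ⟪basisVec μ, P k z⟫_ℂ = ⟪P k (basisVec μ), z⟫_ℂ := fun z => by
    conv_rhs => rw [← star_P k, ContinuousLinearMap.star_eq_adjoint,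
      ContinuousLinearMap.adjoint_inner_left]
  rw [h, P_basisVec]
  split_ifs with hμ
  · rfl
  · rw [inner_zero_left, ← hB'.2, ← mul_assoc, mul_apply_eq_comp, P_basisVec, if_neg hμ, map_zero,
      inner_zero_right]

/-- The i-th term has norm at most ∑_n ‖r(v_i)^* x_n‖ ‖r(v_i)^* y_n‖, and these bounds are summable
over i. -/
lemma IsTraceClass.summable_slice {T : BFock ι} (h : IsTraceClass T) :
    Summable fun i => star (rightCreation i) * T * rightCreation i := by
  obtain ⟨x, y, hs, hT⟩ := h
  have h1 := (Equiv.prodComm ι ℕ).summable_iff.2 (summable_norm_star_rightCreation hs)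
  have h2 := ((summable_prod_of_nonneg (fun _ => by
    simp only [Function.comp_apply, Pi.zero_apply]; positivity)).1 h1)
  refine h2.2.of_norm_bounded fun i => ?_
  refine ContinuousLinearMap.opNorm_le_bound _ (tsum_nonneg fun _ => by
    simp only [Function.comp_apply]; positivity) fun z => ?_
  have h3 := (hT (rightCreation i z)).mapL (star (rightCreation i))
  simp only [map_smul] at h3
  rw [mul_apply_eq_comp, mul_apply_eq_comp, ← h3.tsum_eq, ← tsum_mul_right]
  refine tsum_of_norm_bounded ((h2.1 i).mul_right ‖z‖).hasSum fun n => ?_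
  simp only [Function.comp_apply, Equiv.prodComm_apply, Prod.swap_prod_mk]
  rw [norm_smul, ContinuousLinearMap.star_eq_adjoint, ← ContinuousLinearMap.adjoint_inner_left,
    mul_comm, mul_assoc]
  exact mul_le_mul_of_nonneg_left (norm_inner_le_norm _ _) (norm_nonneg _)

lemma IsTraceClass.hasSum_slice_apply {T : BFock ι} (h : IsTraceClass T) (μ ν : List ι) :
    HasSum (fun i => T (basisVec (μ ++ [i])) (ν ++ [i])) (slice T (basisVec μ) ν) := by
  have h1 := h.summable_slice.hasSum.mapL
    ((innerSL ℂ (basisVec ν)).comp (ContinuousLinearMap.apply ℂ (Fock ι) (basisVec μ)))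
  simp only [ContinuousLinearMap.comp_apply, ContinuousLinearMap.apply_apply, innerSL_apply_apply,
    inner_basisVec_left, mul_apply_eq_comp, rightCreation_basisVec, star_apply_coord] at h1
  exact h1

/-! ### Normal functionals from Gram matrices -/

/-- Expand the ζ_μ in a Hilbert basis (b_n) and let y_n ∈ F have coordinates ⟨b_n, ζ_μ⟩. Bessel's
inequality gives ∑ ‖y_n‖² ≤ ∑ ‖ζ_μ‖², so T ↦ ∑ ⟨y_n, T y_n⟩ is normal; Parseval identifies its
values on matrix units. -/
lemma exists_normal_gram {K : Type*} [NormedAddCommGroup K] [InnerProductSpace ℂ K]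
    [CompleteSpace K] (ζ : List ι → K) (hζ : Summable fun μ => ‖ζ μ‖ ^ 2) :
    ∃ φ : BFock ι →ₗ[ℂ] ℂ, IsNormal φ ∧ ∀ μ ν, φ (matUnit μ ν) = ⟪ζ μ, ζ ν⟫_ℂ := by
  obtain ⟨w, b, -⟩ := exists_hilbertBasis ℂ K
  have hmem : ∀ n, Memℓp (fun μ => ⟪b n, ζ μ⟫_ℂ) 2 := fun n => by
    refine memℓp_gen (hζ.of_nonneg_of_le (fun _ => by positivity) fun μ => ?_)
    simp only [ENNReal.toReal_ofNat, Real.rpow_ofNat]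
    refine pow_le_pow_left₀ (norm_nonneg _) ((norm_inner_le_norm _ _).trans_eq ?_) 2
    rw [b.orthonormal.1, one_mul]
  let y : w → Fock ι := fun n => ⟨_, hmem n⟩
  have hy : ∀ n μ, y n μ = ⟪b n, ζ μ⟫_ℂ := fun _ _ => rfl
  have hnorm : ∀ n, HasSum (fun μ => ‖⟪b n, ζ μ⟫_ℂ‖ ^ 2) (‖y n‖ * ‖y n‖) := fun n => by
    have := lp.hasSum_norm (p := 2) (by norm_num) (y n)
    simpa only [ENNReal.toReal_ofNat, Real.rpow_ofNat, hy, sq ‖y n‖] using this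
  have hs : Summable fun n => ‖y n‖ * ‖y n‖ := by
    refine summable_of_sum_le (c := ∑' μ, ‖ζ μ‖ ^ 2) (fun _ => by positivity) fun s => ?_
    refine hasSum_le (fun μ => ?_) (hasSum_sum fun n _ => hnorm n) hζ.hasSum
    exact b.orthonormal.sum_inner_products_le (ζ μ)
  refine ⟨seriesFunctional y y hs, .of_hasSum hs (hasSum_seriesFunctional hs), fun μ ν => ?_⟩
  refine (hasSum_seriesFunctional hs _).unique
    ((b.hasSum_inner_mul_inner (ζ μ) (ζ ν)).of_eq fun n => ?_)
  rw [matUnit_apply, inner_smul_right, ← inner_conj_symm, inner_basisVec_left, hy, hy,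
    inner_conj_symm, mul_comm]

/-! ### Existence and uniqueness of `Δω` -/

/-- The factor 4 counts the positive elements in the decomposition of a; the sharp constant is not
needed. -/
lemma PositiveLinearMap.norm_apply_le {A : Type*} [CStarAlgebra A] [PartialOrder A]
    [StarOrderedRing A] (f : A →ₚ[ℂ] ℂ) (a : A) : ‖f a‖ ≤ 4 * (‖f 1‖ * ‖a‖) := by
  obtain ⟨x, h0, hn, hx⟩ := CStarAlgebra.exists_sum_four_nonneg a
  conv_lhs => rw [hx]
  rw [map_sum]
  refine (norm_sum_le _ _).trans ?_
  have : ∀ i : Fin 4, ‖f (Complex.I ^ (i : ℕ) • x i)‖ ≤ ‖f 1‖ * ‖a‖ := fun i => by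
    rw [map_smul, norm_smul, norm_pow, Complex.norm_I, one_pow, one_mul]
    exact (f.norm_apply_le_of_nonneg _ (h0 i)).trans
      (mul_le_mul_of_nonneg_left (hn i) (norm_nonneg _))
  exact (Finset.sum_le_sum fun i _ => this i).trans_eq (by simp)

lemma PositiveLinearMap.continuous_complex {A : Type*} [CStarAlgebra A] [PartialOrder A]
    [StarOrderedRing A] (f : A →ₚ[ℂ] ℂ) : Continuous f :=
  (LinearMap.mkContinuousOfExistsBound (f : A →ₗ[ℂ] ℂ)
    ⟨4 * ‖f 1‖, fun a => by
      rw [mul_assoc]; exact PositiveLinearMap.norm_apply_le f a⟩).continuous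

lemma exists_isSelfAdjoint_mul_self_eq {A : Type*} [CStarAlgebra A] [PartialOrder A]
    [StarOrderedRing A] {a : A} (ha : 0 ≤ a) : ∃ s : A, IsSelfAdjoint s ∧ s * s = a :=
  ⟨CFC.sqrt a, .of_nonneg (CFC.sqrt_nonneg a), CFC.sqrt_mul_sqrt_self a ha⟩

/-- Positivity on 𝔅 is only tested on squares of elements of 𝔅, so the square root S must not leave
𝔅_m: (1 - P_m) S² (1 - P_m) = 0 forces S (1 - P_m) = 0. -/
lemma exists_eq_star_mul_self_of_mem_level {m : ℕ} {X : BFock ι} (h0 : 0 ≤ X)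
    (hX : X ∈ boundedSupportLevel ι m) :
    ∃ S ∈ boundedSupportLevel ι m, X = star S * S := by
  obtain ⟨S, hS, hSS⟩ := exists_isSelfAdjoint_mul_self_eq h0
  have h1 : S * P m = S := by
    rw [← sub_eq_zero, ← CStarRing.star_mul_self_eq_zero_iff, star_sub, star_mul, hS.star_eq,
      star_P, sub_mul, mul_sub, mul_sub, mul_assoc, mul_assoc, ← mul_assoc (S), hSS,
      ← mul_assoc, (mem_level_iff.1 hX).1, (mem_level_iff.1 hX).2]
    simp
  have h2 := congrArg star h1
  rw [star_mul, star_P, hS.star_eq] at h2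
  exact ⟨S, mem_level_iff.2 ⟨h2, h1⟩, by rw [hS.star_eq, hSS]⟩

/-- Compression to the words of length at most `m`, as a linear map into `𝔅`. -/
def compressB (m : ℕ) : BFock ι →ₗ[ℂ] boundedSupport ι where
  toFun A := ⟨compress m A, compress_mem m A⟩
  map_add' A B := Subtype.ext (by
    change compress m (A + B) = compress m A + compress m B
    simp only [compress, mul_add, add_mul])
  map_smul' c A := Subtype.ext (by
    change compress m (c • A) = c • compress m A
    simp only [compress, mul_smul_comm, smul_mul_assoc])

lemma IsPositive.apply_compressB_nonneg {ω : boundedSupport ι →ₗ[ℂ] ℂ} (hω : IsPositive ω)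
    (m : ℕ) {X : BFock ι} (hX : 0 ≤ X) : 0 ≤ ω (compressB m X) := by
  have h0 : 0 ≤ compress m X := by
    have := star_left_conjugate_nonneg hX (P m)
    rwa [star_P] at this
  obtain ⟨S, hS, h⟩ := exists_eq_star_mul_self_of_mem_level h0 (compress_mem_level m X)
  have := hω ⟨S, mem_boundedSupport_iff.2 ⟨m, hS⟩⟩
  rwa [show star (⟨S, mem_boundedSupport_iff.2 ⟨m, hS⟩⟩ : boundedSupport ι) * ⟨S, _⟩
    = compressB m X from Subtype.ext h.symm] at this

lemma deltaB_apply (B : boundedSupport ι) : deltaB B = B - betaB B := rfl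

/-- The averaged functionals which converge to `Δω` on `λ(𝔅)`. -/
def averaged (ω : boundedSupport ι →ₗ[ℂ] ℂ) (N : ℕ) : BFock ι →ₗ[ℂ] ℂ :=
  -- The last summand cancels the end term -ω(P_N A P_N) left by telescoping, and positivity of ω
  -- makes it nonnegative on positive operators.
  (N : ℂ)⁻¹ • (∑ m ∈ Finset.range N, ω ∘ₗ deltaB ∘ₗ compressB m + ω ∘ₗ compressB N)

lemma averaged_apply (ω : boundedSupport ι →ₗ[ℂ] ℂ) (N : ℕ) (A : BFock ι) :
    averaged ω N A = (N : ℂ)⁻¹ *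
      (∑ m ∈ Finset.range N, ω (deltaB (compressB m A)) + ω (compressB N A)) := by
  simp [averaged, mul_add]

lemma averaged_nonneg {ω : boundedSupport ι →ₗ[ℂ] ℂ} (hω : IsPositive ω) (hd : IsDecreasing ω)
    (N : ℕ) {A : BFock ι} (hA : 0 ≤ A) : 0 ≤ averaged ω N A := by
  rw [averaged_apply]
  refine mul_nonneg (inv_nonneg.2 (Nat.cast_nonneg N)) (add_nonneg ?_
    (hω.apply_compressB_nonneg N hA))
  exact Finset.sum_nonneg fun m _ => IsPositive.apply_compressB_nonneg (ω := ω ∘ₗ deltaB) hd m hA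

lemma tendsto_averaged (ω : boundedSupport ι →ₗ[ℂ] ℂ) {A : BFock ι} (B : boundedSupport ι)
    (hB : (B : BFock ι) = delta A) : Tendsto (fun N => averaged ω N A) atTop (𝓝 (ω B)) := by
  obtain ⟨k, hk⟩ := mem_boundedSupport_iff.1 B.2
  rw [hB] at hk
  set s : ℕ → ℂ := fun m => ω (compressB m A)
  -- The defect of the telescoping identity. It vanishes from k on, so its total is a constant that
  -- disappears after division by N.
  set d : ℕ → ℂ := fun m => ω (deltaB (compressB m A)) - (s m - s (m + 1) + ω B) with hd
  have hd0 : ∀ m, k ≤ m → d m = 0 := fun m hm => by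
    have h1 : compressB (m + 1) A = B + betaB (compressB m A) :=
      Subtype.ext ((compress_succ hk (by omega)).trans (by rw [← hB]; rfl))
    simp only [hd, s, deltaB_apply, h1, map_add, map_sub]
    ring
  have key : ∀ N, k ≤ N → N ≠ 0 → averaged ω N A
      = ω B + (∑ m ∈ Finset.range k, d m + s 0) * (N : ℂ)⁻¹ := fun N hN h0 => by
    have h2 : ∑ m ∈ Finset.range N, d m = ∑ m ∈ Finset.range k, d m := by
      refine (Finset.sum_subset (Finset.range_mono hN) fun m _ hm => hd0 m ?_).symm
      simpa using hm
    have h3 : ∑ m ∈ Finset.range N, ω (deltaB (compressB m A))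
        = ∑ m ∈ Finset.range N, d m + (s 0 - s N + N * ω B) := by
      rw [← Finset.sum_range_sub', ← nsmul_eq_mul, ← Finset.card_range N, ← Finset.sum_const,
        Finset.card_range, ← Finset.sum_add_distrib, ← Finset.sum_add_distrib]
      exact Finset.sum_congr rfl fun m _ => by rw [hd]; ring
    have hN0 : (N : ℂ) ≠ 0 := Nat.cast_ne_zero.2 h0
    rw [averaged_apply, h3, h2]
    change _ * (_ + s N) = _
    field_simp
    ring
  have hlim : Tendsto (fun N : ℕ => ω B + (∑ m ∈ Finset.range k, d m + s 0) * (N : ℂ)⁻¹) atTop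
      (𝓝 (ω B + (∑ m ∈ Finset.range k, d m + s 0) * 0)) :=
    tendsto_const_nhds.add (tendsto_const_nhds.mul (tendsto_inv_atTop_nhds_zero_nat (𝕜 := ℂ)))
  rw [mul_zero, add_zero] at hlim
  refine hlim.congr' ?_
  filter_upwards [eventually_ge_atTop k, eventually_ne_atTop 0] with N h1 h2
  exact (key N h1 h2).symm

/-- The averages are positive and their values at 1 are bounded, so they have a pointwise
ultrafilter limit on all of B(F). Extending this far settles positivity on the norm closure of λ(𝔅)
at once: no approximation of positive elements by squares from λ(𝔅) is needed. -/
lemma exists_positive_extension {ω : boundedSupport ι →ₗ[ℂ] ℂ} (hω : IsPositive ω)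
    (hd : IsDecreasing ω) : ∃ Φ : BFock ι →ₗ[ℂ] ℂ, (∀ A, 0 ≤ A → 0 ≤ Φ A) ∧
      ∀ (A : BFock ι) (B : boundedSupport ι), (B : BFock ι) = delta A → Φ A = ω B := by
  have hbd : ∃ C, ∀ N, ‖averaged ω N 1‖ ≤ C := by
    -- Since δ(1) = E_0, the averages converge at 1 and are therefore bounded there.
    have h1 := tendsto_averaged ω (A := 1) (EB 0) rfl
    obtain ⟨C, hC⟩ := (Metric.isBounded_range_of_tendsto _ h1).exists_norm_le
    exact ⟨C, fun N => hC _ ⟨N, rfl⟩⟩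
  obtain ⟨C, hC⟩ := hbd
  have hbound : ∀ A N, averaged ω N A ∈ Metric.closedBall (0 : ℂ) (4 * (C * ‖A‖)) := fun A N => by
    rw [mem_closedBall_zero_iff]
    have h1 := PositiveLinearMap.norm_apply_le
      (PositiveLinearMap.mk₀ (averaged ω N) fun A => averaged_nonneg hω hd N) A
    refine h1.trans ?_
    have h2 : ‖averaged ω N 1‖ * ‖A‖ ≤ C * ‖A‖ :=
      mul_le_mul_of_nonneg_right (hC N) (norm_nonneg _)
    exact mul_le_mul_of_nonneg_left h2 (by norm_num)
  have hlim : ∀ A, ∃ L, Tendsto (fun N => averaged ω N A) (hyperfilter ℕ) (𝓝 L) := fun A => by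
    obtain ⟨L, -, hL⟩ := (isCompact_closedBall (0 : ℂ) (4 * (C * ‖A‖))).ultrafilter_le_nhds
      ((hyperfilter ℕ).map fun N => averaged ω N A)
      (le_principal_iff.2 (mem_map.2 (Eventually.of_forall (hbound A))))
    exact ⟨L, hL⟩
  choose L hL using hlim
  refine ⟨{ toFun := L, map_add' := fun A B => ?_, map_smul' := fun c A => ?_ }, fun A hA => ?_,
    fun A B hB => ?_⟩
  · refine tendsto_nhds_unique (hL _) ?_
    simpa only [map_add] using (hL A).add (hL B)
  · refine tendsto_nhds_unique (hL _) ?_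
    simp only [map_smul]
    exact (hL A).const_smul c
  · exact ge_of_tendsto (hL A) (Eventually.of_forall fun N => averaged_nonneg hω hd N hA)
  -- The hyperfilter refines `atTop`, so where the averages converge the limit is the genuine one.
  · refine tendsto_nhds_unique (hL A) ((tendsto_averaged ω B hB).mono_left ?_)
    rw [← Nat.cofinite_eq_atTop]
    exact hyperfilter_le_cofinite

lemma incl_nonneg {A : ClosureLambda ι} (hA : 0 ≤ A) : 0 ≤ A.incl := by
  obtain ⟨B, rfl⟩ := CStarAlgebra.nonneg_iff_eq_star_mul_self.1 hA
  rw [map_mul, map_star]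
  exact star_mul_self_nonneg _

theorem exists_isDelta {ω : boundedSupport ι →ₗ[ℂ] ℂ} (hω : IsPositive ω)
    (hd : IsDecreasing ω) : ∃ φ, IsDelta ω φ := by
  obtain ⟨Φ, h0, h⟩ := exists_positive_extension hω hd
  refine ⟨PositiveLinearMap.mk₀ (Φ ∘ₗ (Generated.incl : ClosureLambda ι →⋆ₐ[ℂ] BFock ι).toLinearMap)
    fun A hA => h0 _ (incl_nonneg hA), fun A _ B hB => h _ _ hB⟩

lemma IsDelta.unique {ω : boundedSupport ι →ₗ[ℂ] ℂ} {φ ψ : ClosureLambda ι →ₚ[ℂ] ℂ}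
    (hφ : IsDelta ω φ) (hψ : IsDelta ω ψ) : φ = ψ := by
  refine DFunLike.coe_injective ((PositiveLinearMap.continuous_complex φ).ext_on dense_lambdaRange
    (PositiveLinearMap.continuous_complex ψ) fun A hA => ?_)
  have hA' := mem_lambdaRange_iff.1 hA
  rw [hφ A hA ⟨_, hA'⟩ rfl, hψ A hA ⟨_, hA'⟩ rfl]

theorem existsUnique_isDelta {ω : boundedSupport ι →ₗ[ℂ] ℂ} (hω : IsDecreasingLocallyNormal ω) :
    ∃! φ, IsDelta ω φ :=
  let ⟨φ, hφ⟩ := exists_isDelta hω.1 hω.2.1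
  ⟨φ, hφ, fun _ h => h.unique hφ⟩

lemma IsDecreasingLocallyNormal.isDelta {ω : boundedSupport ι →ₗ[ℂ] ℂ}
    (hω : IsDecreasingLocallyNormal ω) : IsDelta ω (Delta ω) :=
  isDelta_Delta (exists_isDelta hω.1 hω.2.1)

lemma IsLocallyNormal.comp_betaB {ω : boundedSupport ι →ₗ[ℂ] ℂ} (hω : IsLocallyNormal ω) :
    IsLocallyNormal (ω ∘ₗ betaB) := fun k => by
  obtain ⟨φ, hφ, h⟩ := hω (k + 1)
  exact ⟨φ ∘ₗ betaL, hφ.comp_beta, fun B hB => h (betaB B) (beta_mem_level hB)⟩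

lemma IsDecreasingLocallyNormal.comp_betaB {ω : boundedSupport ι →ₗ[ℂ] ℂ}
    (hω : IsDecreasingLocallyNormal ω) : IsDecreasingLocallyNormal (ω ∘ₗ betaB) := by
  have hmul : ∀ B : boundedSupport ι, betaB (star B * B) = star (betaB B) * betaB B := fun B =>
    Subtype.ext (by
      change beta (star (B : BFock ι) * (B : BFock ι))
        = star (beta (B : BFock ι)) * beta (B : BFock ι)
      rw [map_mul, map_star])
  have hcomm : ∀ B : boundedSupport ι, betaB (deltaB B) = deltaB (betaB B) := fun B => by
    rw [deltaB_apply, deltaB_apply, map_sub]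
  refine ⟨fun B => ?_, fun B => ?_, hω.2.2.comp_betaB⟩
  · rw [LinearMap.comp_apply, hmul]; exact hω.1 _
  · rw [LinearMap.comp_apply, LinearMap.comp_apply, hcomm, hmul]; exact hω.2.1 _

/-! ### Locally normal functionals and matrix units -/

/-- Strongly, β(e_{μν}) = ∑_i e_{μi,νi}; normality one level up lets ω pass through the sum. -/
lemma IsLocallyNormal.hasSum_betaB_matUnitB {ω : boundedSupport ι →ₗ[ℂ] ℂ}
    (hω : IsLocallyNormal ω) (μ ν : List ι) :
    HasSum (fun i => ω (matUnitB (μ ++ [i]) (ν ++ [i]))) (ω (betaB (matUnitB μ ν))) := by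
  set k := max μ.length ν.length
  have hl : matUnit μ ν ∈ boundedSupportLevel ι k :=
    matUnit_mem_level (le_max_left _ _) (le_max_right _ _)
  obtain ⟨φ, hφ, h⟩ := hω (k + 1)
  rw [h _ (beta_mem_level hl)]
  refine (hφ.hasSum_beta (matUnit μ ν)).of_eq fun i => ?_
  rw [rightCreation_mul_matUnit_mul]
  refine h _ (matUnit_mem_level ?_ ?_) <;> simp [k]

/-- Continuity on bounded subsets of the `𝔅_k`, along compressions by finite projections. -/
def IsApproximable (ψ : boundedSupport ι →ₗ[ℂ] ℂ) : Prop :=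
  ∀ (k : ℕ) (C : ℝ) (T : Finset (List ι) → boundedSupport ι) (T' : boundedSupport ι),
    (∀ s, (T s : BFock ι) ∈ boundedSupportLevel ι k) →
    (T' : BFock ι) ∈ boundedSupportLevel ι k → (∀ s, ‖(T s : BFock ι)‖ ≤ C) →
    (∀ x y, Tendsto (fun s => ⟪y, (T s : BFock ι) x⟫_ℂ) atTop (𝓝 ⟪y, (T' : BFock ι) x⟫_ℂ)) →
    Tendsto (fun s => ψ (T s)) atTop (𝓝 (ψ T'))

lemma IsLocallyNormal.isApproximable {ω : boundedSupport ι →ₗ[ℂ] ℂ} (hω : IsLocallyNormal ω) :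
    IsApproximable ω := by
  intro k C T T' hT hT' hC h
  obtain ⟨φ, hφ, hk⟩ := hω k
  rw [hk _ hT']
  simp only [hk _ (hT _)]
  exact hφ.tendsto hC h

lemma IsApproximable.sub {ψ χ : boundedSupport ι →ₗ[ℂ] ℂ} (hψ : IsApproximable ψ)
    (hχ : IsApproximable χ) : IsApproximable (ψ - χ) :=
  fun k C T T' hT hT' hC h => (hψ k C T T' hT hT' hC h).sub (hχ k C T T' hT hT' hC h)

lemma wordProj_mul_mul_wordProj (s : Finset (List ι)) (A : BFock ι) :
    wordProj s * A * wordProj s = ∑ μ ∈ s, ∑ ν ∈ s, A (basisVec ν) μ • matUnit μ ν := by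
  simp only [wordProj, Finset.sum_mul, Finset.mul_sum, matUnit_mul_mul_matUnit]
  exact Finset.sum_comm

lemma wordProj_mul_P_comm (s : Finset (List ι)) (k : ℕ) :
    P k * wordProj s = wordProj s * P k := by
  have h : ∀ μ : List ι, P k * matUnit μ μ = matUnit μ μ * P k := fun μ => by
    by_cases hμ : μ.length ≤ k
    · have := mem_level_iff.1 (matUnit_mem_level hμ hμ)
      rw [this.1, this.2]
    · have h1 : P k * matUnit μ μ = 0 := by
        ext x : 1
        rw [mul_apply_eq_comp, matUnit_apply, map_smul, P_basisVec, if_neg hμ, smul_zero,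
          zero_apply]
      have h2 := congrArg star h1
      rw [star_mul, star_matUnit, star_P, star_zero] at h2
      rw [h1, h2]
  rw [wordProj, Finset.mul_sum, Finset.sum_mul]
  exact Finset.sum_congr rfl fun μ _ => h μ

lemma wordProj_conj_mem_level {k : ℕ} {A : BFock ι} (hA : A ∈ boundedSupportLevel ι k)
    (s : Finset (List ι)) : wordProj s * A * wordProj s ∈ boundedSupportLevel ι k := by
  have h := mem_level_iff.1 hA
  refine mem_level_iff.2 ⟨?_, ?_⟩
  · rw [← mul_assoc, ← mul_assoc, wordProj_mul_P_comm, mul_assoc (wordProj s), h.1]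
  · rw [mul_assoc, ← wordProj_mul_P_comm, ← mul_assoc, mul_assoc (wordProj s), h.2]

lemma norm_wordProj_conj_le (s : Finset (List ι)) (A : BFock ι) :
    ‖wordProj s * A * wordProj s‖ ≤ ‖A‖ := by
  refine (norm_mul_le _ _).trans ((mul_le_of_le_one_right (norm_nonneg _)
    (norm_wordProj_le s)).trans ((norm_mul_le _ _).trans ?_))
  exact mul_le_of_le_one_left (norm_nonneg _) (norm_wordProj_le s)

lemma tendsto_inner_wordProj_conj (A : BFock ι) (x y : Fock ι) :
    Tendsto (fun s => ⟪y, (wordProj s * A * wordProj s : BFock ι) x⟫_ℂ) atTop (𝓝 ⟪y, A x⟫_ℂ) := by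
  have h : ∀ s, ⟪y, (wordProj s * A * wordProj s : BFock ι) x⟫_ℂ
      = ⟪wordProj s y, A (wordProj s x)⟫_ℂ := fun s => by
    have hs : star (wordProj s) = wordProj s := (isStarProjection_wordProj s).isSelfAdjoint
    conv_lhs => rw [← hs, hs, mul_assoc, mul_apply_eq_comp, ← hs,
      ContinuousLinearMap.star_eq_adjoint, ContinuousLinearMap.adjoint_inner_right,
      mul_apply_eq_comp, ← ContinuousLinearMap.star_eq_adjoint, hs]
  simp only [h]
  exact (tendsto_wordProj y).inner ((A.continuous.tendsto _).comp (tendsto_wordProj x))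

/-- The compression of an element of `𝔅` to a finite set of words. -/
def finCompressB (s : Finset (List ι)) (B : boundedSupport ι) : boundedSupport ι :=
  ∑ μ ∈ s, ∑ ν ∈ s, (B : BFock ι) (basisVec ν) μ • matUnitB μ ν

lemma coe_finCompressB (s : Finset (List ι)) (B : boundedSupport ι) :
    (finCompressB s B : BFock ι) = wordProj s * (B : BFock ι) * wordProj s := by
  rw [wordProj_mul_mul_wordProj, finCompressB, AddSubmonoidClass.coe_finsetSum]
  refine Finset.sum_congr rfl fun μ _ => ?_
  rw [AddSubmonoidClass.coe_finsetSum]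
  rfl

lemma IsApproximable.tendsto_finCompressB {ψ : boundedSupport ι →ₗ[ℂ] ℂ}
    (hψ : IsApproximable ψ) (B : boundedSupport ι) :
    Tendsto (fun s => ψ (finCompressB s B)) atTop (𝓝 (ψ B)) := by
  obtain ⟨k, hk⟩ := mem_boundedSupport_iff.1 B.2
  refine hψ k ‖(B : BFock ι)‖ _ B (fun s => ?_) hk (fun s => ?_) fun x y => ?_
  · rw [coe_finCompressB]; exact wordProj_conj_mem_level hk s
  · rw [coe_finCompressB]; exact norm_wordProj_conj_le s _
  · simp only [coe_finCompressB]; exact tendsto_inner_wordProj_conj _ x y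

lemma IsApproximable.ext {ψ χ : boundedSupport ι →ₗ[ℂ] ℂ} (hψ : IsApproximable ψ)
    (hχ : IsApproximable χ) (h : ∀ μ ν, ψ (matUnitB μ ν) = χ (matUnitB μ ν)) : ψ = χ := by
  refine LinearMap.ext fun B => tendsto_nhds_unique (hψ.tendsto_finCompressB B) ?_
  convert hχ.tendsto_finCompressB B using 2 with s
  simp only [finCompressB, map_sum, map_smul, h]

/-- The entry (B^*B)_{μν} is the sum over κ of conj(B_{κμ}) B_{κν}. Hence the value at a finite
compression of B^*B is a sum over κ of the given nonnegative forms, with c the κ-th row of B. -/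
lemma IsApproximable.isPositive {ψ : boundedSupport ι →ₗ[ℂ] ℂ} (hψ : IsApproximable ψ)
    (h : ∀ (s : Finset (List ι)) (c : List ι → ℂ),
      0 ≤ ∑ μ ∈ s, ∑ ν ∈ s, starRingEnd ℂ (c μ) * c ν * ψ (matUnitB μ ν)) : IsPositive ψ := by
  intro B
  refine ge_of_tendsto (hψ.tendsto_finCompressB _) (Eventually.of_forall fun s => ?_)
  have h1 : ∀ μ ν, HasSum (fun κ => starRingEnd ℂ ((B : BFock ι) (basisVec μ) κ)
      * (B : BFock ι) (basisVec ν) κ * ψ (matUnitB μ ν))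
      ((star (B : BFock ι) * (B : BFock ι)) (basisVec ν) μ * ψ (matUnitB μ ν)) := fun μ ν => by
    rw [mul_apply_eq_comp, star_apply_coord]
    refine ((lp.hasSum_inner ((B : BFock ι) (basisVec μ))
      ((B : BFock ι) (basisVec ν))).mul_right (ψ (matUnitB μ ν))).of_eq fun κ => ?_
    rw [RCLike.inner_apply, mul_comm (starRingEnd ℂ _)]
  have h2 := hasSum_sum (s := s) fun μ _ => hasSum_sum (s := s) fun ν _ => h1 μ ν
  simp only [finCompressB, map_sum, map_smul]
  exact h2.nonneg fun κ => h s fun μ => (B : BFock ι) (basisVec μ) κ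

/-! ### The GNS representation -/

section GNS

variable {A : Type*} [CStarAlgebra A] [PartialOrder A] [StarOrderedRing A] (f : A →ₚ[ℂ] ℂ)

/-- The vector of the GNS space which is given by an element of the algebra. -/
def gnsVec : A →ₗ[ℂ] f.GNS where
  toFun a := (f.toPreGNS a : f.GNS)
  map_add' a b := by rw [map_add, UniformSpace.Completion.coe_add]
  map_smul' c a := by rw [map_smul, UniformSpace.Completion.coe_smul]; rfl

lemma inner_gnsVec (a b : A) : ⟪gnsVec f a, gnsVec f b⟫_ℂ = f (star a * b) := by
  change ⟪(f.toPreGNS a : f.GNS), (f.toPreGNS b : f.GNS)⟫_ℂ = _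
  rw [UniformSpace.Completion.inner_coe, f.preGNS_inner_def, f.ofPreGNS_toPreGNS,
    f.ofPreGNS_toPreGNS]

lemma norm_gnsVec_sq (a : A) : (‖gnsVec f a‖ ^ 2 : ℂ) = f (star a * a) := by
  rw [← inner_gnsVec, inner_self_eq_norm_sq_to_K]; rfl

lemma gnsStarAlgHom_gnsVec (a b : A) : f.gnsStarAlgHom a (gnsVec f b) = gnsVec f (a * b) :=
  f.gnsNonUnitalStarAlgHom_apply_coe

lemma denseRange_gnsVec : DenseRange (gnsVec f) :=
  UniformSpace.Completion.denseRange_coe (α := f.PreGNS)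

open scoped CStarAlgebra in
lemma continuous_gnsVec : Continuous (gnsVec f) := by
  have h : ∀ a, gnsVec f a = f.gnsStarAlgHom a (gnsVec f 1) := fun a => by
    rw [gnsStarAlgHom_gnsVec, mul_one]
  have h1 : Continuous f.gnsStarAlgHom := map_continuous f.gnsStarAlgHom
  rw [show ⇑(gnsVec f) = fun a => f.gnsStarAlgHom a (gnsVec f 1) from funext h]
  exact h1.clm_apply continuous_const

lemma norm_apply_sq_le (a b : A) : ‖f (star a * b)‖ ^ 2 ≤ ‖f (star a * a)‖ * ‖f (star b * b)‖ := by
  have h : ∀ a, ‖f (star a * a)‖ = ‖gnsVec f a‖ ^ 2 := fun a => by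
    rw [← norm_gnsVec_sq, norm_pow, Complex.norm_real, norm_norm]
  rw [h, h, ← inner_gnsVec, ← mul_pow]
  exact pow_le_pow_left₀ (norm_nonneg _) (norm_inner_le_norm _ _) 2

end GNS

/-! ### Orthogonal isometries -/

lemma isStarProjection_sum_mul_star {A κ : Type*} [CStarAlgebra A] {w : κ → A}
    [DecidableEq κ] (h : ∀ i j, star (w i) * w j = if i = j then 1 else 0) (s : Finset κ) :
    IsStarProjection (∑ i ∈ s, w i * star (w i)) := by
  constructor
  · rw [IsIdempotentElem, Finset.sum_mul]
    refine Finset.sum_congr rfl fun i hi => ?_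
    rw [Finset.mul_sum, Finset.sum_eq_single_of_mem i hi]
    · rw [mul_assoc, ← mul_assoc (star (w i)), h, if_pos rfl, one_mul]
    · intro j _ hj
      rw [mul_assoc, ← mul_assoc (star (w i)), h, if_neg hj.symm, zero_mul, mul_zero]
  · simp only [isSelfAdjoint_iff, star_sum, star_mul, star_star]

lemma sum_mul_star_le_one {A κ : Type*} [CStarAlgebra A] [PartialOrder A] [StarOrderedRing A]
    {w : κ → A} [DecidableEq κ] (h : ∀ i j, star (w i) * w j = if i = j then 1 else 0)
    (s : Finset κ) : ∑ i ∈ s, w i * star (w i) ≤ 1 :=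
  (isStarProjection_sum_mul_star h s).le_one

/-! ### Words in the Toeplitz-Cuntz algebra -/

lemma TO.word_nil : TO.word ([] : List ι) = 1 := rfl

lemma TO.word_cons (i : ι) (μ : List ι) : TO.word (i :: μ) = TO.v i * TO.word μ := by
  rw [word, word, List.map_cons, List.prod_cons]

lemma TO.word_append (μ ν : List ι) : TO.word (μ ++ ν) = TO.word μ * TO.word ν := by
  rw [word, word, word, List.map_append, List.prod_append]

lemma TO.word_append_singleton (μ : List ι) (i : ι) :
    TO.word (μ ++ [i]) = TO.word μ * TO.v i := by
  rw [word_append, word_cons, word_nil, mul_one]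

lemma TO.star_v_mul_v_eq [DecidableEq ι] (i j : ι) :
    star (TO.v i) * TO.v j = if i = j then 1 else 0 := by
  split_ifs with h
  · rw [h, star_v_mul_v]
  · exact star_v_mul_v_of_ne h

lemma TO.star_word_mul_word [DecidableEq (List ι)] {μ ν : List ι} (h : μ.length = ν.length) :
    star (TO.word μ) * TO.word ν = if μ = ν then 1 else 0 := by
  induction μ generalizing ν with
  | nil =>
    obtain rfl : ν = [] := by simpa using h.symm
    simp [word_nil]
  | cons i μ ih =>
    obtain _ | ⟨j, ν⟩ := ν
    · simp at h
    · rw [word_cons, word_cons, star_mul, mul_assoc, ← mul_assoc (star (v i))]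
      by_cases hij : i = j
      · subst hij
        rw [star_v_mul_v, one_mul, ih (by simpa using h)]
        simp
      · rw [star_v_mul_v_of_ne hij, zero_mul, mul_zero, if_neg (by simp [hij])]

lemma TO.star_word_mul_word_subtype [DecidableEq (List ι)] {k : ℕ}
    (μ ν : {μ : List ι // μ.length = k}) :
    star (TO.word μ.1) * TO.word ν.1 = if μ = ν then 1 else 0 := by
  rw [star_word_mul_word (μ.2.trans ν.2.symm)]
  simp only [Subtype.ext_iff]

/-- The elements `v_μ v_ν^*` span a dense subspace of the Toeplitz-Cuntz algebra. -/
lemma TO.dense_span : Dense (Submodule.span ℂ (Set.range fun p : List ι × List ι =>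
    TO.word p.1 * star (TO.word p.2)) : Set (TO ι)) := by
  classical
  set M := Submodule.span ℂ (Set.range fun p : List ι × List ι =>
    TO.word p.1 * star (TO.word p.2)) with hM
  have hmem : ∀ μ ν : List ι, TO.word μ * star (TO.word ν) ∈ M := fun μ ν =>
    Submodule.subset_span ⟨(μ, ν), rfl⟩
  -- The span contains 1, so it suffices that left multiplication by every element of the generated
  -- `*`-algebra preserves it. The induction below carries along the same statement for the adjoint.
  have hclosed : ∀ a : TO ι, (∀ μ ν, a * (TO.word μ * star (TO.word ν)) ∈ M) →
      ∀ m ∈ M, a * m ∈ M := by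
    intro a ha m hm
    refine Submodule.span_induction ?_ ?_ ?_ ?_ hm
    · rintro _ ⟨⟨μ, ν⟩, rfl⟩; exact ha μ ν
    · rw [mul_zero]; exact M.zero_mem
    · intro x y _ _ hx hy; rw [mul_add]; exact M.add_mem hx hy
    · intro c x _ hx; rw [mul_smul_comm]; exact M.smul_mem c hx
  have key : ∀ x ∈ StarAlgebra.adjoin ℂ (Set.range (ambientGen (ι := ι))),
      ∃ a : TO ι, a.incl = x ∧ (∀ m ∈ M, a * m ∈ M) ∧ ∀ m ∈ M, star a * m ∈ M := by
    intro x hx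
    refine StarAlgebra.adjoin_induction (p := fun x _ => ∃ a : TO ι, a.incl = x ∧
      (∀ m ∈ M, a * m ∈ M) ∧ ∀ m ∈ M, star a * m ∈ M) ?_ ?_ ?_ ?_ ?_ hx
    · rintro _ ⟨i, rfl⟩
      refine ⟨TO.v i, rfl, hclosed _ fun μ ν => ?_, hclosed _ fun μ ν => ?_⟩
      · rw [← mul_assoc, ← word_cons]; exact hmem _ _
      · obtain _ | ⟨j, μ⟩ := μ
        -- With no letter to cancel, v_i^* joins the starred word: v_i^* v_ν^* = (v_ν v_i)^*.
        · rw [word_nil, one_mul, ← star_mul, ← word_append_singleton]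
          simpa only [word_nil, one_mul] using hmem [] (ν ++ [i])
        · rw [word_cons, ← mul_assoc, ← mul_assoc, star_v_mul_v_eq]
          split_ifs
          · rw [one_mul]; exact hmem _ _
          · rw [zero_mul, zero_mul]; exact M.zero_mem
    · intro c
      refine ⟨algebraMap ℂ _ c, AlgHomClass.commutes _ c, fun m hm => ?_, fun m hm => ?_⟩
      · rw [← Algebra.smul_def]; exact M.smul_mem c hm
      · rw [← algebraMap_star_comm, ← Algebra.smul_def]; exact M.smul_mem _ hm
    · rintro _ _ _ _ ⟨a, rfl, ha, ha'⟩ ⟨b, rfl, hb, hb'⟩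
      refine ⟨a + b, map_add _ _ _, fun m hm => ?_, fun m hm => ?_⟩
      · rw [add_mul]; exact M.add_mem (ha m hm) (hb m hm)
      · rw [star_add, add_mul]; exact M.add_mem (ha' m hm) (hb' m hm)
    · rintro _ _ _ _ ⟨a, rfl, ha, ha'⟩ ⟨b, rfl, hb, hb'⟩
      refine ⟨a * b, map_mul _ _ _, fun m hm => ?_, fun m hm => ?_⟩
      · rw [mul_assoc]; exact ha _ (hb m hm)
      · rw [star_mul, mul_assoc]; exact hb' _ (ha' m hm)
    · rintro _ _ ⟨a, rfl, ha, ha'⟩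
      exact ⟨star a, map_star _ _, ha', by simpa only [star_star] using ha⟩
  refine (Generated.dense_adjoin (Set.range (ambientGen (ι := ι)))).mono fun x hx => ?_
  obtain ⟨a, ha, h, -⟩ := key _ hx
  obtain rfl := Generated.incl_injective ha
  have h1 : (1 : TO ι) ∈ M := by
    have := hmem [] []
    rwa [word_nil, star_one, mul_one] at this
  have := h 1 h1
  rwa [mul_one] at this

open scoped CStarAlgebra in
lemma continuous_fockRepClosure : Continuous (fockRepClosure ι) :=
  map_continuous (fockRepClosure ι)

lemma IsDecreasingLocallyNormal.Delta_word {ω : boundedSupport ι →ₗ[ℂ] ℂ}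
    (hω : IsDecreasingLocallyNormal ω) (μ ν : List ι) :
    Delta ω (fockRepClosure ι (TO.word μ * star (TO.word ν))) = ω (matUnitB μ ν) := by
  have h : (fockRepClosure ι (TO.word μ * star (TO.word ν))).incl
      = leftWord μ * star (leftWord ν) := by
    rw [incl_fockRepClosure, map_mul, map_star]; rfl
  refine hω.isDelta _ ?_ _ ?_
  · rw [h, mem_lambdaRange_iff, delta_leftWord]; exact (matUnitB μ ν).2
  · rw [h, delta_leftWord]; rfl

/-- A functional on the Toeplitz-Cuntz algebra is `Δω ∘ l` if and only if the matrix of `ω`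
consists of its values at the elements `v_μ v_ν^*`. -/
lemma eq_Delta_iff {ω : boundedSupport ι →ₗ[ℂ] ℂ} (hω : IsDecreasingLocallyNormal ω)
    (ρ : TO ι →ₚ[ℂ] ℂ) : (∀ x, ρ x = Delta ω (fockRepClosure ι x)) ↔
      ∀ μ ν, ρ (TO.word μ * star (TO.word ν)) = ω (matUnitB μ ν) := by
  refine ⟨fun h μ ν => (h _).trans (hω.Delta_word μ ν), fun h => ?_⟩
  refine congrFun ((PositiveLinearMap.continuous_complex ρ).ext_on TO.dense_span
    ((PositiveLinearMap.continuous_complex (Delta ω)).comp continuous_fockRepClosure)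
    fun x hx => ?_)
  refine Submodule.span_induction ?_ ?_ ?_ ?_ hx
  · rintro _ ⟨⟨μ, ν⟩, rfl⟩
    exact (h μ ν).trans (hω.Delta_word μ ν).symm
  · simp only [map_zero]
  · intro x y _ _ hx hy
    simp only [map_add] at hx hy ⊢
    rw [hx, hy]
  · intro c x _ hx
    simp only [map_smul] at hx ⊢
    rw [hx]

/-! ### The functional `ω` of a functional on the Toeplitz-Cuntz algebra -/

/-- Each B is evaluated at a chosen level. Compatibility makes the value independent of the level,
and linearity is checked at a common higher one. -/
lemma exists_glue (φ : ℕ → BFock ι →ₗ[ℂ] ℂ)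
    (h : ∀ k, ∀ B ∈ boundedSupportLevel ι k, φ (k + 1) B = φ k B) :
    ∃ ω : boundedSupport ι →ₗ[ℂ] ℂ, ∀ (k : ℕ) (B : boundedSupport ι),
      (B : BFock ι) ∈ boundedSupportLevel ι k → ω B = φ k B := by
  have hmono : ∀ {k m : ℕ}, k ≤ m → ∀ B ∈ boundedSupportLevel ι k, φ m B = φ k B := by
    intro k m hkm B hB
    induction m, hkm using Nat.le_induction with
    | base => rfl
    | succ m hkm ih => rw [h m B (level_mono hkm hB), ih]
  have heq : ∀ {k m : ℕ} (B : BFock ι), B ∈ boundedSupportLevel ι k →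
      B ∈ boundedSupportLevel ι m → φ k B = φ m B := fun {k m} B hk hm => by
    rw [← hmono (le_max_left k m) B hk, ← hmono (le_max_right k m) B hm]
  choose lev hlev using fun B : boundedSupport ι => mem_boundedSupport_iff.1 B.2
  refine ⟨{ toFun := fun B => φ (lev B) B, map_add' := fun A B => ?_, map_smul' := fun c B => ?_ },
    fun k B hB => heq _ (hlev B) hB⟩
  · set m := max (lev (A + B)) (max (lev A) (lev B))
    rw [← hmono (le_max_left _ _ : _ ≤ m) _ (hlev (A + B)),
      ← hmono ((le_max_left _ _).trans (le_max_right _ _) : lev A ≤ m) _ (hlev A),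
      ← hmono ((le_max_right _ _).trans (le_max_right _ _) : lev B ≤ m) _ (hlev B), ← map_add]
    rfl
  · set m := max (lev (c • B)) (lev B)
    rw [← hmono (le_max_left _ _ : _ ≤ m) _ (hlev (c • B)),
      ← hmono (le_max_right _ _ : lev B ≤ m) _ (hlev B), RingHom.id_apply, ← map_smul]
    rfl

lemma coord_eq_zero_of_mem_level {k : ℕ} {B : BFock ι} (hB : B ∈ boundedSupportLevel ι k)
    {μ ν : List ι} (h : ¬ (μ.length ≤ k ∧ ν.length ≤ k)) : B (basisVec ν) μ = 0 := by
  have h' := mem_level_iff.1 hB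
  rw [not_and_or] at h
  rcases h with h | h
  · rw [← inner_basisVec_left, ← h'.1, mul_apply_eq_comp, ← star_P k,
      ContinuousLinearMap.star_eq_adjoint, ContinuousLinearMap.adjoint_inner_right, P_basisVec,
      if_neg h, inner_zero_left]
  · rw [← h'.2, mul_apply_eq_comp, P_basisVec, if_neg h, map_zero]; rfl

lemma IsNormal.tendsto_wordProj_conj {φ : BFock ι →ₗ[ℂ] ℂ} (hφ : IsNormal φ) (B : BFock ι) :
    Tendsto (fun s => ∑ μ ∈ s, ∑ ν ∈ s, B (basisVec ν) μ * φ (matUnit μ ν)) atTop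
      (𝓝 (φ B)) := by
  have := hφ.tendsto (norm_wordProj_conj_le · B) (tendsto_inner_wordProj_conj B)
  simpa only [wordProj_mul_mul_wordProj, map_sum, map_smul, smul_eq_mul] using this

lemma IsNormal.eq_of_matUnit_eq {φ χ : BFock ι →ₗ[ℂ] ℂ} (hφ : IsNormal φ) (hχ : IsNormal χ)
    {k : ℕ} (h : ∀ μ ν : List ι, μ.length ≤ k → ν.length ≤ k →
      φ (matUnit μ ν) = χ (matUnit μ ν)) {B : BFock ι} (hB : B ∈ boundedSupportLevel ι k) :
    φ B = χ B := by
  refine tendsto_nhds_unique (hφ.tendsto_wordProj_conj B) ?_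
  refine (hχ.tendsto_wordProj_conj B).congr fun s => ?_
  refine Finset.sum_congr rfl fun μ _ => Finset.sum_congr rfl fun ν _ => ?_
  by_cases hl : μ.length ≤ k ∧ ν.length ≤ k
  · rw [h μ ν hl.1 hl.2]
  · rw [coord_eq_zero_of_mem_level hB hl, zero_mul, zero_mul]

/-- The vectors `π(v_μ)^* ξ` in the GNS space. -/
def wordVec (ρ : TO ι →ₚ[ℂ] ℂ) (μ : List ι) : ρ.GNS := gnsVec ρ (star (TO.word μ))

lemma inner_wordVec (ρ : TO ι →ₚ[ℂ] ℂ) (μ ν : List ι) :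
    ⟪wordVec ρ μ, wordVec ρ ν⟫_ℂ = ρ (TO.word μ * star (TO.word ν)) := by
  rw [wordVec, wordVec, inner_gnsVec, star_star]

lemma norm_wordVec_sq (ρ : TO ι →ₚ[ℂ] ℂ) (μ : List ι) :
    (‖wordVec ρ μ‖ ^ 2 : ℂ) = ρ (TO.word μ * star (TO.word μ)) := by
  rw [← inner_wordVec, inner_self_eq_norm_sq_to_K]; rfl

lemma sum_norm_wordVec_sq_le (ρ : TO ι →ₚ[ℂ] ℂ) (k : ℕ)
    (s : Finset {μ : List ι // μ.length = k}) :
    ∑ μ ∈ s, ‖wordVec ρ μ.1‖ ^ 2 ≤ ‖gnsVec ρ 1‖ ^ 2 := by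
  classical
  have h := sum_mul_star_le_one (TO.star_word_mul_word_subtype (ι := ι) (k := k)) s
  have h1 := OrderHomClass.mono ρ h
  have h2 := norm_gnsVec_sq ρ 1
  rw [star_one, one_mul] at h2
  rw [map_sum, ← h2] at h1
  simp only [← norm_wordVec_sq] at h1
  exact_mod_cast h1

lemma summable_norm_wordVec_sq (ρ : TO ι →ₚ[ℂ] ℂ) (k : ℕ) :
    Summable fun μ : List ι => if μ.length = k then ‖wordVec ρ μ‖ ^ 2 else 0 := by
  refine ((Subtype.val_injective (p := fun μ : List ι => μ.length = k)).summable_iff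
    fun μ hμ => if_neg fun h => hμ ⟨⟨μ, h⟩, rfl⟩).1 ?_
  refine (summable_of_sum_le (fun _ => sq_nonneg _) (sum_norm_wordVec_sq_le ρ k)).congr
    fun μ => ?_
  rw [Function.comp_apply, if_pos μ.2]

/-- Words of equal length have orthogonal ranges, so for each of the k + 1 lengths involved the
vectors have total squared norm at most ρ(1); their truncated Gram matrix is thus normal. -/
lemma exists_normal_level (ρ : TO ι →ₚ[ℂ] ℂ) (k : ℕ) :
    ∃ φ : BFock ι →ₗ[ℂ] ℂ, IsNormal φ ∧ ∀ μ ν : List ι, μ.length ≤ k → ν.length ≤ k →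
      φ (matUnit μ ν) = ρ (TO.word μ * star (TO.word ν)) := by
  classical
  obtain ⟨φ, hφ, h⟩ := exists_normal_gram
    (fun μ : List ι => if μ.length ≤ k then wordVec ρ μ else 0) (by
      have h := summable_sum fun j (_ : j ∈ Finset.range (k + 1)) => summable_norm_wordVec_sq ρ j
      refine h.congr fun μ => ?_
      rw [Finset.sum_ite_eq]
      simp only [Finset.mem_range, Nat.lt_succ_iff]
      split_ifs <;> simp)
  refine ⟨φ, hφ, fun μ ν hμ hν => ?_⟩
  rw [h, if_pos hμ, if_pos hν, inner_wordVec]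

/-- Although δ does not preserve the levels, ω ∘ δ is the difference of the locally normal
functionals ω and ω ∘ β. -/
lemma IsLocallyNormal.isApproximable_comp_deltaB {ω : boundedSupport ι →ₗ[ℂ] ℂ}
    (hω : IsLocallyNormal ω) : IsApproximable (ω ∘ₗ deltaB) := by
  have := hω.isApproximable.sub hω.comp_betaB.isApproximable
  rwa [show ω - ω ∘ₗ betaB = ω ∘ₗ deltaB from LinearMap.ext fun B => by
    rw [LinearMap.comp_apply, deltaB_apply, map_sub]; rfl] at this

lemma sum_conj_mul_word (ρ : TO ι →ₚ[ℂ] ℂ) (s : Finset (List ι)) (c : List ι → ℂ) (z : TO ι) :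
    ∑ μ ∈ s, ∑ ν ∈ s, starRingEnd ℂ (c μ) * c ν * ρ (TO.word μ * z * star (TO.word ν))
      = ρ ((∑ μ ∈ s, starRingEnd ℂ (c μ) • TO.word μ) * z *
        star (∑ μ ∈ s, starRingEnd ℂ (c μ) • TO.word μ)) := by
  simp only [star_sum, star_smul, Finset.sum_mul, Finset.mul_sum, map_sum, smul_mul_assoc,
    mul_smul_comm, map_smul, smul_eq_mul, RCLike.star_def, Complex.conj_conj, mul_assoc]
  rw [Finset.sum_comm]
  refine Finset.sum_congr rfl fun μ _ => Finset.sum_congr rfl fun ν _ => ?_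
  ring

/-- Every positive functional on the Toeplitz-Cuntz algebra comes from a decreasing locally normal
positive functional on `𝔅`. -/
theorem exists_decreasingLocallyNormal (ρ : TO ι →ₚ[ℂ] ℂ) :
    ∃ ω : boundedSupport ι →ₗ[ℂ] ℂ, IsDecreasingLocallyNormal ω ∧
      ∀ μ ν, ρ (TO.word μ * star (TO.word ν)) = ω (matUnitB μ ν) := by
  classical
  choose φ hφ h using exists_normal_level ρ
  obtain ⟨ω, hω⟩ := exists_glue φ fun k B hB => (hφ (k + 1)).eq_of_matUnit_eq (hφ k)
    (fun μ ν hμ hν => by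
      rw [h k μ ν hμ hν, h (k + 1) μ ν (by omega) (by omega)]) hB
  have hLN : IsLocallyNormal ω := fun k => ⟨φ k, hφ k, hω k⟩
  have hmat : ∀ μ ν, ρ (TO.word μ * star (TO.word ν)) = ω (matUnitB μ ν) := fun μ ν => by
    have h1 := le_max_left μ.length ν.length
    have h2 := le_max_right μ.length ν.length
    rw [hω _ _ (matUnit_mem_level h1 h2)]
    exact (h _ μ ν h1 h2).symm
  refine ⟨ω, ⟨?_, ?_, hLN⟩, hmat⟩
  · refine hLN.isApproximable.isPositive fun s c => ?_
    have h1 := sum_conj_mul_word ρ s c 1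
    simp only [mul_one, hmat] at h1
    rw [h1]
    exact map_nonneg ρ (mul_star_self_nonneg _)
  · refine hLN.isApproximable_comp_deltaB.isPositive fun s c => ?_
    set a : TO ι := ∑ μ ∈ s, starRingEnd ℂ (c μ) • TO.word μ with ha
    have h1 := sum_conj_mul_word ρ s c 1
    simp only [mul_one, hmat] at h1
    rw [← ha] at h1
    -- In terms of ρ, the quadratic form of ω ∘ β is ∑_i ρ(a v_i v_i^* a^*). Its partial sums are at
    -- most ρ(a a^*), which is the form of ω.
    have h2 : HasSum (fun i => ρ (a * (TO.v i * star (TO.v i)) * star a))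
        (∑ μ ∈ s, ∑ ν ∈ s, starRingEnd ℂ (c μ) * c ν * ω (betaB (matUnitB μ ν))) := by
      refine (hasSum_sum (s := s) fun μ _ => hasSum_sum (s := s) fun ν _ =>
        (hLN.hasSum_betaB_matUnitB μ ν).mul_left (starRingEnd ℂ (c μ) * c ν)).of_eq fun i => ?_
      rw [ha, ← sum_conj_mul_word]
      refine Finset.sum_congr rfl fun μ _ => Finset.sum_congr rfl fun ν _ => ?_
      rw [← hmat, TO.word_append_singleton, TO.word_append_singleton, star_mul]
      simp only [mul_assoc]
    simp only [LinearMap.comp_apply, deltaB_apply, map_sub, mul_sub, Finset.sum_sub_distrib]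
    rw [h1, sub_nonneg]
    refine le_of_tendsto h2 (Eventually.of_forall fun t => ?_)
    rw [← map_sum, ← Finset.sum_mul, ← Finset.mul_sum]
    refine OrderHomClass.mono ρ ?_
    have h3 := star_right_conjugate_le_conjugate (sum_mul_star_le_one TO.star_v_mul_v_eq t) a
    rwa [mul_one] at h3

/-! ### Density matrices -/

lemma E_apply_coord (k : ℕ) (x : Fock ι) (μ : List ι) :
    (E k : BFock ι) x μ = if μ.length = k then x μ else 0 := by
  rw [← inner_basisVec_left, ← star_E, ContinuousLinearMap.star_eq_adjoint,
    ContinuousLinearMap.adjoint_inner_right, E_basisVec]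
  split_ifs
  · rw [inner_basisVec_left]
  · rw [inner_zero_left]

/-- The indices are transposed because tr(T e_{μν}) is the entry of T from μ to ν. -/
lemma IsDensityMatrix.apply_coord {ω : boundedSupport ι →ₗ[ℂ] ℂ} {Ω : ℕ → ℕ → BFock ι}
    (h : IsDensityMatrix ω Ω) (i j : ℕ) (μ ν : List ι) :
    Ω i j (basisVec μ) ν = if ν.length = i ∧ μ.length = j then ω (matUnitB μ ν) else 0 := by
  obtain ⟨T, hT⟩ := h
  obtain ⟨-, -, h3, h4⟩ := hT (max i j)
  rw [h4 i (le_max_left _ _) j (le_max_right _ _), mul_assoc, mul_apply_eq_comp, E_apply_coord,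
    mul_apply_eq_comp, E_basisVec]
  by_cases hν : ν.length = i
  · by_cases hμ : μ.length = j
    · rw [if_pos hν, if_pos hμ, if_pos ⟨hν, hμ⟩, h3 (matUnitB μ ν) (matUnit_mem_level
        (hμ.trans_le (le_max_right _ _)) (hν.trans_le (le_max_left _ _)))]
      exact (trace_mul_matUnit _ _ _).symm
    · rw [if_pos hν, if_neg hμ, if_neg (fun h => hμ h.2), map_zero]; rfl
  · rw [if_neg hν, if_neg (fun h => hν h.1)]

lemma IsDensityMatrix.isTraceClass {ω : boundedSupport ι →ₗ[ℂ] ℂ} {Ω : ℕ → ℕ → BFock ι}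
    (h : IsDensityMatrix ω Ω) (i j : ℕ) : IsTraceClass (Ω i j) := by
  obtain ⟨T, hT⟩ := h
  obtain ⟨h1, -, -, h4⟩ := hT (max i j)
  rw [h4 i (le_max_left _ _) j (le_max_right _ _)]
  exact h1.mul_mul _ _

lemma ext_coord {S T : BFock ι} (h : ∀ μ ν, S (basisVec μ) ν = T (basisVec μ) ν) : S = T :=
  clm_ext fun μ => lp.ext (funext fun ν => h μ ν)

theorem existsUnique_isDensityMatrix {ω : boundedSupport ι →ₗ[ℂ] ℂ} (hω : IsLocallyNormal ω) :
    ∃! Ω, IsDensityMatrix ω Ω := by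
  have hex : ∀ k, ∃ T : BFock ι, IsTraceClass T ∧ T ∈ boundedSupportLevel ι k ∧
      ∀ B : boundedSupport ι, (B : BFock ι) ∈ boundedSupportLevel ι k →
        ω B = trace (T * (B : BFock ι)) := fun k => by
    obtain ⟨φ, hφ, h⟩ := hω k
    obtain ⟨T, hT, hTr⟩ := hφ.exists_traceClass
    -- Cutting down to the corner puts T in 𝔅_k without changing traces against elements of 𝔅_k.
    refine ⟨compress k T, hT.mul_mul _ _, compress_mem_level k T, fun B hB => ?_⟩
    rw [trace_compress_mul T hB, hTr, h B hB]
  choose T hT1 hT2 hT3 using hex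
  have hcoord : ∀ k {μ ν : List ι}, μ.length ≤ k → ν.length ≤ k →
      T k (basisVec μ) ν = ω (matUnitB μ ν) := fun k μ ν hμ hν => by
    rw [← trace_mul_matUnit, hT3 k (matUnitB μ ν) (matUnit_mem_level hμ hν)]; rfl
  refine ⟨fun i j => E i * T (max i j) * E j, ⟨T, fun k => ⟨hT1 k, hT2 k, hT3 k,
    fun i hi j hj => ext_coord fun μ ν => ?_⟩⟩, fun Ω hΩ => funext fun i => funext fun j => ?_⟩
  · simp only [mul_apply_eq_comp, E_apply_coord, E_basisVec]
    by_cases hν : ν.length = i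
    · by_cases hμ : μ.length = j
      · rw [if_pos hν, if_pos hμ, if_pos hν, hcoord _ (hμ.trans_le (le_max_right _ _))
          (hν.trans_le (le_max_left _ _)), hcoord _ (hμ.trans_le hj) (hν.trans_le hi)]
      · rw [if_neg hμ, map_zero, map_zero]
    · rw [if_neg hν, if_neg hν]
  · obtain ⟨T', hT'⟩ := id hΩ
    refine ext_coord fun μ ν => ?_
    rw [hΩ.apply_coord, mul_apply_eq_comp, mul_apply_eq_comp, E_apply_coord, E_basisVec]
    by_cases hν : ν.length = i
    · by_cases hμ : μ.length = j
      · rw [if_pos ⟨hν, hμ⟩, if_pos hν, if_pos hμ, hcoord _ (hμ.trans_le (le_max_right _ _))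
          (hν.trans_le (le_max_left _ _))]
      · rw [if_neg (fun h => hμ h.2), if_neg hμ, map_zero, if_pos hν]; rfl
    · rw [if_neg (fun h => hν h.1), if_neg hν]

/-- Slicing sums the entries of Ω over a common appended letter, and ω(β(e_{μν})) is the same sum.
-/
lemma sliceMatrix_eq_iff {ω : boundedSupport ι →ₗ[ℂ] ℂ} (hω : IsLocallyNormal ω)
    {Ω : ℕ → ℕ → BFock ι} (h : IsDensityMatrix ω Ω) :
    sliceMatrix Ω = Ω ↔ ∀ μ ν, ω (betaB (matUnitB μ ν)) = ω (matUnitB μ ν) := by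
  have key : ∀ i j (μ ν : List ι), sliceMatrix Ω i j (basisVec μ) ν
      = if ν.length = i ∧ μ.length = j then ω (betaB (matUnitB μ ν)) else 0 := by
    intro i j μ ν
    have h1 := (h.isTraceClass (i + 1) (j + 1)).hasSum_slice_apply μ ν
    simp only [h.apply_coord, List.length_append, List.length_singleton, add_left_inj] at h1
    refine h1.unique ?_
    split_ifs with hc
    · exact hω.hasSum_betaB_matUnitB μ ν
    · exact hasSum_zero
  refine ⟨fun hs μ ν => ?_, fun hb => funext fun i => funext fun j => ext_coord fun μ ν => ?_⟩
  · have h1 := key ν.length μ.length μ ν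
    rw [hs, h.apply_coord, if_pos ⟨rfl, rfl⟩, if_pos ⟨rfl, rfl⟩] at h1
    exact h1.symm
  · rw [key, h.apply_coord, hb]

lemma IsLocallyNormal.hasSum_EB {ω : boundedSupport ι →ₗ[ℂ] ℂ} (hω : IsLocallyNormal ω) (k : ℕ) :
    HasSum (fun μ : {μ : List ι // μ.length = k} => ω (matUnitB μ.1 μ.1)) (ω (EB k)) := by
  obtain ⟨φ, hφ, h⟩ := hω k
  have hE : (E k : BFock ι) ∈ boundedSupportLevel ι k := by
    refine mem_level_iff.2 ⟨P_mul_E k, ?_⟩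
    have := congrArg star (P_mul_E (ι := ι) k)
    rwa [star_mul, star_E, star_P] at this
  have hm : ∀ μ : List ι, E k * matUnit μ μ = if μ.length = k then matUnit μ μ else 0 :=
    fun μ => by
      rw [mul_matUnit, E_basisVec]
      split_ifs
      · rfl
      · rw [map_zero]; rfl
  rw [h (EB k) hE]
  have h1 := hφ.hasSum_mul_matUnit (E k)
  simp only [hm] at h1
  refine (((Subtype.val_injective (p := fun μ : List ι => μ.length = k)).hasSum_iff
    fun μ hμ => ?_).2 h1).of_eq fun μ => ?_
  · rw [if_neg fun h => hμ ⟨⟨μ, h⟩, rfl⟩, map_zero]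
  · rw [Function.comp_apply, if_pos μ.2]
    exact h _ (matUnit_mem_level μ.2.le μ.2.le)

/-! ### Strong sums of range projections -/

/-- The ranges are orthogonal, so the finite sums are projections and converge strongly. The last
identity, Pythagoras for the limit, serves to deduce Qη = η from equality of norms. -/
lemma exists_strong_sum_range {K κ : Type*} [NormedAddCommGroup K] [InnerProductSpace ℂ K]
    [CompleteSpace K] [DecidableEq κ] {V : κ → K →L[ℂ] K}
    (h : ∀ i j, star (V i) * V j = if i = j then 1 else 0) :
    ∃ Q : K →L[ℂ] K, ∀ η, HasSum (fun i => (V i * star (V i)) η) (Q η) ∧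
      HasSum (fun i => ‖star (V i) η‖ ^ 2) (‖Q η‖ ^ 2) ∧ ‖Q η‖ ≤ ‖η‖ ∧
      ‖Q η - η‖ ^ 2 = ‖η‖ ^ 2 - ‖Q η‖ ^ 2 := by
  classical
  have hsp := isStarProjection_sum_mul_star h
  have hadj : ∀ (T : K →L[ℂ] K) (x y : K), ⟪T x, y⟫_ℂ = ⟪x, star T y⟫_ℂ := fun T x y => by
    rw [ContinuousLinearMap.star_eq_adjoint, ContinuousLinearMap.adjoint_inner_right]
  have hisom : ∀ i j x y, ⟪V i x, V j y⟫_ℂ = if i = j then ⟪x, y⟫_ℂ else 0 := fun i j x y => by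
    rw [hadj, ← mul_apply_eq_comp, h]
    split_ifs
    · rfl
    · exact inner_zero_right x
  have hnorm : ∀ i x, ‖V i x‖ = ‖x‖ := fun i x => by
    have h1 := hisom i i x x
    rw [if_pos rfl, inner_self_eq_norm_sq_to_K, inner_self_eq_norm_sq_to_K] at h1
    have h2 : ‖V i x‖ ^ 2 = ‖x‖ ^ 2 := by exact_mod_cast h1
    exact (pow_left_inj₀ (norm_nonneg _) (norm_nonneg _) two_ne_zero).1 h2
  let W : κ → K →ₗᵢ[ℂ] K := fun i => ⟨(V i).toLinearMap, hnorm i⟩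
  have hW : OrthogonalFamily ℂ (fun _ : κ => K) W := fun i j hij x y =>
    (hisom i j x y).trans (if_neg hij)
  have hsum : ∀ (η : K) (s : Finset κ), ‖∑ i ∈ s, (V i * star (V i)) η‖ ^ 2
      = ∑ i ∈ s, ‖star (V i) η‖ ^ 2 := fun η s =>
    hW.norm_sum (fun i => star (V i) η) s
  have hle : ∀ (η : K) (s : Finset κ), ‖∑ i ∈ s, (V i * star (V i)) η‖ ≤ ‖η‖ := fun η s => by
    rw [← sum_apply]
    simpa using (∑ i ∈ s, V i * star (V i)).le_of_opNorm_le (hsp s).norm_le η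
  have hle2 : ∀ (η : K) (s : Finset κ), ∑ i ∈ s, ‖star (V i) η‖ ^ 2 ≤ ‖η‖ ^ 2 := fun η s => by
    rw [← hsum]
    exact pow_le_pow_left₀ (norm_nonneg _) (hle η s) 2
  have hS : ∀ η, Summable fun i => (V i * star (V i)) η := fun η =>
    (hW.summable_iff_norm_sq_summable fun i => star (V i) η).2
      (summable_of_sum_le (fun _ => sq_nonneg _) (hle2 η))
  have hQle : ∀ η, ‖∑' i, (V i * star (V i)) η‖ ≤ ‖η‖ := fun η =>
    le_of_tendsto (hS η).hasSum.norm (Eventually.of_forall (hle η))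
  let Q : K →L[ℂ] K := LinearMap.mkContinuous
    { toFun := fun η => ∑' i, (V i * star (V i)) η
      map_add' := fun x y => by
        simp only [map_add]
        exact (hS x).tsum_add (hS y)
      map_smul' := fun c x => by
        simp only [map_smul, RingHom.id_apply]
        exact (hS x).tsum_const_smul c } 1 fun η => by rw [one_mul]; exact hQle η
  have hQ : ∀ η, HasSum (fun i => (V i * star (V i)) η) (Q η) := fun η => (hS η).hasSum
  refine ⟨Q, fun η => ?_⟩
  have h2 : HasSum (fun i => ‖star (V i) η‖ ^ 2) (‖Q η‖ ^ 2) := by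
    have := (hQ η).norm.pow 2
    simp only [hsum] at this
    exact this
  have h3 : ⟪η, Q η⟫_ℂ = (‖Q η‖ ^ 2 : ℝ) := by
    refine HasSum.unique (((hQ η).mapL (innerSL ℂ η)).of_eq fun i => ?_) (h2.mapL Complex.ofRealCLM)
    rw [innerSL_apply_apply, mul_apply_eq_comp, ← star_star (V i), ← hadj, star_star,
      inner_self_eq_norm_sq_to_K, Complex.ofRealCLM_apply, Complex.ofReal_pow]
    rfl
  refine ⟨hQ η, h2, hQle η, ?_⟩
  rw [norm_sub_sq (𝕜 := ℂ), ← inner_conj_symm, h3]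
  simp only [Complex.conj_ofReal, RCLike.re_to_complex, Complex.ofReal_re]
  ring

lemma tendsto_zero_of_dense {K : Type*} [NormedAddCommGroup K] [NormedSpace ℂ K]
    {S : ℕ → K →L[ℂ] K} (hS : ∀ k η, ‖S k η‖ ≤ ‖η‖) {D : Set K} (hD : Dense D)
    (h : ∀ η ∈ D, Tendsto (fun k => S k η) atTop (𝓝 0)) (η : K) :
    Tendsto (fun k => S k η) atTop (𝓝 0) := by
  rw [Metric.tendsto_atTop]
  intro ε hε
  obtain ⟨ξ, hξ, hd⟩ := Metric.dense_iff.1 hD η (ε / 2) (by positivity)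
  obtain ⟨N, hN⟩ := Metric.tendsto_atTop.1 (h _ hd) (ε / 2) (by positivity)
  refine ⟨N, fun k hk => ?_⟩
  have h1 := hN k hk
  rw [dist_zero_right] at h1 ⊢
  have h2 := hS k (η - ξ)
  have h3 : ‖η - ξ‖ < ε / 2 := by rwa [← dist_eq_norm, dist_comm]
  calc ‖S k η‖ = ‖S k (η - ξ) + S k ξ‖ := by rw [← map_add, sub_add_cancel]
    _ ≤ ‖S k (η - ξ)‖ + ‖S k ξ‖ := norm_add_le _ _
    _ < ε := by linarith

/-! ### Compact operators -/

lemma isCompactOperator_matUnit (μ ν : List ι) : IsCompactOperator (matUnit μ ν) := by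
  have h : IsCompactOperator (innerSL ℂ (basisVec ν) : Fock ι → ℂ) :=
    isCompactOperator_of_locallyCompactSpace_dom (innerSL ℂ (basisVec ν))
  exact h.clm_comp (ContinuousLinearMap.toSpanSingleton ℂ (basisVec μ))

lemma isCompactOperator_wordProj (s : Finset (List ι)) : IsCompactOperator (wordProj s) := by
  classical
  induction s using Finset.induction_on with
  | empty =>
    rw [wordProj, Finset.sum_empty]
    exact isCompactOperator_zero
  | insert μ s hμ ih =>
    rw [wordProj, Finset.sum_insert hμ]
    exact (isCompactOperator_matUnit μ μ).add ih

/-- Strong convergence of P_m is uniform on a finite ε/4-net of the relatively compact image of the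
unit ball. -/
lemma tendsto_P_mul {K : BFock ι} (hK : IsCompactOperator K) :
    Tendsto (fun m => P m * K) atTop (𝓝 K) := by
  rw [Metric.tendsto_atTop]
  intro ε hε
  have hc := hK.isCompact_closure_image_closedBall (f := (K : Fock ι →ₗ[ℂ] Fock ι)) 1
  obtain ⟨t, -, ht, hcov⟩ := hc.finite_cover_balls (e := ε / 4) (by positivity)
  have hev : ∀ᶠ m in atTop, ∀ x ∈ t, ‖P m x - x‖ < ε / 4 := by
    refine (eventually_all_finite ht).2 fun x _ => ?_
    have := (tendsto_iff_norm_sub_tendsto_zero.1 (tendsto_P x)).eventually_lt_const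
      (show (0 : ℝ) < ε / 4 by positivity)
    exact this
  obtain ⟨N, hN⟩ := eventually_atTop.1 hev
  refine ⟨N, fun m hm => ?_⟩
  have hb : ∀ z : Fock ι, ‖z‖ ≤ 1 → ‖(P m * K - K : BFock ι) z‖ ≤ 3 * (ε / 4) := fun z hz => by
    have hz' : K z ∈ closure ((K : Fock ι →ₗ[ℂ] Fock ι) '' Metric.closedBall 0 1) :=
      subset_closure ⟨z, by simpa using hz, rfl⟩
    obtain ⟨x, hx, hd⟩ := Set.mem_iUnion₂.1 (hcov hz')
    have h1 := hN m hm x hx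
    have h2 : ‖K z - x‖ < ε / 4 := by rwa [← dist_eq_norm]
    have h3 : ‖P m (K z - x)‖ ≤ ‖K z - x‖ := by
      simpa using (P m).le_of_opNorm_le (norm_P_le m) (K z - x)
    have h4 : (P m * K - K : BFock ι) z = P m (K z - x) + (P m x - x) - (K z - x) := by
      rw [sub_apply, mul_apply_eq_comp, map_sub]; abel
    rw [h4]
    have h5 := norm_sub_le (P m (K z - x) + (P m x - x)) (K z - x)
    have h6 := norm_add_le (P m (K z - x)) (P m x - x)
    linarith
  have hop : ‖P m * K - K‖ ≤ 3 * (ε / 4) := by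
    refine ContinuousLinearMap.opNorm_le_bound _ (by positivity) fun z => ?_
    by_cases hz : z = 0
    · simp [hz]
    · have hz0 : ‖z‖ ≠ 0 := norm_ne_zero_iff.2 hz
      have h1 := hb ((‖z‖⁻¹ : ℂ) • z) (by
        rw [norm_smul, norm_inv, Complex.norm_real, norm_norm, inv_mul_cancel₀ hz0])
      rw [map_smul, norm_smul, norm_inv, Complex.norm_real, norm_norm,
        inv_mul_le_iff₀ (by positivity)] at h1
      linarith
  rw [dist_eq_norm]
  linarith

/-! ### Values of `Δω` -/

/-- The inclusion of `𝔅` in the closure of `λ(𝔅)`. -/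
def ofB (B : boundedSupport ι) : ClosureLambda ι := ofLambda B (mem_lambdaRange_of_mem B.2)

lemma incl_ofB (B : boundedSupport ι) : (ofB B).incl = (B : BFock ι) := rfl

lemma ofB_mul (A B : boundedSupport ι) : ofB A * ofB B = ofB (A * B) :=
  Generated.incl_injective (map_mul _ _ _)

lemma star_ofB (B : boundedSupport ι) : star (ofB B) = ofB (star B) :=
  Generated.incl_injective (map_star _ _)

lemma ofB_sub (A B : boundedSupport ι) : ofB (A - B) = ofB A - ofB B :=
  Generated.incl_injective (by
    rw [map_sub, incl_ofB, incl_ofB, incl_ofB, AddSubgroupClass.coe_sub])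

/-- `P_k` as an element of `𝔅`. -/
def PB (k : ℕ) : boundedSupport ι := ⟨P k, mem_boundedSupport_iff.2 ⟨k, P_mem_level k⟩⟩

lemma isStarProjection_of_incl {p : ClosureLambda ι} (h : IsStarProjection p.incl) :
    IsStarProjection p := by
  refine ⟨Generated.incl_injective ?_, Generated.incl_injective ?_⟩
  · rw [map_mul]; exact h.isIdempotentElem
  · rw [map_star]; exact h.isSelfAdjoint

lemma isStarProjection_P (k : ℕ) : IsStarProjection (P k : BFock ι) :=
  ⟨by rw [IsIdempotentElem, P_mul_P, min_self], star_P k⟩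

lemma isStarProjection_ofB_PB (k : ℕ) : IsStarProjection (ofB (PB k : boundedSupport ι)) :=
  isStarProjection_of_incl (isStarProjection_P k)

lemma betaB_EB (k : ℕ) : betaB (EB k : boundedSupport ι) = EB (k + 1) := Subtype.ext (beta_E k)

lemma deltaB_PB (k : ℕ) : deltaB (PB k : boundedSupport ι) = EB 0 - EB (k + 1) :=
  Subtype.ext (by
    change P k - beta (P k) = E 0 - E (k + 1)
    rw [beta_P, P_succ, P_zero]; abel)

namespace IsDecreasingLocallyNormal

variable {ω : boundedSupport ι →ₗ[ℂ] ℂ}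

lemma Delta_ofB (hω : IsDecreasingLocallyNormal ω) (B : boundedSupport ι) :
    Delta ω (ofB B) = ω (deltaB B) :=
  hω.isDelta _ (mem_lambdaRange_of_mem B.2) _ rfl

lemma Delta_one (hω : IsDecreasingLocallyNormal ω) : Delta ω 1 = ω (EB 0) :=
  hω.isDelta 1 (mem_lambdaRange_iff.2 (E_mem 0)) (EB 0) rfl

/-- The link between Δω and the numbers ω(E_k): δ(1) = E_0 and δ(P_k) = E_0 - E_{k+1}. -/
lemma Delta_one_sub_PB (hω : IsDecreasingLocallyNormal ω) (k : ℕ) :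
    Delta ω (1 - ofB (PB k)) = ω (EB (k + 1)) := by
  rw [map_sub, hω.Delta_one, hω.Delta_ofB, deltaB_PB, map_sub, sub_sub_cancel]

lemma comp_betaB_eq_iff (hω : IsDecreasingLocallyNormal ω) : ω ∘ₗ betaB = ω ↔
    ∀ μ ν, ω (betaB (matUnitB μ ν)) = ω (matUnitB μ ν) :=
  ⟨fun h μ ν => LinearMap.congr_fun h (matUnitB μ ν),
    fun h => hω.comp_betaB.2.2.isApproximable.ext hω.2.2.isApproximable h⟩

lemma comp_deltaB_eq_zero_iff (hω : IsDecreasingLocallyNormal ω) : (∀ B, ω (deltaB B) = 0) ↔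
    ∀ μ ν, ω (betaB (matUnitB μ ν)) = ω (matUnitB μ ν) := by
  rw [← hω.comp_betaB_eq_iff, LinearMap.ext_iff]
  refine forall_congr' fun B => ?_
  rw [deltaB_apply, map_sub, sub_eq_zero, eq_comm]; rfl

/-- If ω(E_k) is constant then Δω(P_k) = 0. Every B in 𝔅_k equals P_k B, so Cauchy-Schwarz gives
ω(δ(B)) = Δω(B) = 0. Conversely apply the vanishing to B = E_k. -/
lemma EB_const_iff (hω : IsDecreasingLocallyNormal ω) :
    (∀ k, ω (EB k) = ω (EB 0)) ↔ ∀ B, ω (deltaB B) = 0 := by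
  refine ⟨fun h B => ?_, fun h k => ?_⟩
  · obtain ⟨k, hk⟩ := mem_boundedSupport_iff.1 B.2
    have h1 : Delta ω (ofB (PB k)) = 0 := by
      rw [hω.Delta_ofB, deltaB_PB, map_sub, h (k + 1), sub_self]
    have h2 := norm_apply_sq_le (Delta ω) (ofB (PB k)) (ofB B)
    have h3 : ofB (PB k) * ofB B = ofB B :=
      Generated.incl_injective ((map_mul _ _ _).trans (mem_level_iff.1 hk).1)
    rw [(isStarProjection_ofB_PB k).isSelfAdjoint.star_eq,
      (isStarProjection_ofB_PB k).isIdempotentElem.eq, h1, norm_zero, zero_mul, h3,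
      hω.Delta_ofB] at h2
    exact norm_eq_zero.1 (pow_eq_zero_iff two_ne_zero |>.1 (le_antisymm h2 (sq_nonneg _)))
  · induction k with
    | zero => rfl
    | succ k ih =>
      have := h (EB k)
      rw [deltaB_apply, map_sub, betaB_EB, sub_eq_zero] at this
      rw [← this, ih]

/-- Matrix units are compact, which gives one direction. For the other, a compact A is the norm
limit of P_m A, and Δω kills P_m A by Cauchy-Schwarz because Δω(P_m) = 0. -/
lemma isKSingular_iff (hω : IsDecreasingLocallyNormal ω) :
    IsKSingular (Delta ω) ↔ ∀ B, ω (deltaB B) = 0 := by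
  refine ⟨fun h => hω.comp_deltaB_eq_zero_iff.2 fun μ ν => ?_, fun h A hA => ?_⟩
  · have := h (ofB (matUnitB μ ν)) (isCompactOperator_matUnit μ ν)
    rw [hω.Delta_ofB, deltaB_apply, map_sub, sub_eq_zero] at this
    exact this.symm
  · have h1 : Tendsto (fun m => ofB (PB m) * A) atTop (𝓝 A) :=
      (Topology.IsInducing.subtypeVal.tendsto_nhds_iff).2 (tendsto_P_mul hA)
    have h2 : ∀ m, Delta ω (ofB (PB m) * A) = 0 := fun m => by
      have h3 := norm_apply_sq_le (Delta ω) (ofB (PB m)) A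
      rw [(isStarProjection_ofB_PB m).isSelfAdjoint.star_eq,
        (isStarProjection_ofB_PB m).isIdempotentElem.eq, hω.Delta_ofB, h, norm_zero,
        zero_mul] at h3
      exact norm_eq_zero.1 (pow_eq_zero_iff two_ne_zero |>.1 (le_antisymm h3 (sq_nonneg _)))
    have h3 := ((PositiveLinearMap.continuous_complex (Delta ω)).tendsto A).comp h1
    simp only [Function.comp_def, h2] at h3
    exact tendsto_nhds_unique h3 tendsto_const_nhds

end IsDecreasingLocallyNormal

/-! ### Essential functionals -/

lemma gns_star_mul {A κ : Type*} [CStarAlgebra A] [PartialOrder A] [StarOrderedRing A]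
    (f : A →ₚ[ℂ] ℂ) {w : κ → A} [DecidableEq κ]
    (h : ∀ i j, star (w i) * w j = if i = j then 1 else 0) (i j : κ) :
    star (f.gnsStarAlgHom (w i)) * f.gnsStarAlgHom (w j) = if i = j then 1 else 0 := by
  rw [← map_star, ← map_mul, h]
  split_ifs
  · exact map_one _
  · exact map_zero _

lemma gns_hasSum_inner {A κ : Type*} [CStarAlgebra A] [PartialOrder A] [StarOrderedRing A]
    (f : A →ₚ[ℂ] ℂ) {w : κ → A} {b : A} {q : f.GNS}
    (h : HasSum (fun i => f.gnsStarAlgHom (w i * star (w i)) (gnsVec f b)) q) (a : A) :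
    HasSum (fun i => f (star a * (w i * star (w i)) * b)) ⟪gnsVec f a, q⟫_ℂ := by
  refine (h.mapL (innerSL ℂ (gnsVec f a))).of_eq fun i => ?_
  rw [innerSL_apply_apply, gnsStarAlgHom_gnsVec, inner_gnsVec, mul_assoc]

/-- Let Q be the strong sum of the π(v_i v_i^*). Its entries between the vectors π(v_μ)^* ξ are
ω(β(e_{μν})), while their Gram matrix is ω(e_{μν}). If the two agree, Q preserves the norms of these
vectors and hence fixes them. -/
theorem isEssential_iff {ω : boundedSupport ι →ₗ[ℂ] ℂ} (hω : IsLocallyNormal ω)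
    {ρ : TO ι →ₚ[ℂ] ℂ} (hρ : ∀ μ ν, ρ (TO.word μ * star (TO.word ν)) = ω (matUnitB μ ν)) :
    IsEssential ρ ↔ ∀ μ ν, ω (betaB (matUnitB μ ν)) = ω (matUnitB μ ν) := by
  classical
  have hsum : ∀ μ ν q, HasSum (fun i => ρ.gnsStarAlgHom (TO.v i * star (TO.v i))
      (wordVec ρ ν)) q → ⟪wordVec ρ μ, q⟫_ℂ = ω (betaB (matUnitB μ ν)) := fun μ ν q hq => by
    refine (gns_hasSum_inner ρ hq (star (TO.word μ))).unique
      ((hω.hasSum_betaB_matUnitB μ ν).of_eq fun i => ?_)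
    rw [← hρ, TO.word_append_singleton, TO.word_append_singleton, star_mul, star_star]
    simp only [mul_assoc]
  refine ⟨fun h μ ν => ?_, fun h => ?_⟩
  · rw [← hsum μ ν _ (h (wordVec ρ ν)), inner_wordVec, hρ]
  · obtain ⟨Q, hQ⟩ := exists_strong_sum_range (gns_star_mul ρ TO.star_v_mul_v_eq)
    have hQ1 : ∀ η, HasSum (fun i => ρ.gnsStarAlgHom (TO.v i * star (TO.v i)) η) (Q η) :=
      fun η => by simpa only [map_mul, map_star] using (hQ η).1
    have hvec : ∀ ν, Q (wordVec ρ ν) = wordVec ρ ν := fun ν => by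
      have h1 := hsum ν ν _ (hQ1 (wordVec ρ ν))
      rw [h, ← hρ, ← inner_wordVec] at h1
      have h2 := (hQ (wordVec ρ ν)).2.2
      have h3 : ‖wordVec ρ ν‖ ≤ ‖Q (wordVec ρ ν)‖ := by
        by_cases h0 : wordVec ρ ν = 0
        · rw [h0, norm_zero]; exact norm_nonneg _
        · have h4 := norm_inner_le_norm (𝕜 := ℂ) (wordVec ρ ν) (Q (wordVec ρ ν))
          rw [h1, inner_self_eq_norm_sq_to_K, norm_pow, RCLike.norm_ofReal, abs_norm, sq] at h4
          exact le_of_mul_le_mul_left h4 (norm_pos_iff.2 h0)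
      have h5 := h2.2
      rw [le_antisymm h2.1 h3, sub_self] at h5
      exact sub_eq_zero.1 (norm_eq_zero.1 (pow_eq_zero_iff two_ne_zero |>.1 h5))
    -- For nonempty μ the vector lies in the range of π(v_j), j the first letter, and Q fixes it
    -- without any hypothesis; only the empty word uses invariance.
    have hall : ∀ μ ν, Q (gnsVec ρ (TO.word μ * star (TO.word ν)))
        = gnsVec ρ (TO.word μ * star (TO.word ν)) := fun μ ν => by
      obtain _ | ⟨j, μ⟩ := μ
      · rw [TO.word_nil, one_mul]; exact hvec ν
      · refine (hQ1 _).unique ?_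
        have h1 := hasSum_single (f := fun i => ρ.gnsStarAlgHom (TO.v i * star (TO.v i))
          (gnsVec ρ (TO.word (j :: μ) * star (TO.word ν)))) j fun i hi => by
            rw [gnsStarAlgHom_gnsVec, TO.word_cons, mul_assoc (TO.v j), mul_assoc (TO.v i),
              ← mul_assoc (star (TO.v i)), TO.star_v_mul_v_of_ne hi, zero_mul, mul_zero, map_zero]
        simp only [gnsStarAlgHom_gnsVec] at h1 ⊢
        have h2 : TO.v j * star (TO.v j) * (TO.word (j :: μ) * star (TO.word ν))
            = TO.word (j :: μ) * star (TO.word ν) := by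
          rw [TO.word_cons, mul_assoc (TO.v j), mul_assoc (TO.v j), ← mul_assoc (star (TO.v j)),
            TO.star_v_mul_v, one_mul]
        rwa [h2] at h1
    have hone : ∀ a, Q (gnsVec ρ a) = gnsVec ρ a := by
      refine congrFun ((Q.continuous.comp (continuous_gnsVec ρ)).ext_on TO.dense_span
        (continuous_gnsVec ρ) fun x hx => ?_)
      refine LinearMap.eqOn_span (f := Q.toLinearMap ∘ₗ gnsVec ρ) (g := gnsVec ρ) ?_ hx
      rintro _ ⟨⟨μ, ν⟩, rfl⟩
      exact hall μ ν
    intro η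
    have : Q η = η := congrFun ((denseRange_gnsVec ρ).equalizer Q.continuous continuous_id
      (funext hone)) η
    have h2 := hQ1 η
    rwa [this] at h2

/-! ### Singular functionals -/

/-- Strong convergence of the `P_k` to the identity, in the GNS representation. -/
def TendstoProj (φ : ClosureLambda ι →ₚ[ℂ] ℂ) : Prop :=
  ∀ η : φ.GNS, Tendsto (fun k => φ.gnsStarAlgHom (1 - ofB (PB k)) η) atTop (𝓝 0)

lemma norm_gnsStarAlgHom_projection_le {A : Type*} [CStarAlgebra A] [PartialOrder A]
    [StarOrderedRing A] (f : A →ₚ[ℂ] ℂ) {p : A} (hp : IsStarProjection p) (η : f.GNS) :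
    ‖f.gnsStarAlgHom p η‖ ≤ ‖η‖ := by
  have h : IsStarProjection (f.gnsStarAlgHom p) := hp.map f.gnsStarAlgHom
  simpa using (f.gnsStarAlgHom p).le_of_opNorm_le h.norm_le η

lemma norm_gnsVec_projection_sq {A : Type*} [CStarAlgebra A] [PartialOrder A]
    [StarOrderedRing A] (f : A →ₚ[ℂ] ℂ) {p : A} (hp : IsStarProjection p) :
    (‖gnsVec f p‖ ^ 2 : ℂ) = f p := by
  rw [norm_gnsVec_sq, hp.isSelfAdjoint.star_eq, hp.isIdempotentElem.eq]

/-- For a projection p, the GNS vector of p has squared norm f(p); left multiplication by a is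
continuous. -/
lemma tendsto_gnsVec_mul {A α : Type*} [CStarAlgebra A] [PartialOrder A] [StarOrderedRing A]
    (f : A →ₚ[ℂ] ℂ) {l : Filter α} {p : α → A} (hp : ∀ x, IsStarProjection (p x))
    (h : Tendsto (fun x => f (p x)) l (𝓝 0)) (a : A) :
    Tendsto (fun x => gnsVec f (a * p x)) l (𝓝 0) := by
  have h1 : Tendsto (fun x => gnsVec f (p x)) l (𝓝 0) := by
    rw [tendsto_zero_iff_norm_tendsto_zero]
    have h2 : ∀ x, ‖gnsVec f (p x)‖ = √‖f (p x)‖ := fun x => by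
      rw [← norm_gnsVec_projection_sq f (hp x), norm_pow, Complex.norm_real, norm_norm,
        Real.sqrt_sq (norm_nonneg _)]
    simp only [h2]
    have h3 := (Real.continuous_sqrt.tendsto _).comp h.norm
    rwa [norm_zero, Real.sqrt_zero] at h3
  have h2 := ((f.gnsStarAlgHom a).continuous.tendsto 0).comp h1
  simpa only [Function.comp_def, gnsStarAlgHom_gnsVec, map_zero] using h2

lemma isStarProjection_PB_sub (k : ℕ) (s : Finset (List ι)) :
    IsStarProjection (ofB (PB k - finCompressB s (PB k))) := by
  refine isStarProjection_of_incl ?_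
  have hs := isStarProjection_wordProj s
  have h1 : wordProj s * P k * wordProj s = P k * wordProj s := by
    rw [← wordProj_mul_P_comm, mul_assoc, hs.isIdempotentElem.eq]
  have h2 : (ofB (PB k - finCompressB s (PB k))).incl = P k * (1 - wordProj s) := by
    rw [incl_ofB, AddSubgroupClass.coe_sub, coe_finCompressB]
    change P k - wordProj s * P k * wordProj s = _
    rw [h1, mul_sub, mul_one]
  rw [h2]
  refine (isStarProjection_P k).mul hs.one_sub ?_
  rw [commute_iff_eq, mul_sub, sub_mul, one_mul, mul_one, wordProj_mul_P_comm]

/-- Two approximations in the GNS space of Δω: a by a P_k, using Δω(1 - P_k) = ω(E_{k+1}) → 0, and a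
P_k by a times finite-rank compressions of P_k, using continuity of ω ∘ δ along such compressions.
-/
theorem isKEssential_of_tendsto {ω : boundedSupport ι →ₗ[ℂ] ℂ}
    (hω : IsDecreasingLocallyNormal ω) (h : Tendsto (fun k => ω (EB k)) atTop (𝓝 0)) :
    IsKEssential (Delta ω) := by
  set M := Submodule.span ℂ {η : (Delta ω).GNS | ∃ A : ClosureLambda ι,
    IsCompactOperator A.incl ∧ ∃ ξ, η = (Delta ω).gnsStarAlgHom A ξ} with hM
  have h1 : ∀ (a : ClosureLambda ι) (k : ℕ) (s : Finset (List ι)),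
      gnsVec (Delta ω) (a * ofB (finCompressB s (PB k))) ∈ M := fun a k s => by
    refine Submodule.subset_span ⟨a * ofB (finCompressB s (PB k)), ?_, gnsVec (Delta ω) 1, ?_⟩
    · rw [map_mul, incl_ofB, coe_finCompressB, mul_assoc (wordProj s)]
      exact ((isCompactOperator_wordProj s).comp_clm _).clm_comp a.incl
    · rw [gnsStarAlgHom_gnsVec, mul_one]
  have h2 : ∀ (a : ClosureLambda ι) (k : ℕ),
      gnsVec (Delta ω) (a * ofB (PB k)) ∈ closure (M : Set (Delta ω).GNS) := fun a k => by
    have hlim : Tendsto (fun s => Delta ω (ofB (PB k - finCompressB s (PB k)))) atTop (𝓝 0) := by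
      simp only [hω.Delta_ofB, map_sub]
      have := (hω.2.2.isApproximable_comp_deltaB.tendsto_finCompressB (PB k)).const_sub
        (ω (deltaB (PB k)))
      rw [LinearMap.comp_apply, sub_self] at this
      exact this
    have h3 := tendsto_gnsVec_mul (Delta ω) (isStarProjection_PB_sub k) hlim a
    simp only [ofB_sub, mul_sub, map_sub] at h3
    have h4 := (tendsto_const_nhds (x := gnsVec (Delta ω) (a * ofB (PB k)))).sub h3
    simp only [sub_sub_cancel, sub_zero] at h4
    exact mem_closure_of_tendsto h4 (Eventually.of_forall fun s => h1 a k s)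
  have h3 : ∀ a : ClosureLambda ι, gnsVec (Delta ω) a ∈ closure (M : Set (Delta ω).GNS) :=
    fun a => by
    have hlim : Tendsto (fun k => Delta ω (1 - ofB (PB k))) atTop (𝓝 0) := by
      simp only [hω.Delta_one_sub_PB]
      exact h.comp (tendsto_add_atTop_nat 1)
    have h4 := tendsto_gnsVec_mul (Delta ω) (fun k => (isStarProjection_ofB_PB k).one_sub) hlim a
    simp only [mul_sub, mul_one, map_sub] at h4
    have h5 := (tendsto_const_nhds (x := gnsVec (Delta ω) a)).sub h4
    simp only [sub_sub_cancel, sub_zero] at h5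
    have h6 := mem_closure_of_tendsto h5 (Eventually.of_forall fun k => h2 a k)
    rwa [closure_closure] at h6
  have h4 := (denseRange_gnsVec (Delta ω)).closure_range
  intro η
  have h5 : closure (Set.range (gnsVec (Delta ω))) ⊆ closure (M : Set (Delta ω).GNS) :=
    closure_minimal (by rintro _ ⟨a, rfl⟩; exact h3 a) isClosed_closure
  exact h5 (by rw [h4]; trivial)

open scoped CStarAlgebra in
-- On a vector π(A)ξ with A compact, (1 - P_k)A → 0 in norm. Such vectors span a dense subspace, and
-- the projections are uniformly bounded.
theorem IsKEssential.tendstoProj {φ : ClosureLambda ι →ₚ[ℂ] ℂ} (h : IsKEssential φ) :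
    TendstoProj φ := by
  have hle : ∀ k η, ‖φ.gnsStarAlgHom (1 - ofB (PB k)) η‖ ≤ ‖η‖ := fun k η =>
    norm_gnsStarAlgHom_projection_le φ (isStarProjection_ofB_PB k).one_sub η
  have hcont : Continuous φ.gnsStarAlgHom := map_continuous φ.gnsStarAlgHom
  intro η
  refine tendsto_zero_of_dense hle h (fun η hη => ?_) η
  refine Submodule.span_induction ?_ ?_ ?_ ?_ hη
  · rintro _ ⟨A, hA, ξ, rfl⟩
    have h1 : Tendsto (fun m => ofB (PB m) * A) atTop (𝓝 A) :=
      (Topology.IsInducing.subtypeVal.tendsto_nhds_iff).2 (tendsto_P_mul hA)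
    have hc : Continuous fun a => φ.gnsStarAlgHom a ξ := hcont.clm_apply continuous_const
    have h2 := (hc.tendsto _).comp ((tendsto_const_nhds (x := A)).sub h1)
    rw [sub_self, map_zero, zero_apply] at h2
    refine h2.congr fun k => ?_
    rw [Function.comp_apply, ← mul_apply_eq_comp, ← map_mul, sub_mul, one_mul]
  · simp only [map_zero]; exact tendsto_const_nhds
  · intro x y _ _ hx hy
    simpa only [map_add, add_zero] using hx.add hy
  · intro c x _ hx
    simpa only [map_smul, smul_zero] using hx.const_smul c

/-- A word of length k + 1 maps F into the range of 1 - P_k. Conjugating the bound by 1 with this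
projection leaves the sum unchanged. -/
lemma sum_word_le_one_sub_PB [DecidableEq (List ι)] (k : ℕ)
    (s : Finset {μ : List ι // μ.length = k + 1}) :
    ∑ μ ∈ s, fockRepClosure ι (TO.word μ.1 * star (TO.word μ.1)) ≤ 1 - ofB (PB k) := by
  set w : {μ : List ι // μ.length = k + 1} → ClosureLambda ι := fun μ =>
    fockRepClosure ι (TO.word μ.1) with hw
  have h : ∀ i j, star (w i) * w j = if i = j then 1 else 0 := fun i j => by
    simp only [hw]
    rw [← map_star, ← map_mul, TO.star_word_mul_word_subtype]
    split_ifs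
    · exact map_one _
    · exact map_zero _
  have hP : ∀ μ, (1 - ofB (PB k)) * w μ = w μ := fun μ => by
    have h1 : ofB (PB k) * w μ = 0 := by
      refine Generated.incl_injective ?_
      rw [map_mul, map_zero]
      refine clm_ext fun ν => ?_
      rw [mul_apply_eq_comp]
      change P k (leftWord μ.1 (basisVec ν)) = 0
      rw [leftWord_basisVec, P_basisVec, if_neg]
      rw [List.length_append, μ.2]; omega
    rw [sub_mul, one_mul, h1, sub_zero]
  have hsa : star (1 - ofB (PB k : boundedSupport ι)) = 1 - ofB (PB k) :=
    (isStarProjection_ofB_PB k).one_sub.isSelfAdjoint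
  have h1 := star_right_conjugate_le_conjugate (sum_mul_star_le_one h s)
    (1 - ofB (PB k : boundedSupport ι))
  rw [mul_one, hsa, (isStarProjection_ofB_PB k).one_sub.isIdempotentElem.eq, Finset.mul_sum,
    Finset.sum_mul] at h1
  convert h1 using 2 with μ
  rw [← mul_assoc, hP, mul_assoc]
  have h2 := congrArg star (hP μ)
  rw [star_mul, hsa] at h2
  rw [h2, map_mul, map_star]

theorem TendstoProj.isSingular {ω : boundedSupport ι →ₗ[ℂ] ℂ}
    (h : TendstoProj (Delta ω)) {ρ : TO ι →ₚ[ℂ] ℂ}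
    (hρ : ∀ x, ρ x = Delta ω (fockRepClosure ι x)) : IsSingular ρ := by
  classical
  have hQ := fun k => exists_strong_sum_range
    (gns_star_mul ρ (TO.star_word_mul_word_subtype (ι := ι) (k := k)))
  choose Q hQ using hQ
  refine fun ξ => ⟨fun k => Q k ξ, fun k => by simpa only [map_mul, map_star] using (hQ k ξ).1, ?_⟩
  refine tendsto_zero_of_dense (fun k η => (hQ k η).2.2.1) (denseRange_gnsVec ρ) ?_ ξ
  rintro _ ⟨a, rfl⟩
  -- The projections below 1 - P_k are those of word length k + 1, hence the shift.
  rw [← tendsto_add_atTop_iff_nat 1]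
  refine squeeze_zero_norm (fun k => ?_) (tendsto_zero_iff_norm_tendsto_zero.1
    (h (gnsVec (Delta ω) (fockRepClosure ι a))))
  refine le_of_sq_le_sq ?_ (norm_nonneg _)
  -- Finite partial sums of the squared norm are compared: they are values of Δω ∘ l = ρ, and the
  -- bound by 1 - P_k holds inside the domain of Δω.
  refine le_of_tendsto (hQ (k + 1) (gnsVec ρ a)).2.1 (Eventually.of_forall fun s => ?_)
  have h1 := star_left_conjugate_le_conjugate (sum_word_le_one_sub_PB k s) (fockRepClosure ι a)
  have h2 := OrderHomClass.mono (Delta ω) h1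
  have hp := (isStarProjection_ofB_PB (ι := ι) k).one_sub
  have h3 : Delta ω (star (fockRepClosure ι a) * (1 - ofB (PB k)) * fockRepClosure ι a)
      = ((‖(Delta ω).gnsStarAlgHom (1 - ofB (PB k))
        (gnsVec (Delta ω) (fockRepClosure ι a))‖ ^ 2 : ℝ) : ℂ) := by
    rw [Complex.ofReal_pow, gnsStarAlgHom_gnsVec, norm_gnsVec_sq, star_mul,
      hp.isSelfAdjoint.star_eq, mul_assoc, mul_assoc, ← mul_assoc (1 - ofB (PB k))
        (1 - ofB (PB k)), hp.isIdempotentElem.eq]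
  have h4 : Delta ω (star (fockRepClosure ι a) * (∑ μ ∈ s, fockRepClosure ι
      (TO.word μ.1 * star (TO.word μ.1))) * fockRepClosure ι a)
      = ((∑ μ ∈ s, ‖star (ρ.gnsStarAlgHom (TO.word μ.1)) (gnsVec ρ a)‖ ^ 2 : ℝ) : ℂ) := by
    rw [Finset.mul_sum, Finset.sum_mul, map_sum, Complex.ofReal_sum]
    refine Finset.sum_congr rfl fun μ _ => ?_
    rw [← map_star ρ.gnsStarAlgHom, gnsStarAlgHom_gnsVec, Complex.ofReal_pow, norm_gnsVec_sq,
      star_mul, star_star, ← map_star, ← map_mul, ← map_mul, ← hρ]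
    simp only [mul_assoc]
  rw [h3, h4] at h2
  exact_mod_cast h2

/-- Testing singularity on the cyclic vector suffices: ω(E_k) is the sum of ρ(v_μ v_μ^*) over |μ| =
k. -/
theorem IsSingular.tendsto {ω : boundedSupport ι →ₗ[ℂ] ℂ} (hω : IsLocallyNormal ω)
    {ρ : TO ι →ₚ[ℂ] ℂ} (hρ : ∀ μ ν, ρ (TO.word μ * star (TO.word ν)) = ω (matUnitB μ ν))
    (h : IsSingular ρ) : Tendsto (fun k => ω (EB k)) atTop (𝓝 0) := by
  obtain ⟨q, hq, hlim⟩ := h (gnsVec ρ 1)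
  have h1 : ∀ k, ω (EB k) = ⟪gnsVec ρ 1, q k⟫_ℂ := fun k => by
    refine (hω.hasSum_EB k).unique ((gns_hasSum_inner ρ (hq k) 1).of_eq fun μ => ?_)
    rw [star_one, one_mul, mul_one, hρ]
  simp only [h1]
  have := (tendsto_const_nhds (x := gnsVec ρ 1)).inner (𝕜 := ℂ) hlim
  rwa [inner_zero_right] at this

/-! ### Normality in the Fock representation -/

open scoped CStarAlgebra in
lemma continuous_fockRep : Continuous (fockRep ι) := map_continuous (fockRep ι)

lemma fockRep_word (μ ν : List ι) :
    fockRep ι (TO.word μ * star (TO.word ν)) = leftWord μ * star (leftWord ν) := by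
  rw [map_mul, map_star]; rfl

/-- In Fock space, the range projections of the left words of length k sum strongly to β^k(1), the
projection onto words of length at least k. Normality gives ω(E_k) = φ(β^k(1)), which tends to 0
because β^k(1) → 0 strongly. -/
theorem IsFockNormal.tendsto {ω : boundedSupport ι →ₗ[ℂ] ℂ} (hω : IsLocallyNormal ω)
    {ρ : TO ι →ₚ[ℂ] ℂ} (hρ : ∀ μ ν, ρ (TO.word μ * star (TO.word ν)) = ω (matUnitB μ ν))
    (h : IsFockNormal ρ) : Tendsto (fun k => ω (EB k)) atTop (𝓝 0) := by
  classical
  obtain ⟨φ, hφ, h⟩ := h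
  have h1 : ∀ k, ω (EB k) = φ (beta^[k] 1) := fun k => by
    have hV : ∀ i j : {μ : List ι // μ.length = k},
        star (leftWord i.1) * leftWord j.1 = if i = j then 1 else 0 := fun i j => by
      rw [leftWord, leftWord, ← map_star, ← map_mul, TO.star_word_mul_word_subtype]
      split_ifs
      · exact map_one _
      · exact map_zero _
    obtain ⟨Q, hQ⟩ := exists_strong_sum_range hV
    have hQeq : Q = beta^[k] 1 := by
      refine clm_ext fun ν => (hQ _).1.unique ?_
      rw [beta_iterate_one_basisVec]
      by_cases hk : k ≤ ν.length
      · rw [if_pos hk]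
        have h2 : (ν.take k).length = k := List.length_take_of_le hk
        have h3 := hasSum_single (f := fun μ : {μ : List ι // μ.length = k} =>
          (leftWord μ.1 * star (leftWord μ.1)) (basisVec ν)) ⟨ν.take k, h2⟩ fun μ hμ => by
            rw [mul_apply_eq_comp, star_leftWord_basisVec_of_not_prefix, map_zero]
            intro hp
            refine hμ (Subtype.ext ?_)
            exact (List.prefix_iff_eq_take.1 hp).trans (by rw [μ.2])
        have h4 : star (leftWord (ν.take k)) (basisVec ν) = basisVec (ν.drop k) := by
          have := star_leftWord_basisVec_append (ν.take k) (ν.drop k)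
          rwa [List.take_append_drop] at this
        rw [mul_apply_eq_comp, h4, leftWord_basisVec, List.take_append_drop] at h3
        exact h3
      · rw [if_neg hk]
        refine hasSum_zero.of_eq fun μ => ?_
        rw [mul_apply_eq_comp, star_leftWord_basisVec_of_not_prefix, map_zero]
        intro hp
        exact hk (μ.2 ▸ hp.length_le)
    refine (hω.hasSum_EB k).unique ?_
    have h5 : Tendsto (fun s : Finset {μ : List ι // μ.length = k} =>
        φ (∑ μ ∈ s, leftWord μ.1 * star (leftWord μ.1))) atTop (𝓝 (φ (beta^[k] 1))) := by
      refine hφ.tendsto (fun s => (isStarProjection_sum_mul_star hV s).norm_le)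
        (tendsto_inner_of_tendsto fun x => ?_)
      have h6 := (hQ x).1
      rw [hQeq] at h6
      simp only [sum_apply]
      exact h6
    simp only [map_sum] at h5
    refine HasSum.of_eq h5 fun μ => ?_
    rw [← hρ, h, fockRep_word]
  simp only [h1]
  have h2 := hφ.tendsto (l := atTop) (T := fun k : ℕ => beta^[k] 1) (T' := 0) (C := 1)
    (fun k => (norm_beta_iterate_le k 1).trans_eq CStarRing.norm_one)
    (tendsto_inner_of_tendsto fun x => by
      rw [zero_apply]; exact tendsto_beta_iterate_one x)
  rwa [map_zero] at h2

lemma IsDecreasingLocallyNormal.comp_betaB_pow {ω : boundedSupport ι →ₗ[ℂ] ℂ}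
    (hω : IsDecreasingLocallyNormal ω) (N : ℕ) :
    IsDecreasingLocallyNormal (ω ∘ₗ betaB ^ N) := by
  induction N with
  | zero => exact hω
  | succ N ih => exact ih.comp_betaB

lemma betaB_pow_EB (N k : ℕ) : (betaB ^ N) (EB k : boundedSupport ι) = EB (k + N) := by
  induction N with
  | zero => rfl
  | succ N ih =>
    rw [pow_succ', Module.End.mul_apply, ih, betaB_EB, add_assoc]

lemma coe_betaB_pow (N : ℕ) (B : boundedSupport ι) :
    ((betaB ^ N) B : BFock ι) = beta^[N] (B : BFock ι) := by
  induction N with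
  | zero => rfl
  | succ N ih =>
    rw [pow_succ', Module.End.mul_apply, Function.iterate_succ_apply', ← ih]; rfl

/-- The value at N is that of the positive functional Δ(ω ∘ β^N) at l(v_μ v_ν^*), hence bounded by a
constant times its value ω(E_N) at 1. -/
lemma IsDecreasingLocallyNormal.tendsto_betaB_pow {ω : boundedSupport ι →ₗ[ℂ] ℂ}
    (hω : IsDecreasingLocallyNormal ω) (h : Tendsto (fun k => ω (EB k)) atTop (𝓝 0))
    (μ ν : List ι) : Tendsto (fun N => ω ((betaB ^ N) (matUnitB μ ν))) atTop (𝓝 0) := by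
  set c := ‖fockRepClosure ι (TO.word μ * star (TO.word ν))‖
  have hb : ∀ N, ‖ω ((betaB ^ N) (matUnitB μ ν))‖ ≤ 4 * (‖ω (EB N)‖ * c) := fun N => by
    have h1 := PositiveLinearMap.norm_apply_le (Delta (ω ∘ₗ betaB ^ N))
      (fockRepClosure ι (TO.word μ * star (TO.word ν)))
    rwa [(hω.comp_betaB_pow N).Delta_word, (hω.comp_betaB_pow N).Delta_one, LinearMap.comp_apply,
      LinearMap.comp_apply, betaB_pow_EB, zero_add] at h1
  refine squeeze_zero_norm hb ?_
  simpa using (h.norm.mul_const c).const_mul 4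

lemma sum_beta_iterate_delta (A : BFock ι) (N : ℕ) :
    ∑ i ∈ Finset.range N, beta^[i] (delta A) = A - beta^[N] A := by
  have h : ∀ i, beta^[i] (delta A) = beta^[i] A - beta^[i + 1] A := fun i => by
    rw [delta, iterate_map_sub, Function.iterate_succ_apply]
  simp only [h, Finset.sum_range_sub']
  rfl

theorem isFockNormal_of_tendsto {ω : boundedSupport ι →ₗ[ℂ] ℂ}
    (hω : IsDecreasingLocallyNormal ω) {ρ : TO ι →ₚ[ℂ] ℂ}
    (hρ : ∀ μ ν, ρ (TO.word μ * star (TO.word ν)) = ω (matUnitB μ ν))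
    (h : Tendsto (fun k => ω (EB k)) atTop (𝓝 0)) : IsFockNormal ρ := by
  -- The row units e_{∅μ} factor e_{μν} as e_{∅μ}^* e_{∅ν}, so the matrix of ω ∘ δ is a Gram matrix
  -- in the GNS space of Δω. Its trace is at most Δω(1), since finite word projections are at most
  -- 1.
  have hinner : ∀ μ ν : List ι, ⟪gnsVec (Delta ω) (ofB (matUnitB [] μ)),
      gnsVec (Delta ω) (ofB (matUnitB [] ν))⟫_ℂ = ω (deltaB (matUnitB μ ν)) := fun μ ν => by
    rw [inner_gnsVec, star_ofB, ofB_mul, hω.Delta_ofB]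
    congr 2
    refine Subtype.ext ?_
    change star (matUnit [] μ) * matUnit [] ν = matUnit μ ν
    rw [star_matUnit, matUnit_mul_matUnit_self]
  obtain ⟨φ, hφ, hφm⟩ := exists_normal_gram
    (fun μ => gnsVec (Delta ω) (ofB (matUnitB [] μ))) (by
      refine summable_of_sum_le (c := ‖gnsVec (Delta ω) 1‖ ^ 2) (fun _ => sq_nonneg _)
        fun s => ?_
      have hp : IsStarProjection (ofB (∑ μ ∈ s, matUnitB μ μ)) := by
        refine isStarProjection_of_incl ?_
        rw [incl_ofB, AddSubmonoidClass.coe_finsetSum]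
        exact isStarProjection_wordProj s
      have h1 := OrderHomClass.mono (Delta ω) hp.le_one
      have h2 := norm_gnsVec_sq (Delta ω) 1
      rw [star_one, one_mul] at h2
      rw [hω.Delta_ofB, ← h2, map_sum, map_sum] at h1
      simp only [← hinner, inner_self_eq_norm_sq_to_K, RCLike.ofReal_eq_complex_ofReal] at h1
      exact_mod_cast h1)
  simp only [hinner] at hφm
  have hφB : ∀ B : boundedSupport ι, φ B = ω (deltaB B) := by
    have hLN : IsLocallyNormal (φ ∘ₗ
        (boundedSupport ι).toNonUnitalSubalgebra.toSubmodule.subtype) :=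
      fun _ => ⟨φ, hφ, fun _ _ => rfl⟩
    exact LinearMap.congr_fun (hLN.isApproximable.ext hω.2.2.isApproximable_comp_deltaB hφm)
  refine ⟨φ, hφ, congrFun ((PositiveLinearMap.continuous_complex ρ).ext_on TO.dense_span
    (hφ.continuous.comp (continuous_fockRep)) fun x hx => ?_)⟩
  refine LinearMap.eqOn_span (f := ρ.toLinearMap) (g := φ ∘ₗ (fockRep ι).toLinearMap) ?_ hx
  rintro _ ⟨⟨μ, ν⟩, rfl⟩
  change ρ (TO.word μ * star (TO.word ν)) = φ (fockRep ι (TO.word μ * star (TO.word ν)))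
  rw [hρ, fockRep_word]
  set A := leftWord μ * star (leftWord ν) with hA
  have hd : delta A = matUnit μ ν := delta_leftWord μ ν
  have hcoe : ∀ N, ((∑ i ∈ Finset.range N, (betaB ^ i) (matUnitB μ ν) : boundedSupport ι)
      : BFock ι) = A - beta^[N] A := fun N => by
    rw [← sum_beta_iterate_delta, hd, AddSubmonoidClass.coe_finsetSum]
    exact Finset.sum_congr rfl fun i _ => coe_betaB_pow i _
  -- A - β^N(A) is a finite sum of elements β^i(e_{μν}) of 𝔅, where φ agrees with ω ∘ δ; the
  -- resulting sum telescopes.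
  have hδ : ∀ N, φ (A - beta^[N] A) = ω (matUnitB μ ν) - ω ((betaB ^ N) (matUnitB μ ν)) :=
    fun N => by
      rw [← hcoe, hφB, map_sum, map_sum]
      have h1 : ∀ i, ω (deltaB ((betaB ^ i) (matUnitB μ ν)))
          = ω ((betaB ^ i) (matUnitB μ ν)) - ω ((betaB ^ (i + 1)) (matUnitB μ ν)) := fun i => by
        rw [deltaB_apply, map_sub, pow_succ', Module.End.mul_apply]
      simp only [h1, Finset.sum_range_sub']
      rfl
  have h1 := (hω.tendsto_betaB_pow h μ ν).const_sub (ω (matUnitB μ ν))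
  simp only [← hδ, sub_zero] at h1
  refine tendsto_nhds_unique h1 (hφ.tendsto (C := 2 * ‖A‖) (fun N => ?_)
    (tendsto_inner_of_tendsto fun x => ?_))
  · refine (norm_sub_le _ _).trans ?_
    have := norm_beta_iterate_le N A
    linarith
  · have := isLambda_delta A x
    simpa only [← sum_apply, sum_beta_iterate_delta] using this

end

end ToeplitzCuntz

open ToeplitzCuntz

/-! ### Assembly of the equivalences -/

theorem mainTheorem3 {ι : Type} [Countable ι] [Nonempty ι] (ρ : TO ι →ₚ[ℂ] ℂ) :
    (∃! ω : boundedSupport ι →ₗ[ℂ] ℂ,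
      IsDecreasingLocallyNormal ω ∧ ∀ x, ρ x = Delta ω (fockRepClosure ι x)) ∧
    ∀ ω : boundedSupport ι →ₗ[ℂ] ℂ, IsDecreasingLocallyNormal ω →
      (∀ x, ρ x = Delta ω (fockRepClosure ι x)) →
      (∃! φ, IsDelta ω φ) ∧
      (∃! φ, IsDelta (ω ∘ₗ betaB) φ) ∧
      (∃! Ω, IsDensityMatrix ω Ω) ∧
      ∀ Ω, IsDensityMatrix ω Ω →
        List.TFAE [
          IsEssential ρ,
          ∀ k, ω (EB k) = ω (EB 0),
          ∀ B, ω (deltaB B) = 0,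
          IsKSingular (Delta ω),
          sliceMatrix Ω = Ω,
          ∀ x, ρ x = Delta (ω ∘ₗ betaB) (fockRepClosure ι x)] ∧
        List.TFAE [
          IsSingular ρ,
          Tendsto (fun k => ω (EB k)) atTop (𝓝 0),
          IsFockNormal ρ,
          IsKEssential (Delta ω)] := by
  refine ⟨?_, fun ω hω hρ => ⟨existsUnique_isDelta hω, existsUnique_isDelta hω.comp_betaB,
    existsUnique_isDensityMatrix hω.2.2, fun Ω hΩ => ⟨?_, ?_⟩⟩⟩
  · obtain ⟨ω, hω, h⟩ := exists_decreasingLocallyNormal ρ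
    refine ⟨ω, ⟨hω, (eq_Delta_iff hω ρ).2 h⟩, fun ω' ⟨hω', h'⟩ => ?_⟩
    refine hω'.2.2.isApproximable.ext hω.2.2.isApproximable fun μ ν => ?_
    rw [← h, ← (eq_Delta_iff hω' ρ).1 h']
  · have hm := (eq_Delta_iff hω ρ).1 hρ
    tfae_have 1 ↔ 3 := (isEssential_iff hω.2.2 hm).trans hω.comp_deltaB_eq_zero_iff.symm
    tfae_have 2 ↔ 3 := hω.EB_const_iff
    tfae_have 4 ↔ 3 := hω.isKSingular_iff
    tfae_have 5 ↔ 3 := (sliceMatrix_eq_iff hω.2.2 hΩ).trans hω.comp_deltaB_eq_zero_iff.symm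
    tfae_have 6 ↔ 3 := by
      rw [eq_Delta_iff hω.comp_betaB ρ, hω.comp_deltaB_eq_zero_iff]
      refine forall₂_congr fun μ ν => ?_
      rw [hm, eq_comm]; rfl
    tfae_finish
  · have hm := (eq_Delta_iff hω ρ).1 hρ
    tfae_have 1 → 2 := IsSingular.tendsto hω.2.2 hm
    tfae_have 2 → 4 := isKEssential_of_tendsto hω
    tfae_have 4 → 1 := fun h => h.tendstoProj.isSingular hρ
    tfae_have 2 → 3 := isFockNormal_of_tendsto hω hm
    tfae_have 3 → 2 := IsFockNormal.tendsto hω.2.2 hm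
    tfae_finish
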